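/- Let $N\ge 0$ be an integer. Consider a chain of $N+1$ oscillators with momenta $p=(p_0,\dots,p_N)$ and positions $q=(q_0,\dots,q_N)$, coupled to a left and a right heat bath with variables $r_L,r_R$; the phase space is $\mathcal X=\mathbb R^{2N+4}\ni(p,q,r)$ with Lebesgue measure. For $b\in\{L,R\}$ let $\gamma_b>0$ (relaxation rate), $\lambda_b\neq 0$ (coupling strength) and $T_b>0$ (temperature) be constants, and let $\beta_0>0$ satisfy $1/\beta_0>\max\{T_L,T_R\}$. Write $s_L=r_L-\lambda_L^2q_0$, $s_R=r_R-\lambda_R^2q_N$ and $\tilde q_i=q_i-q_{i-1}$ for $1\le i\le N$. For $\alpha\in\mathbb R$ let $P^\alpha(x)=(1+x^2)^{\alpha/2}$ on $\mathbb R$. Let $\mathcal F_\alpha$ be the set of $C^\infty$ functions $f:\mathbb R\to\mathbb R$ such that for every $k\ge 0$ there is a constant $C_k$ with $|f^{(k)}(x)|\le C_kP^\alpha(x)$ for all $x$, and let $\mathcal F_\alpha^2$ be the set of $C^\infty$ functions $f$ with $f^{(k)}\in\mathcal F_{\alpha-k}$ for $k=0,1,2$. Let $V_1,V_2:\mathbb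 R\to\mathbb R$ satisfy: * (A1) $V_1\in\mathcal F_{2n}^2$ for some real $n>1$, and there are constants $c_1,c_2,c_3>0$ such that $V_1(x)\ge c_1P^{2n}(x)$ and $xV_1'(x)\ge c_2P^{2n}(x)-c_3$ for all $x\in\mathbb R$; * (A2) $V_2\in\mathcal F_{2m}^2$ for some real $m>n$, and there are constants $c_1',c_2',c_3'>0$ such that $V_2(x)\ge c_1'P^{2m}(x)$ and $xV_2'(x)\ge c_2'P^{2m}(x)-c_3'$ for all $x\in\mathbb R$. Define the effective energy $$G(p,q,r)=\sum_{i=0}^N\Bigl(\frac{p_i^2}{2}+V_1(q_i)\Bigr)+\sum_{i=1}^NV_2(\tilde q_i)+\frac{r_L^2}{2\lambda_L^2}+\frac{r_R^2}{2\lambda_R^2}-q_0r_L-q_Nr_R+\Gamma,$$ where the constant $\Gamma$ is chosen such that $G\ge 1$ on $\mathcal X$. Let $K$ be the closure in $L^2(\mathcal X)=L^2(\mathcal X;\mathbb C)$ of the operator given on $C_0^\infty(\mathcal X)$ by $$\begin{aligned}K={}&\alpha_K-c_L^2\partial_{r_L}^2+a_L^2s_L^2-c_R^2\partial_{r_R}^2+a_R^2s_R^2-r_L\partial_{p_0}+b_Ls_L\partial_{r_L}-r_R\partial_{p_N}+b_Rs_R\partial_{r_R}\\&-\sum_{i=0}^N\bigl(p_i\partial_{q_i}-V_1'(q_i)\partial_{p_i}\bigr)+\sum_{i=1}^NV_2'(\tilde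 q_i)\bigl(\partial_{p_i}-\partial_{p_{i-1}}\bigr),\end{aligned}$$ where, for $b\in\{L,R\}$, $$a_b^2=\frac{\gamma_b\beta_0}{\lambda_b^2}(1-\beta_0T_b),\qquad b_b=\gamma_b(1-2\beta_0T_b),\qquad c_b^2=\lambda_b^2\gamma_bT_b,\qquad\alpha_K=\frac{b_L+b_R}{2},$$ and let $K^*$ be its Hilbert space adjoint, with domains $\mathcal D(K)$ and $\mathcal D(K^*)$. Then there exist constants $C$ and $\varepsilon>0$ such that $$\|G^\varepsilon f\|\le C\bigl(\|Kf\|+\|f\|\bigr)\quad\text{for all }f\in\mathcal D(K),\qquad \|G^\varepsilon f\|\le C\bigl(\|K^*f\|+\|f\|\bigr)\quad\text{for all }f\in\mathcal D(K^*),$$ where $\|\cdot\|$ is the norm of $L^2(\mathcal X)$; in particular $G^\varepsilon f\in L^2(\mathcal X)$ in both cases. -/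

import Mathlib

open MeasureTheory Distributions
open scoped ContDiff ENNReal

noncomputable section

/-! ### Growth classes of potentials -/

/-- The weight `P^α(x) = (1 + x²)^{α/2}` on the real line. -/
def growthWeight (α x : ℝ) : ℝ := (1 + x ^ 2) ^ (α / 2)

/-- The class `𝓕_α` (on the real line): smooth functions all of whose derivatives are
bounded by a constant multiple of `P^α`. -/
def GrowthClass (α : ℝ) (f : ℝ → ℝ) : Prop :=
  ContDiff ℝ ∞ f ∧ ∀ k : ℕ, ∃ C : ℝ, ∀ x : ℝ, |iteratedDeriv k f x| ≤ C * growthWeight α x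

/-- The class `𝓕_α^i` (on the real line): smooth functions with `D^k f ∈ 𝓕_{α-k}` for `k ≤ i`. -/
def GrowthClassOrder (α : ℝ) (i : ℕ∞) (f : ℝ → ℝ) : Prop :=
  ContDiff ℝ ∞ f ∧ ∀ k : ℕ, (k : ℕ∞) ≤ i → GrowthClass (α - k) (iteratedDeriv k f)

/-- The growth condition on a potential with exponent `2a`: it is in `𝓕_{2a}^2`, it is
bounded below by a positive multiple of `P^{2a}`, and `x V'(x)` is bounded below by a
positive multiple of `P^{2a}` up to an additive constant. -/
def PotentialGrowth (V : ℝ → ℝ) (a : ℝ) : Prop :=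
  GrowthClassOrder (2 * a) 2 V ∧
  (∃ c₁ : ℝ, 0 < c₁ ∧ ∀ x : ℝ, c₁ * growthWeight (2 * a) x ≤ V x) ∧
  (∃ c₂ c₃ : ℝ, 0 < c₂ ∧ 0 < c₃ ∧
    ∀ x : ℝ, c₂ * growthWeight (2 * a) x - c₃ ≤ x * deriv V x)

/-! ### The chain -/

/-- The data of a chain of `N + 1` oscillators with a heat bath at each end: the one-body
potential, the nearest-neighbour potential, for each bath (`0` is the left one, `1` the right
one) its relaxation rate, coupling strength and temperature, and a reference inverse
temperature `β₀` whose temperature `1 / β₀` is above those of both baths. -/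
structure OscillatorChain (N : ℕ) where
  V₁ : ℝ → ℝ
  V₂ : ℝ → ℝ
  smooth_V₁ : ContDiff ℝ ∞ V₁
  smooth_V₂ : ContDiff ℝ ∞ V₂
  γ : Fin 2 → ℝ
  lam : Fin 2 → ℝ
  T : Fin 2 → ℝ
  β₀ : ℝ
  γ_pos : ∀ b, 0 < γ b
  lam_ne_zero : ∀ b, lam b ≠ 0
  T_pos : ∀ b, 0 < T b
  β₀_pos : 0 < β₀
  T_lt : ∀ b, T b < 1 / β₀

/-- Labels of the coordinates `p_0, …, p_N, q_0, …, q_N, r_L, r_R`. -/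
abbrev ChainCoord (N : ℕ) := Fin (N + 1) ⊕ Fin (N + 1) ⊕ Fin 2

/-- The extended phase space `ℝ^{2N+4}`, with Lebesgue measure. -/
abbrev ChainSpace (N : ℕ) := EuclideanSpace ℝ (ChainCoord N)

/-- The Hilbert space `L²(ℝ^{2N+4})` of complex functions. -/
abbrev ChainL2 (N : ℕ) := Lp ℂ 2 (volume : Measure (ChainSpace N))

namespace ChainCoord

variable {N : ℕ}

/-- The label of the momentum of particle `i`. -/
abbrev p (i : Fin (N + 1)) : ChainCoord N := Sum.inl i

/-- The label of the position of particle `i`. -/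
abbrev q (i : Fin (N + 1)) : ChainCoord N := Sum.inr (Sum.inl i)

/-- The label of the variable of bath `b`. -/
abbrev r (b : Fin 2) : ChainCoord N := Sum.inr (Sum.inr b)

end ChainCoord

/-- The particle to which a bath is attached: the first one for the left bath, the last one for
the right bath. -/
def bathSite (N : ℕ) (b : Fin 2) : Fin (N + 1) := if b = 0 then 0 else Fin.last N

/-- The partial derivative of `f` in the coordinate direction `k`. -/
def chainDeriv {N : ℕ} (k : ChainCoord N) (f : ChainSpace N → ℂ) (x : ChainSpace N) : ℂ :=
  fderiv ℝ f x (EuclideanSpace.single k 1)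

namespace OscillatorChain

open ChainCoord

variable {N : ℕ} (S : OscillatorChain N)

/-- The Hamiltonian of the chain
`H_S = ∑_{i=0}^N (p_i² / 2 + V₁(q_i)) + ∑_{i=1}^N V₂(q_i - q_{i-1})`. -/
def hamiltonian (x : ChainSpace N) : ℝ :=
  ∑ i : Fin (N + 1), (x (p i) ^ 2 / 2 + S.V₁ (x (q i))) +
    ∑ i : Fin N, S.V₂ (x (q i.succ) - x (q i.castSucc))

/-- The effective energy
`G = H_S + ∑_{b = L, R} (r_b² / (2 λ_b²) - q_{site b} r_b) + Γ`. -/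
def energy (Γ : ℝ) (x : ChainSpace N) : ℝ :=
  S.hamiltonian x +
    ∑ b : Fin 2, (x (r b) ^ 2 / (2 * S.lam b ^ 2) - x (q (bathSite N b)) * x (r b)) + Γ

/-- `a_b² = γ_b β₀ (1 - β₀ T_b) / λ_b²`. -/
def aSq (b : Fin 2) : ℝ := S.γ b * S.β₀ / S.lam b ^ 2 * (1 - S.β₀ * S.T b)

/-- `b_b = γ_b (1 - 2 β₀ T_b)`. -/
def bCoef (b : Fin 2) : ℝ := S.γ b * (1 - 2 * S.β₀ * S.T b)

/-- `c_b² = λ_b² γ_b T_b`. -/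
def cSq (b : Fin 2) : ℝ := S.lam b ^ 2 * S.γ b * S.T b

/-- `α_K = b_L / 2 + b_R / 2`. -/
def alphaK : ℝ := ∑ b : Fin 2, S.bCoef b / 2

/-- The variable `r_b - λ_b² q_{site b}`. -/
def bathGap (b : Fin 2) (x : ChainSpace N) : ℝ :=
  x (r b) - S.lam b ^ 2 * x (q (bathSite N b))

/-- The formal differential operator `K`. -/
def formalK (f : ChainSpace N → ℂ) (x : ChainSpace N) : ℂ :=
  (S.alphaK : ℂ) * f x +
  ∑ b : Fin 2,
    (-(S.cSq b : ℂ) * chainDeriv (r b) (chainDeriv (r b) f) x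
      + ((S.aSq b * S.bathGap b x ^ 2 : ℝ) : ℂ) * f x
      - (x (r b) : ℂ) * chainDeriv (p (bathSite N b)) f x
      + ((S.bCoef b * S.bathGap b x : ℝ) : ℂ) * chainDeriv (r b) f x) -
  ∑ i : Fin (N + 1),
    ((x (p i) : ℂ) * chainDeriv (q i) f x
      - ((deriv S.V₁ (x (q i)) : ℝ) : ℂ) * chainDeriv (p i) f x) +
  ∑ i : Fin N,
    ((deriv S.V₂ (x (q i.succ) - x (q i.castSucc)) : ℝ) : ℂ) *
      (chainDeriv (p i.succ) f x - chainDeriv (p i.castSucc) f x)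

/-! ### Realization of `K` on `L²` -/

theorem contDiff_chainDeriv {k : ChainCoord N} {f : ChainSpace N → ℂ} (hf : ContDiff ℝ ∞ f) :
    ContDiff ℝ ∞ (chainDeriv k f) :=
  (hf.fderiv_right (m := ∞) (by simp)).clm_apply contDiff_const

theorem tsupport_chainDeriv {k : ChainCoord N} {f : ChainSpace N → ℂ} :
    tsupport (chainDeriv k f) ⊆ tsupport f :=
  tsupport_fderiv_apply_subset ℝ _

theorem continuous_formalK {f : ChainSpace N → ℂ} (hf : ContDiff ℝ ∞ f) :
    Continuous (S.formalK f) := by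
  have h1 : ∀ k, Continuous (chainDeriv k f) := fun k => (contDiff_chainDeriv hf).continuous
  have h2 : ∀ k, Continuous (chainDeriv k (chainDeriv k f)) :=
    fun k => (contDiff_chainDeriv (contDiff_chainDeriv hf)).continuous
  have h0 : Continuous f := hf.continuous
  have hV1 : Continuous (deriv S.V₁) := S.smooth_V₁.continuous_deriv (by simp)
  have hV2 : Continuous (deriv S.V₂) := S.smooth_V₂.continuous_deriv (by simp)
  unfold formalK bathGap
  fun_prop

theorem formalK_eq_zero {f : ChainSpace N → ℂ} {x : ChainSpace N} (hx : x ∉ tsupport f) :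
    S.formalK f x = 0 := by
  have h0 : f x = 0 := image_eq_zero_of_notMem_tsupport hx
  have h1 : ∀ k, chainDeriv k f x = 0 := fun k =>
    image_eq_zero_of_notMem_tsupport fun h => hx (tsupport_chainDeriv h)
  have h2 : ∀ k, chainDeriv k (chainDeriv k f) x = 0 := fun k =>
    image_eq_zero_of_notMem_tsupport fun h => hx (tsupport_chainDeriv (tsupport_chainDeriv h))
  simp [formalK, h0, h1, h2]

theorem memLp_formalK (φ : 𝓓((⊤ : TopologicalSpace.Opens (ChainSpace N)), ℂ)) :
    MemLp (S.formalK φ) 2 (volume : Measure (ChainSpace N)) :=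
  (S.continuous_formalK φ.contDiff).memLp_of_hasCompactSupport
    (HasCompactSupport.intro φ.hasCompactSupport fun _ hx => S.formalK_eq_zero hx)

theorem chainDeriv_add {k : ChainCoord N} {f g : ChainSpace N → ℂ} (hf : ContDiff ℝ ∞ f)
    (hg : ContDiff ℝ ∞ g) : chainDeriv k (f + g) = chainDeriv k f + chainDeriv k g := by
  funext x
  simp only [chainDeriv, Pi.add_apply]
  rw [fderiv_add (hf.differentiable (by simp) x) (hg.differentiable (by simp) x)]
  rfl

theorem chainDeriv_smul {k : ChainCoord N} (c : ℂ) (f : ChainSpace N → ℂ) :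
    chainDeriv k (c • f) = c • chainDeriv k f := by
  funext x
  simp only [chainDeriv, Pi.smul_apply]
  rw [fderiv_const_smul_field]
  rfl

theorem formalK_add {f g : ChainSpace N → ℂ} (hf : ContDiff ℝ ∞ f) (hg : ContDiff ℝ ∞ g) :
    S.formalK (f + g) = S.formalK f + S.formalK g := by
  funext x
  simp only [formalK, chainDeriv_add hf hg,
    chainDeriv_add (contDiff_chainDeriv hf) (contDiff_chainDeriv hg), Pi.add_apply, mul_add,
    mul_sub, Finset.sum_add_distrib, Finset.sum_sub_distrib]
  ring

theorem formalK_smul (c : ℂ) (f : ChainSpace N → ℂ) :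
    S.formalK (c • f) = c • S.formalK f := by
  funext x
  simp only [formalK, chainDeriv_smul, Pi.smul_apply, smul_eq_mul, mul_add, mul_sub,
    Finset.mul_sum]
  simp only [mul_left_comm c]

theorem memLp_testFunction (φ : 𝓓((⊤ : TopologicalSpace.Opens (ChainSpace N)), ℂ)) :
    MemLp φ 2 (volume : Measure (ChainSpace N)) :=
  φ.continuous.memLp_of_hasCompactSupport φ.hasCompactSupport

variable (N) in
/-- The inclusion of `C_0^∞(ℝ^{2N+4})` into `L²`. -/
def testToL2 : 𝓓((⊤ : TopologicalSpace.Opens (ChainSpace N)), ℂ) →ₗ[ℂ] ChainL2 N where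
  toFun φ := (memLp_testFunction φ).toLp φ
  map_add' _ _ := rfl
  map_smul' _ _ := rfl

theorem testToL2_injective : Function.Injective (testToL2 N) := by
  intro φ ψ h
  have h' := (MemLp.toLp_eq_toLp_iff (memLp_testFunction φ) (memLp_testFunction ψ)).1 h
  exact DFunLike.coe_injective (Continuous.ae_eq_iff_eq volume φ.continuous ψ.continuous |>.1 h')

/-- The formal operator `K` as a linear map from test functions to `L²`. -/
def testK : 𝓓((⊤ : TopologicalSpace.Opens (ChainSpace N)), ℂ) →ₗ[ℂ] ChainL2 N where
  toFun φ := (S.memLp_formalK φ).toLp (S.formalK φ)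
  map_add' φ ψ := by
    rw [← MemLp.toLp_add]
    exact MemLp.toLp_congr _ _ (ae_of_all _ (congrFun (S.formalK_add φ.contDiff ψ.contDiff)))
  map_smul' c φ := by
    rw [RingHom.id_apply, ← MemLp.toLp_const_smul]
    exact MemLp.toLp_congr _ _ (ae_of_all _ (congrFun (S.formalK_smul c φ)))

/-- The unbounded operator on `L²` with domain `C_0^∞` given by the formal operator `K`. -/
def minimalK : ChainL2 N →ₗ.[ℂ] ChainL2 N where
  domain := LinearMap.range (testToL2 N)
  toFun := S.testK ∘ₗ (LinearEquiv.ofInjective (testToL2 N) testToL2_injective).symm.toLinearMap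

/-- The operator `K` on `L²(ℝ^{2N+4})`: the closure of the formal operator on `C_0^∞`. -/
def opK : ChainL2 N →ₗ.[ℂ] ChainL2 N := S.minimalK.closure

end OscillatorChain

end

/-!
The proof is elementary: it replaces pseudodifferential calculus by explicit multipliers, and works
with real functions throughout, since the coefficients of `K` are real (`map_formalK`). Write
`K = α_K + ∑_b (-c_b² ∂_{r_b}² + a_b² s_b²) - Z` with a vector field `Z` of divergence `-2 α_K`; the
formal adjoint differs by the signs of `α_K` and `Z` only, and both are handled at once by `realK σ`,
`σ = ±1`.

*A priori estimate.* Call a weight `ψ` controlled if `∫ ψ f² ≤ C (‖Kf‖² + ‖f‖²)` for all test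
functions `f`, and likewise for the formal adjoint (`Controlled`). Integration by parts shows that
`∫ f K f` dominates the bath derivatives of `f` and `∫ s_b² f²`, and that `∫ (Zφ) f²` is bounded by
the squared graph norm whenever `φ` and `∂_{r_b} φ` are bounded (`Controlled.of_along`). Call `U`
subcritical at `a` if `U² G^{δ - 2a}` is controlled for some `δ > 0` (`Subcritical`). If `U` is
subcritical and `Z U = W` up to a subcritical error, the multiplier
`φ = arctan (U G^{δ - α}) W G^{α - 2β}` shows that `W` is subcritical too (`Subcritical.propagate`).
Starting from the bath gap `s_L`, this propagates to `p_0`, to the force of the first bond and hence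
to its elongation, to `p_1`, and so on along the chain; here `m > n` makes the pinning forces
negligible against the bond forces. In the derivative of the total momentum the bond forces cancel,
so that the pinning forces, and with them the positions, are subcritical as well. As `G` is bounded
by the critical powers of all these quantities, some power `G^δ` is controlled
(`EnergyBounds.exists_controlled_rpow`), which is the claim for test functions with `ε = δ / 2`.

*From test functions to the domains.* For `K` the estimate passes to the closure by Fatou's lemma.
For `f` in the domain of `K*`, the real and imaginary parts of `f` are weak solutions of the formal
adjoint equation. Multiplication by a cutoff `χ (G / R)` is bounded in the graph norm uniformly in `R`
(`EnergyBounds.exists_graphSq_energyCut_le`), because the derivatives of `G / R` in the bath variables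
and along `Z` are bounded where `G ≤ 2R`. Mollifications of a weak solution converge to it locally in
the graph norm (`IsWeakSolution.tendsto_eLpNorm_realK_mollify_sub`), by a commutator argument for
first-order operators with locally Lipschitz coefficients; the second-order part has constant
coefficients and commutes with mollification. The estimate for test functions, applied to cut off
mollifications, thus gives the one for `f` on every sublevel set of `G`, with a uniform constant.
-/

/-! ### The formal operators on real functions -/

noncomputable section

namespace OscillatorChain

open ChainCoord

variable {N : ℕ} (S : OscillatorChain N)

/-- The partial derivative of a real function in the coordinate direction `k`. -/
def pd (k : ChainCoord N) (f : ChainSpace N → ℝ) (x : ChainSpace N) : ℝ :=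
  fderiv ℝ f x (EuclideanSpace.single k 1)

/-- The elongation `q_{j+1} - q_j` of a bond. -/
def bond (j : Fin N) (x : ChainSpace N) : ℝ := x (q j.succ) - x (q j.castSucc)

/-- The vector field `Z` in the first-order part of `K`, so that
`K = α_K + ∑_b (-c_b² ∂_{r_b}² + a_b² s_b²) - Z`. -/
def drift (x : ChainSpace N) : ChainSpace N :=
  ∑ b : Fin 2, (x (r b) • EuclideanSpace.single (p (bathSite N b)) (1 : ℝ)
      - (S.bCoef b * S.bathGap b x) • EuclideanSpace.single (r b) (1 : ℝ)) +
  ∑ i : Fin (N + 1), (x (p i) • EuclideanSpace.single (q i) (1 : ℝ)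
      - deriv S.V₁ (x (q i)) • EuclideanSpace.single (p i) (1 : ℝ)) -
  ∑ j : Fin N, deriv S.V₂ (bond j x) •
      (EuclideanSpace.single (p j.succ) (1 : ℝ) - EuclideanSpace.single (p j.castSucc) (1 : ℝ))

/-- The derivative of a real function along the vector field `Z`. -/
def along (f : ChainSpace N → ℝ) (x : ChainSpace N) : ℝ := fderiv ℝ f x (S.drift x)

/-- The real differential operator `σ α_K + ∑_b (-c_b² ∂_{r_b}² + a_b² s_b²) - σ Z`; it is `K` for
`σ = 1` and the formal adjoint of `K` for `σ = -1`. -/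
def realK (σ : ℝ) (f : ChainSpace N → ℝ) (x : ChainSpace N) : ℝ :=
  σ * S.alphaK * f x +
    ∑ b : Fin 2, (-S.cSq b * pd (r b) (pd (r b) f) x + S.aSq b * S.bathGap b x ^ 2 * f x)
    - σ * S.along f x

variable {S}

/-! #### Regularity -/

@[fun_prop]
theorem contDiff_coord (k : ChainCoord N) : ContDiff ℝ ∞ fun x : ChainSpace N => x k :=
  (EuclideanSpace.proj (𝕜 := ℝ) k).contDiff

@[fun_prop]
theorem contDiff_bond (j : Fin N) : ContDiff ℝ ∞ (bond (N := N) j) := by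
  unfold bond; fun_prop

@[fun_prop]
theorem contDiff_bathGap (b : Fin 2) : ContDiff ℝ ∞ (S.bathGap b) := by
  unfold bathGap; fun_prop

theorem contDiff_deriv_V₁ : ContDiff ℝ ∞ (deriv S.V₁) :=
  (contDiff_infty_iff_deriv.1 S.smooth_V₁).2

theorem contDiff_deriv_V₂ : ContDiff ℝ ∞ (deriv S.V₂) :=
  (contDiff_infty_iff_deriv.1 S.smooth_V₂).2

@[fun_prop]
theorem contDiff_drift : ContDiff ℝ ∞ S.drift := by
  have h1 (i : Fin (N + 1)) : ContDiff ℝ ∞ fun x : ChainSpace N => deriv S.V₁ (x (q i)) :=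
    contDiff_deriv_V₁.comp (contDiff_coord _)
  have h2 (j : Fin N) : ContDiff ℝ ∞ fun x : ChainSpace N => deriv S.V₂ (bond j x) :=
    contDiff_deriv_V₂.comp (contDiff_bond _)
  unfold drift
  fun_prop

theorem contDiff_pd {k : ChainCoord N} {f : ChainSpace N → ℝ} (hf : ContDiff ℝ ∞ f) :
    ContDiff ℝ ∞ (pd k f) :=
  (hf.fderiv_right (m := ∞) (by simp)).clm_apply contDiff_const

theorem contDiff_along {f : ChainSpace N → ℝ} (hf : ContDiff ℝ ∞ f) :
    ContDiff ℝ ∞ (S.along f) :=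
  (hf.fderiv_right (m := ∞) (by simp)).clm_apply contDiff_drift

theorem continuous_realK {f : ChainSpace N → ℝ} (hf : ContDiff ℝ ∞ f) (σ : ℝ) :
    Continuous (S.realK σ f) := by
  have h1 (b : Fin 2) : Continuous (pd (r b) (pd (N := N) (r b) f)) :=
    (contDiff_pd (contDiff_pd hf)).continuous
  have h2 : Continuous (S.along f) := (contDiff_along hf).continuous
  have h3 (b : Fin 2) : Continuous (S.bathGap b) := (contDiff_bathGap b).continuous
  have h4 := hf.continuous
  unfold realK
  fun_prop

theorem pd_eq_zero_of_notMem {k : ChainCoord N} {f : ChainSpace N → ℝ} {x : ChainSpace N}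
    (hx : x ∉ tsupport f) : pd k f x = 0 :=
  image_eq_zero_of_notMem_tsupport fun h => hx (tsupport_fderiv_apply_subset ℝ _ h)

theorem pd_pd_eq_zero_of_notMem {k : ChainCoord N} {f : ChainSpace N → ℝ} {x : ChainSpace N}
    (hx : x ∉ tsupport f) : pd k (pd k f) x = 0 :=
  pd_eq_zero_of_notMem fun h => hx (tsupport_fderiv_apply_subset ℝ _ h)

theorem along_eq_zero_of_notMem {f : ChainSpace N → ℝ} {x : ChainSpace N}
    (hx : x ∉ tsupport f) : S.along f x = 0 := by
  have : fderiv ℝ f x = 0 := image_eq_zero_of_notMem_tsupport fun h => hx (tsupport_fderiv_subset ℝ h)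
  simp [along, this]

theorem realK_eq_zero_of_notMem {σ : ℝ} {f : ChainSpace N → ℝ} {x : ChainSpace N}
    (hx : x ∉ tsupport f) : S.realK σ f x = 0 := by
  simp [realK, image_eq_zero_of_notMem_tsupport hx, pd_pd_eq_zero_of_notMem hx,
    along_eq_zero_of_notMem hx]

/-! #### Calculus rules -/

theorem pd_mul {k : ChainCoord N} {f g : ChainSpace N → ℝ} (hf : ContDiff ℝ ∞ f)
    (hg : ContDiff ℝ ∞ g) (x : ChainSpace N) :
    pd k (fun y => f y * g y) x = pd k f x * g x + f x * pd k g x := by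
  simp only [pd]
  rw [fderiv_fun_mul (hf.differentiable (by simp) x) (hg.differentiable (by simp) x)]
  simp; ring

theorem along_mul {f g : ChainSpace N → ℝ} (hf : ContDiff ℝ ∞ f)
    (hg : ContDiff ℝ ∞ g) (x : ChainSpace N) :
    S.along (fun y => f y * g y) x = S.along f x * g x + f x * S.along g x := by
  simp only [along]
  rw [fderiv_fun_mul (hf.differentiable (by simp) x) (hg.differentiable (by simp) x)]
  simp; ring

theorem along_comp {h h' : ℝ → ℝ} {f : ChainSpace N → ℝ} (hf : ContDiff ℝ ∞ f) {x : ChainSpace N}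
    (hh : HasDerivAt h (h' (f x)) (f x)) :
    S.along (fun y => h (f y)) x = h' (f x) * S.along f x := by
  have := hh.comp_hasFDerivAt x (hf.differentiable (by simp) x).hasFDerivAt
  simp only [along]
  erw [this.fderiv]
  simp

theorem pd_comp {k : ChainCoord N} {h h' : ℝ → ℝ} {f : ChainSpace N → ℝ} (hf : ContDiff ℝ ∞ f)
    {x : ChainSpace N} (hh : HasDerivAt h (h' (f x)) (f x)) :
    pd k (fun y => h (f y)) x = h' (f x) * pd k f x := by
  have := hh.comp_hasFDerivAt x (hf.differentiable (by simp) x).hasFDerivAt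
  simp only [pd]
  erw [this.fderiv]
  simp

theorem along_coord (k : ChainCoord N) (x : ChainSpace N) :
    S.along (fun y => y k) x = S.drift x k := by
  have : HasFDerivAt (fun y : ChainSpace N => y k) (EuclideanSpace.proj (𝕜 := ℝ) k) x :=
    (EuclideanSpace.proj (𝕜 := ℝ) k).hasFDerivAt
  simp [along, this.fderiv]

theorem pd_coord (k l : ChainCoord N) (x : ChainSpace N) :
    pd k (fun y => y l) x = if l = k then 1 else 0 := by
  have : HasFDerivAt (fun y : ChainSpace N => y l) (EuclideanSpace.proj (𝕜 := ℝ) l) x :=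
    (EuclideanSpace.proj (𝕜 := ℝ) l).hasFDerivAt
  simp [pd, this.fderiv]

/-- A function that is invariant under translations in a coordinate direction has vanishing
derivative in that direction. -/
theorem pd_eq_zero_of_invariant {k : ChainCoord N} {f : ChainSpace N → ℝ} (hf : ContDiff ℝ ∞ f)
    (h : ∀ (x : ChainSpace N) (t : ℝ), f (x + t • EuclideanSpace.single k (1 : ℝ)) = f x)
    (x : ChainSpace N) : pd k f x = 0 := by
  rw [pd, ← (hf.differentiable (by simp) x).lineDeriv_eq_fderiv, lineDeriv]
  simp [h]

theorem along_eq (f : ChainSpace N → ℝ) (x : ChainSpace N) :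
    S.along f x = ∑ b : Fin 2, (x (r b) * pd (p (bathSite N b)) f x
        - (S.bCoef b * S.bathGap b x) * pd (r b) f x) +
      ∑ i : Fin (N + 1), (x (p i) * pd (q i) f x - deriv S.V₁ (x (q i)) * pd (p i) f x) -
      ∑ j : Fin N, (deriv S.V₂ (bond j x) * pd (p j.succ) f x
        - deriv S.V₂ (bond j x) * pd (p j.castSucc) f x) := by
  simp [along, drift, pd, mul_sub]

/-! #### Integration by parts -/

theorem integral_mul_pd {k : ChainCoord N} {c w : ChainSpace N → ℝ} (hc : ContDiff ℝ ∞ c)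
    (hw : ContDiff ℝ ∞ w) (hs : HasCompactSupport w) :
    ∫ x, c x * pd k w x = - ∫ x, pd k c x * w x := by
  have h1 := (contDiff_pd (k := k) hc).continuous
  have h2 := (contDiff_pd (k := k) hw).continuous
  have h3 := hc.continuous
  have h4 := hw.continuous
  refine integral_mul_fderiv_eq_neg_fderiv_mul_of_integrable ?_ ?_ ?_
    (fun x _ => hc.differentiable (by simp) x) (fun x _ => hw.differentiable (by simp) x)
  · exact (h1.mul h4).integrable_of_hasCompactSupport (hs.mul_left)
  · exact (h3.mul h2).integrable_of_hasCompactSupport (HasCompactSupport.intro hs fun x hx => by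
      simp [pd_eq_zero_of_notMem hx])
  · exact (h3.mul h4).integrable_of_hasCompactSupport (hs.mul_left)

theorem integral_pd {k : ChainCoord N} {w : ChainSpace N → ℝ}
    (hw : ContDiff ℝ ∞ w) (hs : HasCompactSupport w) : ∫ x, pd k w x = 0 := by
  have := integral_mul_pd (k := k) (c := fun _ => 1) contDiff_const hw hs
  simpa [pd] using this

/-- The divergence of the vector field `Z` is the constant `-2 α_K`. -/
theorem integral_along {w : ChainSpace N → ℝ} (hw : ContDiff ℝ ∞ w) (hs : HasCompactSupport w) :
    ∫ x, S.along w x = 2 * S.alphaK * ∫ x, w x := by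
  have int {k : ChainCoord N} {c : ChainSpace N → ℝ} (hc : ContDiff ℝ ∞ c) :
      Integrable fun x => c x * pd k w x :=
    (hc.continuous.mul (contDiff_pd hw).continuous).integrable_of_hasCompactSupport
      (HasCompactSupport.intro hs fun x hx => by simp [pd_eq_zero_of_notMem hx])
  have zero {k : ChainCoord N} {c : ChainSpace N → ℝ} (hc : ContDiff ℝ ∞ c)
      (h : ∀ (x : ChainSpace N) (t : ℝ), c (x + t • EuclideanSpace.single k (1 : ℝ)) = c x) :
      ∫ x, c x * pd k w x = 0 := by
    rw [integral_mul_pd hc hw hs]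
    simp [pd_eq_zero_of_invariant hc h]
  have c1 (i : Fin (N + 1)) : ContDiff ℝ ∞ fun x : ChainSpace N => deriv S.V₁ (x (q i)) :=
    contDiff_deriv_V₁.comp (contDiff_coord _)
  have c2 (j : Fin N) : ContDiff ℝ ∞ fun x : ChainSpace N => deriv S.V₂ (bond j x) :=
    contDiff_deriv_V₂.comp (contDiff_bond _)
  have c3 (b : Fin 2) : ContDiff ℝ ∞ fun x : ChainSpace N => S.bCoef b * S.bathGap b x :=
    contDiff_const.mul (contDiff_bathGap b)
  have c4 (k : ChainCoord N) : ContDiff ℝ ∞ fun x : ChainSpace N => x k := contDiff_coord k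
  have hb (b : Fin 2) : ∫ x, (S.bCoef b * S.bathGap b x) * pd (r b) w x
      = - (S.bCoef b * ∫ x, w x) := by
    rw [integral_mul_pd (c3 b) hw hs, ← integral_const_mul]
    congr 2
    funext x
    have e : (fun x => S.bCoef b * S.bathGap b x) = fun x : ChainSpace N =>
      S.bCoef b * x (r b) - S.bCoef b * (S.lam b ^ 2 * x (q (bathSite N b))) := by
      funext x; simp [bathGap, mul_sub]
    have h1 : HasFDerivAt (fun x : ChainSpace N =>
        S.bCoef b * x (r b) - S.bCoef b * (S.lam b ^ 2 * x (q (bathSite N b))))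
        (S.bCoef b • EuclideanSpace.proj (𝕜 := ℝ) (r b) -
          S.bCoef b • S.lam b ^ 2 • EuclideanSpace.proj (𝕜 := ℝ) (q (bathSite N b))) x :=
      ((EuclideanSpace.proj (𝕜 := ℝ) (r b)).hasFDerivAt.const_mul _).sub
      (((EuclideanSpace.proj (𝕜 := ℝ) (q (bathSite N b))).hasFDerivAt.const_mul _).const_mul _)
    rw [e, pd, h1.fderiv]
    simp
  simp only [along_eq]
  rw [integral_sub, integral_add, integral_finsetSum, integral_finsetSum, integral_finsetSum]
  · have e1 : ∀ b : Fin 2, ∫ x : ChainSpace N, (x (r b) * pd (p (bathSite N b)) w x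
        - (S.bCoef b * S.bathGap b x) * pd (r b) w x) = S.bCoef b * ∫ x, w x := fun b => by
      rw [integral_sub (int (c4 _)) (int (c3 b)), hb, zero (c4 _) (by simp)]
      ring
    have e2 : ∀ i : Fin (N + 1), ∫ x : ChainSpace N,
        (x (p i) * pd (q i) w x - deriv S.V₁ (x (q i)) * pd (p i) w x) = 0 := fun i => by
      rw [integral_sub (int (c4 _)) (int (c1 i)), zero (c4 _) (by simp), zero (c1 i) (by simp)]
      ring
    have e3 : ∀ j : Fin N, ∫ x : ChainSpace N, (deriv S.V₂ (bond j x) * pd (p j.succ) w x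
        - deriv S.V₂ (bond j x) * pd (p j.castSucc) w x) = 0 := fun j => by
      rw [integral_sub (int (c2 j)) (int (c2 j)), zero (c2 j) (by simp [bond]),
        zero (c2 j) (by simp [bond])]
      ring
    simp only [e1, e2, e3, alphaK, Fin.sum_univ_two, Finset.sum_const_zero]
    ring
  · exact fun j _ => (int (c2 j)).sub (int (c2 j))
  · exact fun i _ => (int (c4 _)).sub (int (c1 i))
  · exact fun b _ => (int (c4 _)).sub (int (c3 b))
  · exact integrable_finsetSum _ fun b _ => (int (c4 _)).sub (int (c3 b))
  · exact integrable_finsetSum _ fun i _ => (int (c4 _)).sub (int (c1 i))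
  · exact (integrable_finsetSum _ fun b _ => (int (c4 _)).sub (int (c3 b))).add
      (integrable_finsetSum _ fun i _ => (int (c4 _)).sub (int (c1 i)))
  · exact integrable_finsetSum _ fun j _ => (int (c2 j)).sub (int (c2 j))

/-- The energy identity: testing `K f` or its formal adjoint against `φ f` leaves the dissipative
terms in the bath variables and half the derivative of `φ` along `Z`. -/
theorem integral_mul_realK (σ : ℝ) {f φ : ChainSpace N → ℝ} (hf : ContDiff ℝ ∞ f)
    (hφ : ContDiff ℝ ∞ φ) (hs : HasCompactSupport f ∨ HasCompactSupport φ) :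
    ∫ x, (φ x * f x * S.realK σ f x - ∑ b : Fin 2,
        (S.cSq b * (φ x * pd (r b) f x ^ 2 + pd (r b) φ x * f x * pd (r b) f x)
          + S.aSq b * (φ x * S.bathGap b x ^ 2 * f x ^ 2))
        - σ / 2 * S.along φ x * f x ^ 2) = 0 := by
  have hw : ContDiff ℝ ∞ fun x => φ x * (f x * f x) := hφ.mul (hf.mul hf)
  have hws : HasCompactSupport fun x => φ x * (f x * f x) := by
    rcases hs with hs | hs
    · exact (hs.mul_left).mul_left
    · exact hs.mul_right
  have hv (b : Fin 2) : ContDiff ℝ ∞ fun x => (φ x * f x) * pd (r b) f x :=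
    (hφ.mul hf).mul (contDiff_pd hf)
  have hvs (b : Fin 2) : HasCompactSupport fun x => (φ x * f x) * pd (r b) f x := by
    rcases hs with hs | hs
    · exact (hs.mul_left (f := φ)).mul_right
    · exact (hs.mul_right (f' := f)).mul_right
  have int1 (b : Fin 2) : Integrable (pd (r b) fun x => (φ x * f x) * pd (r b) f x) :=
    (contDiff_pd (hv b)).continuous.integrable_of_hasCompactSupport
      (HasCompactSupport.intro (hvs b) fun x hx => pd_eq_zero_of_notMem hx)
  have int2 : Integrable (S.along fun x => φ x * (f x * f x)) :=
    (contDiff_along hw).continuous.integrable_of_hasCompactSupport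
      (HasCompactSupport.intro hws fun x hx => along_eq_zero_of_notMem hx)
  have int3 : Integrable fun x => φ x * (f x * f x) :=
    hw.continuous.integrable_of_hasCompactSupport hws
  have key : ∀ x, (φ x * f x * S.realK σ f x - ∑ b : Fin 2,
        (S.cSq b * (φ x * pd (r b) f x ^ 2 + pd (r b) φ x * f x * pd (r b) f x)
          + S.aSq b * (φ x * S.bathGap b x ^ 2 * f x ^ 2))
        - σ / 2 * S.along φ x * f x ^ 2) =
      ∑ b : Fin 2, (-S.cSq b) * pd (r b) (fun x => (φ x * f x) * pd (r b) f x) x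
        + (σ * S.alphaK * (φ x * (f x * f x)) - σ / 2 * S.along (fun x => φ x * (f x * f x)) x) := by
    intro x
    simp only [pd_mul (hφ.mul hf) (contDiff_pd hf), pd_mul hφ hf, along_mul hφ (hf.mul hf),
      along_mul hf hf, realK, Fin.sum_univ_two]
    ring
  simp only [key]
  rw [integral_add, integral_finsetSum, integral_sub]
  · simp only [integral_const_mul, integral_pd (hv _) (hvs _), integral_along hw hws]
    simp
    ring
  · exact int3.const_mul _
  · exact int2.const_mul _
  · exact fun b _ => (int1 b).const_mul _
  · exact integrable_finsetSum _ fun b _ => (int1 b).const_mul _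
  · exact (int3.const_mul _).sub (int2.const_mul _)

end OscillatorChain

end

/-! ### Growth of the energy -/

noncomputable section

open Asymptotics

theorem one_le_one_add_sq (x : ℝ) : 1 ≤ 1 + x ^ 2 := by nlinarith [sq_nonneg x]

namespace PotentialGrowth

variable {V : ℝ → ℝ} {a : ℝ}

theorem abs_le (h : PotentialGrowth V a) : ∃ C, ∀ x, |V x| ≤ C * (1 + x ^ 2) ^ a := by
  obtain ⟨C, hC⟩ := (h.1.2 0 (by simp)).2 0
  refine ⟨C, fun x => ?_⟩
  simpa [growthWeight] using hC x

theorem abs_deriv_le (h : PotentialGrowth V a) :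
    ∃ C, ∀ x, |deriv V x| ≤ C * (1 + x ^ 2) ^ (a - 1 / 2) := by
  obtain ⟨C, hC⟩ := (h.1.2 1 (by simp)).2 0
  refine ⟨C, fun x => ?_⟩
  have := hC x
  simp only [iteratedDeriv_zero, iteratedDeriv_one, growthWeight] at this
  convert this using 3
  push_cast; ring

theorem abs_deriv_deriv_le (h : PotentialGrowth V a) :
    ∃ C, ∀ x, |deriv (deriv V) x| ≤ C * (1 + x ^ 2) ^ (a - 1) := by
  obtain ⟨C, hC⟩ := (h.1.2 2 (by simp)).2 0
  refine ⟨C, fun x => ?_⟩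
  have := hC x
  rw [iteratedDeriv_zero, iteratedDeriv_succ, iteratedDeriv_one] at this
  convert this using 3
  simp only [growthWeight]
  push_cast; ring_nf

theorem le (h : PotentialGrowth V a) : ∃ c, 0 < c ∧ ∀ x, c * (1 + x ^ 2) ^ a ≤ V x := by
  obtain ⟨c, hc, h⟩ := h.2.1
  refine ⟨c, hc, fun x => ?_⟩
  simpa [growthWeight] using h x

/-- The force dominates the critical power of the position. -/
theorem le_abs_deriv (h : PotentialGrowth V a) :
    ∃ C, 0 ≤ C ∧ ∀ x, (1 + x ^ 2) ^ (a - 1 / 2) ≤ C * (1 + |deriv V x|) := by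
  obtain ⟨c₂, c₃, h2, h3, h⟩ := h.2.2
  refine ⟨(1 + c₃) / c₂, by positivity, fun x => ?_⟩
  have hx := h x
  have e : growthWeight (2 * a) x = (1 + x ^ 2) ^ (1 / 2 : ℝ) * (1 + x ^ 2) ^ (a - 1 / 2) := by
    rw [← Real.rpow_add (by positivity), growthWeight]; congr 1; ring
  have hroot : |x| ≤ (1 + x ^ 2) ^ (1 / 2 : ℝ) := by
    rw [← Real.sqrt_eq_rpow]
    exact Real.abs_le_sqrt (by linarith)
  have hroot1 : 1 ≤ (1 + x ^ 2) ^ (1 / 2 : ℝ) :=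
    Real.one_le_rpow (one_le_one_add_sq x) (by norm_num)
  have hx2 : x * deriv V x ≤ (1 + x ^ 2) ^ (1 / 2 : ℝ) * |deriv V x| :=
    (le_abs_self _).trans (by rw [abs_mul]; gcongr)
  rw [e] at hx
  set y := (1 + x ^ 2) ^ (1 / 2 : ℝ)
  have h5 : y * (c₂ * (1 + x ^ 2) ^ (a - 1 / 2)) ≤ y * (c₃ + |deriv V x|) := by nlinarith
  have h6 := le_of_mul_le_mul_left h5 (by linarith)
  rw [div_mul_eq_mul_div, le_div_iff₀ h2]
  nlinarith [abs_nonneg (deriv V x), mul_nonneg h3.le (abs_nonneg (deriv V x))]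

end PotentialGrowth

/-- A superlinear power absorbs any linear function up to a constant. -/
theorem exists_linear_le_rpow {n : ℝ} (hn : 1 < n) {κ L : ℝ} (hκ : 0 < κ) (hL : 0 ≤ L) :
    ∃ C, 0 ≤ C ∧ ∀ y : ℝ, 1 ≤ y → L * y ≤ κ * y ^ n + C := by
  refine ⟨L * (L / κ) ^ (1 / (n - 1)), by positivity, fun y hy => ?_⟩
  have hy0 : 0 < y := by linarith
  by_cases h : L / κ ≤ y ^ (n - 1)
  · have e : y ^ n = y ^ (n - 1) * y := by
      rw [← Real.rpow_add_one hy0.ne']; ring_nf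
    have h1 : L ≤ κ * y ^ (n - 1) := by rw [div_le_iff₀ hκ] at h; linarith
    have h2 : 0 ≤ L * (L / κ) ^ (1 / (n - 1)) := by positivity
    rw [e]
    nlinarith
  · push Not at h
    have h1 : y ≤ (L / κ) ^ (1 / (n - 1)) := by
      have := Real.rpow_le_rpow (by positivity) h.le (z := 1 / (n - 1))
        (by apply one_div_nonneg.2; linarith)
      rwa [← Real.rpow_mul hy0.le, mul_one_div_cancel (by linarith), Real.rpow_one] at this
    have h3 : 0 ≤ κ * y ^ n := by positivity
    nlinarith

namespace OscillatorChain

open ChainCoord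

variable {N : ℕ} {S : OscillatorChain N}

theorem cSq_pos (b : Fin 2) : 0 < S.cSq b := by
  have := S.γ_pos b
  have := S.T_pos b
  have := pow_pos (abs_pos.2 (S.lam_ne_zero b)) 2
  rw [sq_abs] at this
  unfold cSq
  positivity

theorem aSq_pos (b : Fin 2) : 0 < S.aSq b := by
  have h1 := S.γ_pos b
  have h2 := S.β₀_pos
  have h3 := pow_pos (abs_pos.2 (S.lam_ne_zero b)) 2
  rw [sq_abs] at h3
  have h4 : S.β₀ * S.T b < 1 := by
    have := S.T_lt b
    rw [lt_div_iff₀ h2] at this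
    linarith
  have : 0 < 1 - S.β₀ * S.T b := by linarith
  unfold aSq
  positivity

theorem lam_sq_pos (b : Fin 2) : 0 < S.lam b ^ 2 := by
  have h3 := pow_pos (abs_pos.2 (S.lam_ne_zero b)) 2
  rwa [sq_abs] at h3

theorem contDiff_energy (Γ : ℝ) : ContDiff ℝ ∞ (S.energy Γ) := by
  have h1 (i : Fin (N + 1)) : ContDiff ℝ ∞ fun x : ChainSpace N => S.V₁ (x (q i)) :=
    S.smooth_V₁.comp (contDiff_coord _)
  have h2 (j : Fin N) : ContDiff ℝ ∞ fun x : ChainSpace N => S.V₂ (x (q j.succ) - x (q j.castSucc)) :=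
    S.smooth_V₂.comp (contDiff_bond j)
  unfold energy hamiltonian
  simp only [div_eq_mul_inv]
  fun_prop

/-- Completing the square in the bath variables. -/
theorem energy_eq (Γ : ℝ) (x : ChainSpace N) :
    S.energy Γ x = ∑ i : Fin (N + 1), x (p i) ^ 2 / 2 + ∑ i : Fin (N + 1), S.V₁ (x (q i))
      + ∑ j : Fin N, S.V₂ (bond j x) + ∑ b : Fin 2, S.bathGap b x ^ 2 / (2 * S.lam b ^ 2)
      - ∑ b : Fin 2, S.lam b ^ 2 * x (q (bathSite N b)) ^ 2 / 2 + Γ := by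
  have hb (b : Fin 2) : x (r b) ^ 2 / (2 * S.lam b ^ 2) - x (q (bathSite N b)) * x (r b)
      = S.bathGap b x ^ 2 / (2 * S.lam b ^ 2) - S.lam b ^ 2 * x (q (bathSite N b)) ^ 2 / 2 := by
    have := S.lam_ne_zero b
    unfold bathGap
    field_simp
    ring
  simp only [energy, hamiltonian, hb, Finset.sum_add_distrib, Finset.sum_sub_distrib, bond]
  ring

/-- The energy is comparable to the sum of the critical powers of the momenta, positions, bond
elongations and bath gaps. -/
structure EnergyBounds (S : OscillatorChain N) (Γ n m C : ℝ) : Prop where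
  one_le : ∀ x, 1 ≤ S.energy Γ x
  p_le : ∀ x i, x (p i) ^ 2 ≤ C * S.energy Γ x
  q_le : ∀ x i, (1 + x (q i) ^ 2) ^ n ≤ C * S.energy Γ x
  bond_le : ∀ x j, (1 + bond j x ^ 2) ^ m ≤ C * S.energy Γ x
  gap_le : ∀ x b, S.bathGap b x ^ 2 ≤ C * S.energy Γ x
  le : ∀ x, S.energy Γ x ≤ C * (1 + ∑ i : Fin (N + 1), x (p i) ^ 2 +
    ∑ i : Fin (N + 1), (1 + x (q i) ^ 2) ^ n + ∑ j : Fin N, (1 + bond j x ^ 2) ^ m +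
    ∑ b : Fin 2, S.bathGap b x ^ 2)

theorem exists_energyBounds {n m Γ : ℝ} (hn : 1 < n) (h1 : PotentialGrowth S.V₁ n)
    (h2 : PotentialGrowth S.V₂ m) (hΓ : ∀ x : ChainSpace N, 1 ≤ S.energy Γ x) :
    ∃ C, 0 < C ∧ EnergyBounds S Γ n m C := by
  obtain ⟨c, hc, hV1⟩ := h1.le
  obtain ⟨c', hc', hV2⟩ := h2.le
  obtain ⟨D, hD⟩ := h1.abs_le
  obtain ⟨D', hD'⟩ := h2.abs_le
  have lin (b : Fin 2) := exists_linear_le_rpow hn (show 0 < c / 4 by positivity)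
    (show 0 ≤ S.lam b ^ 2 / 2 by positivity)
  choose A hA0 hA using lin
  -- `B` is the additive loss in the lower bound of the energy
  set B : ℝ := |∑ b, A b - Γ| + 1 with hB
  have hB1 : 1 ≤ B := by simp [hB]
  have low (x : ChainSpace N) : ∑ i : Fin (N + 1), x (p i) ^ 2 / 2
      + c / 2 * ∑ i : Fin (N + 1), (1 + x (q i) ^ 2) ^ n
      + c' * ∑ j : Fin N, (1 + bond j x ^ 2) ^ m
      + ∑ b : Fin 2, S.bathGap b x ^ 2 / (2 * S.lam b ^ 2) ≤ B * S.energy Γ x := by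
    have e1 : c * ∑ i : Fin (N + 1), (1 + x (q i) ^ 2) ^ n ≤ ∑ i : Fin (N + 1), S.V₁ (x (q i)) := by
      rw [Finset.mul_sum]
      exact Finset.sum_le_sum fun i _ => hV1 _
    have e2 : c' * ∑ j : Fin N, (1 + bond j x ^ 2) ^ m ≤ ∑ j : Fin N, S.V₂ (bond j x) := by
      rw [Finset.mul_sum]
      exact Finset.sum_le_sum fun i _ => hV2 _
    have e3 : ∑ b : Fin 2, S.lam b ^ 2 * x (q (bathSite N b)) ^ 2 / 2
        ≤ c / 2 * ∑ i : Fin (N + 1), (1 + x (q i) ^ 2) ^ n + ∑ b, A b := by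
      have (b : Fin 2) : S.lam b ^ 2 * x (q (bathSite N b)) ^ 2 / 2
          ≤ c / 4 * ∑ i : Fin (N + 1), (1 + x (q i) ^ 2) ^ n + A b := by
        have h3 := hA b _ (one_le_one_add_sq (x (q (bathSite N b))))
        have h4 : (1 + x (q (bathSite N b)) ^ 2) ^ n ≤ ∑ i : Fin (N + 1), (1 + x (q i) ^ 2) ^ n :=
          Finset.single_le_sum (f := fun i => (1 + x (q i) ^ 2) ^ n)
            (fun i _ => by positivity) (Finset.mem_univ _)
        nlinarith [lam_sq_pos (S := S) b]
      refine (Finset.sum_le_sum fun b _ => this b).trans (le_of_eq ?_)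
      simp only [Fin.sum_univ_two]
      ring
    have e4 := energy_eq (S := S) Γ x
    have e5 := le_abs_self (∑ b, A b - Γ)
    nlinarith [hΓ x]
  have pos1 (x : ChainSpace N) : 0 ≤ ∑ i : Fin (N + 1), x (p i) ^ 2 / 2 :=
    Finset.sum_nonneg fun i _ => by positivity
  have pos2 (x : ChainSpace N) : 0 ≤ ∑ i : Fin (N + 1), (1 + x (q i) ^ 2) ^ n :=
    Finset.sum_nonneg fun i _ => by positivity
  have pos3 (x : ChainSpace N) : 0 ≤ ∑ j : Fin N, (1 + bond j x ^ 2) ^ m :=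
    Finset.sum_nonneg fun i _ => by positivity
  have pos4 (x : ChainSpace N) : 0 ≤ ∑ b : Fin 2, S.bathGap b x ^ 2 / (2 * S.lam b ^ 2) :=
    Finset.sum_nonneg fun i _ => by positivity
  set M : ℝ := 2 * B + 2 * B / c + B / c' + ∑ b, 2 * S.lam b ^ 2 * B + |D| + |D'| + |Γ| +
    ∑ b, 1 / (2 * S.lam b ^ 2) with hM
  have s1 : 0 ≤ ∑ b, 2 * S.lam b ^ 2 * B := Finset.sum_nonneg fun b _ => by positivity
  have s2 : 0 ≤ ∑ b, 1 / (2 * S.lam b ^ 2) := Finset.sum_nonneg fun b _ => by positivity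
  have t1 : 0 ≤ 2 * B / c := by positivity
  have t2 : 0 ≤ B / c' := by positivity
  have t3 := abs_nonneg D
  have t4 := abs_nonneg D'
  have t5 := abs_nonneg Γ
  refine ⟨M, by linarith, hΓ, fun x i => ?_, fun x i => ?_, fun x j => ?_, fun x b => ?_,
    fun x => ?_⟩
  · have h3 : x (p i) ^ 2 / 2 ≤ ∑ i : Fin (N + 1), x (p i) ^ 2 / 2 :=
      Finset.single_le_sum (f := fun i => x (p i) ^ 2 / 2)
        (fun i _ => by positivity) (Finset.mem_univ _)
    have h4 : 2 * B * S.energy Γ x ≤ M * S.energy Γ x :=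
      mul_le_mul_of_nonneg_right (by linarith) (by linarith [hΓ x])
    nlinarith [low x, pos2 x, pos3 x, pos4 x]
  · have h3 : (1 + x (q i) ^ 2) ^ n ≤ ∑ i : Fin (N + 1), (1 + x (q i) ^ 2) ^ n :=
      Finset.single_le_sum (f := fun i => (1 + x (q i) ^ 2) ^ n)
        (fun i _ => by positivity) (Finset.mem_univ _)
    have h4 : 2 * B / c * S.energy Γ x ≤ M * S.energy Γ x :=
      mul_le_mul_of_nonneg_right (by linarith) (by linarith [hΓ x])
    refine h3.trans (le_trans ?_ h4)
    rw [div_mul_eq_mul_div, le_div_iff₀ hc]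
    nlinarith [low x, pos1 x, mul_nonneg hc'.le (pos3 x), pos4 x]
  · have h3 : (1 + bond j x ^ 2) ^ m ≤ ∑ j : Fin N, (1 + bond j x ^ 2) ^ m :=
      Finset.single_le_sum (f := fun j => (1 + bond j x ^ 2) ^ m)
        (fun i _ => by positivity) (Finset.mem_univ _)
    have h4 : B / c' * S.energy Γ x ≤ M * S.energy Γ x :=
      mul_le_mul_of_nonneg_right (by linarith) (by linarith [hΓ x])
    refine h3.trans (le_trans ?_ h4)
    rw [div_mul_eq_mul_div, le_div_iff₀ hc']
    nlinarith [low x, pos1 x, mul_nonneg hc.le (pos2 x), pos4 x]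
  · have h3 : S.bathGap b x ^ 2 / (2 * S.lam b ^ 2)
        ≤ ∑ b : Fin 2, S.bathGap b x ^ 2 / (2 * S.lam b ^ 2) :=
      Finset.single_le_sum (f := fun b => S.bathGap b x ^ 2 / (2 * S.lam b ^ 2))
        (fun i _ => by positivity) (Finset.mem_univ _)
    have h5 : 2 * S.lam b ^ 2 * B ≤ ∑ b, 2 * S.lam b ^ 2 * B :=
      Finset.single_le_sum (f := fun b => 2 * S.lam b ^ 2 * B)
        (fun i _ => by positivity) (Finset.mem_univ _)
    have h4 : 2 * S.lam b ^ 2 * B * S.energy Γ x ≤ M * S.energy Γ x :=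
      mul_le_mul_of_nonneg_right (by linarith) (by linarith [hΓ x])
    have h6 : S.bathGap b x ^ 2 / (2 * S.lam b ^ 2) ≤ B * S.energy Γ x := by
      nlinarith [low x, pos1 x, mul_nonneg hc.le (pos2 x), mul_nonneg hc'.le (pos3 x)]
    rw [div_le_iff₀ (by linarith [lam_sq_pos (S := S) b])] at h6
    linarith
  · have e1 : ∑ i : Fin (N + 1), S.V₁ (x (q i)) ≤ |D| * ∑ i : Fin (N + 1), (1 + x (q i) ^ 2) ^ n := by
      rw [Finset.mul_sum]
      refine Finset.sum_le_sum fun i _ => (le_abs_self _).trans ((hD _).trans ?_)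
      gcongr
      exact le_abs_self D
    have e2 : ∑ j : Fin N, S.V₂ (bond j x) ≤ |D'| * ∑ j : Fin N, (1 + bond j x ^ 2) ^ m := by
      rw [Finset.mul_sum]
      refine Finset.sum_le_sum fun i _ => (le_abs_self _).trans ((hD' _).trans ?_)
      gcongr
      exact le_abs_self D'
    have e3 : ∑ b : Fin 2, S.bathGap b x ^ 2 / (2 * S.lam b ^ 2)
        ≤ (∑ b, 1 / (2 * S.lam b ^ 2)) * ∑ b : Fin 2, S.bathGap b x ^ 2 := by
      rw [Finset.mul_sum]
      refine Finset.sum_le_sum fun b _ => ?_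
      rw [← one_div_mul_eq_div]
      refine mul_le_mul_of_nonneg_right ?_ (sq_nonneg _)
      exact Finset.single_le_sum (f := fun b => 1 / (2 * S.lam b ^ 2))
        (fun i _ => by positivity) (Finset.mem_univ _)
    have e4 := energy_eq (S := S) Γ x
    have e5 : 0 ≤ ∑ b : Fin 2, S.lam b ^ 2 * x (q (bathSite N b)) ^ 2 / 2 :=
      Finset.sum_nonneg fun i _ => by positivity
    have e6 : ∑ i : Fin (N + 1), x (p i) ^ 2 / 2 = 1 / 2 * ∑ i : Fin (N + 1), x (p i) ^ 2 := by
      rw [Finset.mul_sum]; exact Finset.sum_congr rfl fun i _ => by ring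
    have pos5 : 0 ≤ ∑ b : Fin 2, S.bathGap b x ^ 2 := Finset.sum_nonneg fun i _ => by positivity
    have p1 := pos1 x
    have p2 := pos2 x
    have p3 := pos3 x
    rw [e6] at p1 e4
    have f1 : 1 / 2 * ∑ i : Fin (N + 1), x (p i) ^ 2 ≤ M * ∑ i : Fin (N + 1), x (p i) ^ 2 :=
      mul_le_mul_of_nonneg_right (by linarith) (by linarith)
    have f2 := mul_le_mul_of_nonneg_right (show |D| ≤ M by linarith) p2
    have f3 := mul_le_mul_of_nonneg_right (show |D'| ≤ M by linarith) p3
    have f4 := mul_le_mul_of_nonneg_right (show ∑ b, 1 / (2 * S.lam b ^ 2) ≤ M by linarith) pos5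
    have f5 : Γ ≤ M := (le_abs_self Γ).trans (by linarith)
    linarith

/-! ### The vector field and the energy -/

theorem drift_q (x : ChainSpace N) (i : Fin (N + 1)) : S.drift x (q i) = x (p i) := by
  simp [drift, Finset.sum_apply, Pi.single_apply, WithLp.ofLp_sum]

theorem drift_r (x : ChainSpace N) (b : Fin 2) :
    S.drift x (r b) = - (S.bCoef b * S.bathGap b x) := by
  fin_cases b <;> simp [drift, Finset.sum_apply, WithLp.ofLp_sum]

theorem drift_p (x : ChainSpace N) (i : Fin (N + 1)) :
    S.drift x (p i) = ∑ b : Fin 2, (if i = bathSite N b then x (r b) else 0)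
      - deriv S.V₁ (x (q i)) - ∑ j : Fin N, deriv S.V₂ (bond j x) *
        ((if i = j.succ then 1 else 0) - (if i = j.castSucc then 1 else 0)) := by
  simp [drift, Finset.sum_apply, Pi.single_apply, WithLp.ofLp_sum]
  ring

theorem fderiv_energy (Γ : ℝ) (x v : ChainSpace N) :
    fderiv ℝ (S.energy Γ) x v = ∑ i : Fin (N + 1), (x (p i) * v (p i)
      + deriv S.V₁ (x (q i)) * v (q i)) + ∑ j : Fin N, deriv S.V₂ (bond j x) *
        (v (q j.succ) - v (q j.castSucc)) + ∑ b : Fin 2, (x (r b) * v (r b) / S.lam b ^ 2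
        - (x (q (bathSite N b)) * v (r b) + v (q (bathSite N b)) * x (r b))) := by
  have hc (k : ChainCoord N) : HasFDerivAt (fun y : ChainSpace N => y k)
      (EuclideanSpace.proj (𝕜 := ℝ) k) x := (EuclideanSpace.proj (𝕜 := ℝ) k).hasFDerivAt
  have hV1 (i : Fin (N + 1)) := ((S.smooth_V₁.differentiable (by simp)
    (x (q i))).hasDerivAt).comp_hasFDerivAt x (hc (q i))
  have hV2 (j : Fin N) := ((S.smooth_V₂.differentiable (by simp)
    (x (q j.succ) - x (q j.castSucc))).hasDerivAt).comp_hasFDerivAt x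
      ((hc (q j.succ)).sub (hc (q j.castSucc)))
  have h := (((HasFDerivAt.fun_sum fun i (_ : i ∈ Finset.univ) =>
      ((((hc (p i)).pow 2).mul_const (2⁻¹ : ℝ)).add (hV1 i))).add
    (HasFDerivAt.fun_sum fun j (_ : j ∈ Finset.univ) => hV2 j)).add
    (HasFDerivAt.fun_sum fun b (_ : b ∈ Finset.univ) =>
      (((hc (r b)).pow 2).mul_const ((2 * S.lam b ^ 2)⁻¹)).sub
        ((hc (q (bathSite N b))).mul (hc (r b))))).add_const Γ
  have e := h.fderiv
  have e' : fderiv ℝ (S.energy Γ) x = _ := e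
  rw [e']
  simp [bond]
  congr 1
  · congr 1
    refine Finset.sum_congr rfl fun i _ => ?_
    ring
  · have h0 := S.lam_ne_zero 0
    have h1 := S.lam_ne_zero 1
    field_simp

theorem pd_r_energy (Γ : ℝ) (x : ChainSpace N) (b : Fin 2) :
    pd (r b) (S.energy Γ) x = S.bathGap b x / S.lam b ^ 2 := by
  have := S.lam_ne_zero b
  rw [pd, fderiv_energy]
  simp [bathGap, Finset.sum_sub_distrib, ite_div]
  field_simp

/-- The energy is conserved up to the friction of the baths. -/
theorem along_energy (Γ : ℝ) (x : ChainSpace N) :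
    S.along (S.energy Γ) x = - ∑ b : Fin 2, S.bCoef b * S.bathGap b x ^ 2 / S.lam b ^ 2 := by
  have e1 : ∑ i : Fin (N + 1), x (p i) * ∑ b : Fin 2, (if i = bathSite N b then x (r b) else 0)
      = ∑ b : Fin 2, x (p (bathSite N b)) * x (r b) := by
    simp only [Finset.mul_sum]
    rw [Finset.sum_comm]
    simp
  have e2 : ∑ i : Fin (N + 1), x (p i) * ∑ j : Fin N, deriv S.V₂ (bond j x) *
        ((if i = j.succ then 1 else 0) - (if i = j.castSucc then 1 else 0))
      = ∑ j : Fin N, deriv S.V₂ (bond j x) * (x (p j.succ) - x (p j.castSucc)) := by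
    simp only [Finset.mul_sum]
    rw [Finset.sum_comm]
    refine Finset.sum_congr rfl fun j _ => ?_
    simp only [mul_sub, Finset.sum_sub_distrib]
    simp [mul_comm]
  have e3 (b : Fin 2) : x (r b) * (- (S.bCoef b * S.bathGap b x)) / S.lam b ^ 2
        - (x (q (bathSite N b)) * (- (S.bCoef b * S.bathGap b x)) + x (p (bathSite N b)) * x (r b))
      = - (S.bCoef b * S.bathGap b x ^ 2 / S.lam b ^ 2) - x (p (bathSite N b)) * x (r b) := by
    have := S.lam_ne_zero b
    unfold bathGap
    field_simp
    ring
  rw [along, fderiv_energy]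
  simp only [drift_q, drift_r, drift_p, e3, mul_sub, Finset.sum_add_distrib,
    Finset.sum_sub_distrib] at e1 e2 ⊢
  rw [e1, e2]
  have e4 : ∑ i : Fin (N + 1), x (p i) * deriv S.V₁ (x (q i))
    = ∑ i : Fin (N + 1), deriv S.V₁ (x (q i)) * x (p i) :=
    Finset.sum_congr rfl fun i _ => mul_comm _ _
  rw [e4, Finset.sum_neg_distrib]
  ring

end OscillatorChain

end

/-! ### Functions controlled by the graph norm -/

noncomputable section

open Asymptotics

namespace OscillatorChain

open ChainCoord

variable {N : ℕ}

theorem integrable_of_tsupport {h f : ChainSpace N → ℝ} (hc : Continuous h)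
    (hs : HasCompactSupport f) (h0 : ∀ x, x ∉ tsupport f → h x = 0) : Integrable h :=
  hc.integrable_of_hasCompactSupport (HasCompactSupport.intro hs h0)

variable (S : OscillatorChain N)

/-- The squared graph norm of `f` for `K` (`σ = 1`) or for its formal adjoint (`σ = -1`). -/
def graphSq (σ : ℝ) (f : ChainSpace N → ℝ) : ℝ :=
  (∫ x, S.realK σ f x ^ 2) + ∫ x, f x ^ 2

/-- A continuous function is controlled if its integral against `f²` is bounded by the squared
graph norm of `f`, uniformly over the test functions `f`, both for `K` and for its adjoint. -/
def Controlled (ψ : ChainSpace N → ℝ) : Prop :=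
  Continuous ψ ∧ ∃ C, 0 ≤ C ∧ ∀ σ : ℝ, |σ| = 1 → ∀ f : ChainSpace N → ℝ, ContDiff ℝ ∞ f →
    HasCompactSupport f → ∫ x, ψ x * f x ^ 2 ≤ C * S.graphSq σ f

variable {S}

theorem integrable_mul_sq {ψ f : ChainSpace N → ℝ} (hψ : Continuous ψ) (hf : ContDiff ℝ ∞ f)
    (hs : HasCompactSupport f) : Integrable fun x => ψ x * f x ^ 2 := by
  have := hf.continuous
  exact integrable_of_tsupport (by fun_prop) hs
    fun x hx => by simp [image_eq_zero_of_notMem_tsupport hx]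

theorem integrable_realK_sq {σ : ℝ} {f : ChainSpace N → ℝ} (hf : ContDiff ℝ ∞ f)
    (hs : HasCompactSupport f) : Integrable fun x => S.realK σ f x ^ 2 :=
  integrable_of_tsupport ((continuous_realK hf σ).pow 2) hs
    fun x hx => by simp [realK_eq_zero_of_notMem hx]

theorem integrable_sq {f : ChainSpace N → ℝ} (hf : ContDiff ℝ ∞ f)
    (hs : HasCompactSupport f) : Integrable fun x => f x ^ 2 := by
  simpa using integrable_mul_sq (ψ := fun _ => 1) continuous_const hf hs

theorem integrable_pd_sq {k : ChainCoord N} {f : ChainSpace N → ℝ} (hf : ContDiff ℝ ∞ f)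
    (hs : HasCompactSupport f) : Integrable fun x => pd k f x ^ 2 :=
  integrable_of_tsupport ((contDiff_pd hf).continuous.pow 2) hs
    fun x hx => by simp [pd_eq_zero_of_notMem hx]

theorem graphSq_nonneg (σ : ℝ) (f : ChainSpace N → ℝ) : 0 ≤ S.graphSq σ f :=
  add_nonneg (integral_nonneg fun _ => sq_nonneg _) (integral_nonneg fun _ => sq_nonneg _)

theorem graphSq_eq {σ : ℝ} {f : ChainSpace N → ℝ} (hf : ContDiff ℝ ∞ f)
    (hs : HasCompactSupport f) : S.graphSq σ f = ∫ x, (S.realK σ f x ^ 2 + f x ^ 2) :=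
  (integral_add (integrable_realK_sq hf hs) (integrable_sq hf hs)).symm

/-- The dissipation: the graph norm bounds the bath derivatives and the bath gaps. -/
theorem integral_dissipation_le (b : Fin 2) {σ : ℝ} {f : ChainSpace N → ℝ}
    (hf : ContDiff ℝ ∞ f) (hs : HasCompactSupport f) :
    S.cSq b * (∫ x, pd (r b) f x ^ 2) + S.aSq b * ∫ x, S.bathGap b x ^ 2 * f x ^ 2
      ≤ S.graphSq σ f := by
  have h0 := integral_mul_realK (S := S) σ hf (contDiff_const (c := (1 : ℝ))) (Or.inl hs)
  have e1 (b : Fin 2) (x : ChainSpace N) : pd (r b) (fun _ => (1 : ℝ)) x = 0 := by simp [pd]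
  have e2 (x : ChainSpace N) : S.along (fun _ => (1 : ℝ)) x = 0 := by simp [along]
  simp only [e1, e2, one_mul, mul_zero, zero_mul, add_zero, sub_zero] at h0
  have hgap := ((contDiff_bathGap (S := S) b).continuous.pow 2)
  have i1 := (integrable_pd_sq (k := r b) hf hs).const_mul (S.cSq b)
  have i2 := (integrable_mul_sq hgap hf hs).const_mul (S.aSq b)
  have i3 := (integrable_realK_sq (S := S) (σ := σ) hf hs).add (integrable_sq hf hs)
  have cont : Continuous fun x => f x * S.realK σ f x - ∑ b : Fin 2,
      (S.cSq b * pd (r b) f x ^ 2 + S.aSq b * (S.bathGap b x ^ 2 * f x ^ 2)) := by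
    have h1 (b : Fin 2) : Continuous (pd (r b) f) := (contDiff_pd hf).continuous
    have h2 (b : Fin 2) : Continuous (S.bathGap b) := (contDiff_bathGap b).continuous
    have h3 := hf.continuous
    have h4 := continuous_realK (S := S) hf σ
    fun_prop
  have i4 := integrable_of_tsupport cont hs fun x hx => by
    simp [image_eq_zero_of_notMem_tsupport hx, pd_eq_zero_of_notMem hx]
  have h1 : 0 ≤ ∫ x, ((S.realK σ f x ^ 2 + f x ^ 2) -
      (S.cSq b * pd (r b) f x ^ 2 + S.aSq b * (S.bathGap b x ^ 2 * f x ^ 2))) := by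
    rw [← h0]
    refine integral_mono i4 (i3.sub (i1.add i2)) fun x => ?_
    have h5 := Finset.single_le_sum (f := fun b => S.cSq b * pd (r b) f x ^ 2 +
        S.aSq b * (S.bathGap b x ^ 2 * f x ^ 2)) (fun b _ => by
          have := cSq_pos (S := S) b
          have := aSq_pos (S := S) b
          positivity) (Finset.mem_univ b)
    simp only at h5 ⊢
    nlinarith [sq_nonneg (f x - S.realK σ f x), sq_nonneg (f x), sq_nonneg (S.realK σ f x)]
  have e3 := integral_sub i3 (i1.add i2)
  have e4 := integral_add i1 i2
  simp only [Pi.add_apply, Pi.pow_apply] at e3 e4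
  rw [e3, e4, integral_const_mul, integral_const_mul, ← graphSq_eq hf hs] at h1
  linarith

namespace Controlled

theorem one : S.Controlled fun _ => 1 :=
  ⟨continuous_const, 1, zero_le_one, fun σ _ f _ _ => by
    simp only [one_mul, graphSq]
    linarith [integral_nonneg (μ := volume) (f := fun x => S.realK σ f x ^ 2)
      fun _ => sq_nonneg _]⟩

theorem gap (b : Fin 2) : S.Controlled fun x => S.bathGap b x ^ 2 :=
  ⟨(contDiff_bathGap b).continuous.pow 2, 1 / S.aSq b, one_div_nonneg.2 (aSq_pos b).le,
    fun σ _ f hf hs => by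
      have h1 := integral_dissipation_le (S := S) b (σ := σ) hf hs
      have h2 : 0 ≤ ∫ x, pd (r b) f x ^ 2 := integral_nonneg fun _ => sq_nonneg _
      rw [one_div_mul_eq_div, le_div_iff₀ (aSq_pos b)]
      simp only
      nlinarith [cSq_pos (S := S) b]⟩

theorem mono {ψ ψ' : ChainSpace N → ℝ} (h : S.Controlled ψ') (hc : Continuous ψ) {c : ℝ}
    (hc0 : 0 ≤ c) (hle : ∀ x, ψ x ≤ c * ψ' x) : S.Controlled ψ := by
  obtain ⟨hψ', C, hC, h⟩ := h
  refine ⟨hc, c * C, by positivity, fun σ hσ f hf hs => ?_⟩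
  calc ∫ x, ψ x * f x ^ 2 ≤ ∫ x, c * (ψ' x * f x ^ 2) :=
        integral_mono (integrable_mul_sq hc hf hs) ((integrable_mul_sq hψ' hf hs).const_mul c)
          fun x => by
            have := mul_le_mul_of_nonneg_right (hle x) (sq_nonneg (f x))
            simp only
            linarith
    _ ≤ c * C * S.graphSq σ f := by
        rw [integral_const_mul, mul_assoc]
        exact mul_le_mul_of_nonneg_left (h σ hσ f hf hs) hc0

theorem add {ψ ψ' : ChainSpace N → ℝ} (h : S.Controlled ψ) (h' : S.Controlled ψ') :
    S.Controlled fun x => ψ x + ψ' x := by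
  obtain ⟨hψ, C, hC, h⟩ := h
  obtain ⟨hψ', C', hC', h'⟩ := h'
  refine ⟨hψ.add hψ', C + C', by positivity, fun σ hσ f hf hs => ?_⟩
  simp only [add_mul]
  rw [integral_add (integrable_mul_sq hψ hf hs) (integrable_mul_sq hψ' hf hs)]
  exact add_le_add (h σ hσ f hf hs) (h' σ hσ f hf hs)

theorem const_mul {ψ : ChainSpace N → ℝ} (h : S.Controlled ψ) {c : ℝ} (hc : 0 ≤ c) :
    S.Controlled fun x => c * ψ x :=
  h.mono (h.1.const_mul c) hc fun _ => le_rfl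

/-- The source of all further control: the derivative along `Z` of a bounded function whose
derivatives in the bath variables are bounded. -/
theorem of_along {ψ ψ' φ : ChainSpace N → ℝ} (hψ : Continuous ψ) (h' : S.Controlled ψ')
    (hφ : ContDiff ℝ ∞ φ) {M : ℝ} (hM : ∀ x, |φ x| ≤ M)
    (hMr : ∀ b x, |pd (r b) φ x| ≤ M) {c : ℝ} (hc : 0 ≤ c)
    (hle : ∀ x, ψ x ≤ c * S.along φ x + ψ' x) : S.Controlled ψ := by
  obtain ⟨hψ', C', hC', h'⟩ := h'
  have hM0 : 0 ≤ M := (abs_nonneg _).trans (hM 0)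
  have hcS (b : Fin 2) := cSq_pos (S := S) b
  have haS (b : Fin 2) := aSq_pos (S := S) b
  refine ⟨hψ, c * (2 * (M + ∑ b : Fin 2, (3 * M + S.cSq b * M))) + C', ?_, fun σ hσ f hf hs => ?_⟩
  · have : 0 ≤ ∑ b : Fin 2, (3 * M + S.cSq b * M) := Finset.sum_nonneg fun b _ => by
      have := hcS b; positivity
    positivity
  have hφc := hφ.continuous
  have hfc := hf.continuous
  have hKc := continuous_realK (S := S) hf σ
  have hpf (b : Fin 2) : Continuous (pd (r b) f) := (contDiff_pd hf).continuous
  have hpφ (b : Fin 2) : Continuous (pd (r b) φ) := (contDiff_pd hφ).continuous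
  have hg (b : Fin 2) : Continuous (S.bathGap b) := (contDiff_bathGap b).continuous
  have hZ : Continuous (S.along φ) := (contDiff_along hφ).continuous
  have h0 := integral_mul_realK (S := S) σ hf hφ (Or.inl hs)
  have i1 : Integrable fun x => φ x * f x * S.realK σ f x - ∑ b : Fin 2,
        (S.cSq b * (φ x * pd (r b) f x ^ 2 + pd (r b) φ x * f x * pd (r b) f x)
          + S.aSq b * (φ x * S.bathGap b x ^ 2 * f x ^ 2)) :=
    integrable_of_tsupport (by fun_prop) hs fun x hx => by
      simp [image_eq_zero_of_notMem_tsupport hx, pd_eq_zero_of_notMem hx]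
  have i2 : Integrable fun x => σ / 2 * S.along φ x * f x ^ 2 :=
    integrable_mul_sq (by fun_prop) hf hs
  have i3 := (integrable_realK_sq (S := S) (σ := σ) hf hs).add (integrable_sq hf hs)
  have i4 (b : Fin 2) : Integrable fun x => 2 * (S.cSq b * pd (r b) f x ^ 2 +
      S.aSq b * (S.bathGap b x ^ 2 * f x ^ 2)) + S.cSq b * f x ^ 2 :=
    integrable_of_tsupport (by fun_prop) hs fun x hx => by
      simp [image_eq_zero_of_notMem_tsupport hx, pd_eq_zero_of_notMem hx]
  rw [integral_sub i1 i2, sub_eq_zero] at h0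
  have bound : |∫ x, S.along φ x * f x ^ 2|
      ≤ 2 * (M + ∑ b : Fin 2, (3 * M + S.cSq b * M)) * S.graphSq σ f := by
    have e : ∫ x, σ / 2 * S.along φ x * f x ^ 2 = σ / 2 * ∫ x, S.along φ x * f x ^ 2 := by
      rw [← integral_const_mul]; simp only [mul_assoc]
    have e2 : |∫ x, S.along φ x * f x ^ 2| = 2 * |∫ x, σ / 2 * S.along φ x * f x ^ 2| := by
      rw [e, abs_mul, abs_div, hσ]; norm_num; ring
    rw [e2, ← h0, mul_assoc]
    refine mul_le_mul_of_nonneg_left ?_ zero_le_two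
    have i5 : Integrable fun x => M * (S.realK σ f x ^ 2 + f x ^ 2) + ∑ b : Fin 2,
        M * (2 * (S.cSq b * pd (r b) f x ^ 2 +
        S.aSq b * (S.bathGap b x ^ 2 * f x ^ 2)) + S.cSq b * f x ^ 2) :=
      (i3.const_mul M).add (integrable_finsetSum _ fun b _ => (i4 b).const_mul M)
    refine (abs_integral_le_integral_abs.trans
      (integral_mono i1.abs i5 fun x => ?_)).trans ?_
    · refine (abs_sub _ _).trans (add_le_add ?_ ((Finset.abs_sum_le_sum_abs _ _).trans
        (Finset.sum_le_sum fun b _ => ?_)))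
      · rw [mul_assoc, abs_mul]
        refine mul_le_mul (hM x) ?_ (abs_nonneg _) hM0
        rw [abs_le]
        constructor <;> nlinarith [sq_nonneg (f x - S.realK σ f x),
          sq_nonneg (f x + S.realK σ f x), sq_nonneg (f x), sq_nonneg (S.realK σ f x)]
      · refine (abs_add_le _ _).trans ?_
        have t1 : |φ x * pd (r b) f x ^ 2 + pd (r b) φ x * f x * pd (r b) f x|
            ≤ M * pd (r b) f x ^ 2 + M * (pd (r b) f x ^ 2 + f x ^ 2) := by
          refine (abs_add_le _ _).trans (add_le_add ?_ ?_)
          · rw [abs_mul, abs_of_nonneg (sq_nonneg (pd (r b) f x))]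
            exact mul_le_mul_of_nonneg_right (hM x) (sq_nonneg _)
          · rw [mul_assoc, abs_mul]
            refine mul_le_mul (hMr b x) ?_ (abs_nonneg _) hM0
            rw [abs_le]
            constructor <;> nlinarith [sq_nonneg (f x - pd (r b) f x),
              sq_nonneg (f x + pd (r b) f x), sq_nonneg (f x), sq_nonneg (pd (r b) f x)]
        have t2 : |φ x * S.bathGap b x ^ 2 * f x ^ 2| ≤ M * (S.bathGap b x ^ 2 * f x ^ 2) := by
          rw [mul_assoc, abs_mul, abs_of_nonneg (show 0 ≤ S.bathGap b x ^ 2 * f x ^ 2 by positivity)]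
          exact mul_le_mul_of_nonneg_right (hM x) (by positivity)
        rw [abs_mul, abs_mul, abs_of_pos (hcS b), abs_of_pos (haS b)]
        have u1 := mul_le_mul_of_nonneg_left t1 (hcS b).le
        have u2 := mul_le_mul_of_nonneg_left t2 (haS b).le
        have u3 : 0 ≤ M * (S.aSq b * (S.bathGap b x ^ 2 * f x ^ 2)) := by
          have := haS b; positivity
        linarith
    · have e5 := integral_add (i3.const_mul M)
        (integrable_finsetSum Finset.univ fun b _ => (i4 b).const_mul M)
      simp only [Pi.add_apply] at e5
      rw [e5, integral_finsetSum _ fun b _ => (i4 b).const_mul M, integral_const_mul,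
        ← graphSq_eq hf hs, add_mul, Finset.sum_mul]
      refine add_le_add le_rfl (Finset.sum_le_sum fun b _ => ?_)
      have j1 := (integrable_pd_sq (k := r b) hf hs).const_mul (S.cSq b)
      have j2 := (integrable_mul_sq ((hg b).pow 2) hf hs).const_mul (S.aSq b)
      have j3 := (integrable_sq hf hs).const_mul (S.cSq b)
      have e6 := integral_add ((j1.add j2).const_mul 2) j3
      have e7 := integral_add j1 j2
      simp only [Pi.add_apply, Pi.pow_apply] at e6 e7
      rw [integral_const_mul, e6, integral_const_mul, e7]
      simp only [integral_const_mul]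
      have d := integral_dissipation_le (S := S) b (σ := σ) hf hs
      have d2 : ∫ x, f x ^ 2 ≤ S.graphSq σ f := by
        have : 0 ≤ ∫ x, S.realK σ f x ^ 2 := integral_nonneg fun _ => sq_nonneg _
        unfold graphSq; linarith
      have d3 := mul_le_mul_of_nonneg_left d2 (hcS b).le
      have d4 := graphSq_nonneg (S := S) σ f
      have d5 : M * (2 * (S.cSq b * (∫ x, pd (r b) f x ^ 2) +
          S.aSq b * ∫ x, S.bathGap b x ^ 2 * f x ^ 2) + S.cSq b * ∫ x, f x ^ 2)
          ≤ M * (2 * S.graphSq σ f + S.cSq b * S.graphSq σ f) :=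
        mul_le_mul_of_nonneg_left (by linarith) hM0
      refine d5.trans ?_
      nlinarith [mul_nonneg hM0 d4]
  have i6 : Integrable fun x => c * (S.along φ x * f x ^ 2) + ψ' x * f x ^ 2 :=
    ((integrable_mul_sq hZ hf hs).const_mul c).add (integrable_mul_sq hψ' hf hs)
  have step : ∫ x, ψ x * f x ^ 2 ≤ ∫ x, (c * (S.along φ x * f x ^ 2) + ψ' x * f x ^ 2) :=
    integral_mono (integrable_mul_sq hψ hf hs) i6 fun x => by
      have := mul_le_mul_of_nonneg_right (hle x) (sq_nonneg (f x))
      simp only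
      linarith
  rw [integral_add ((integrable_mul_sq hZ hf hs).const_mul c) (integrable_mul_sq hψ' hf hs),
    integral_const_mul] at step
  have u1 := mul_le_mul_of_nonneg_left ((le_abs_self _).trans bound) hc
  have u2 := h' σ hσ f hf hs
  linarith

end Controlled

end OscillatorChain

end

/-! ### Propagation of subcriticality along the flow -/

noncomputable section

open Asymptotics

namespace OscillatorChain

open ChainCoord

variable {N : ℕ} (S : OscillatorChain N)

/-- `f` is bounded by a multiple of the `a`-th power of the energy. -/
def PowBound (Γ : ℝ) (f : ChainSpace N → ℝ) (a : ℝ) : Prop :=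
  f =O[⊤] fun x => S.energy Γ x ^ a

/-- `U` is subcritical at the exponent `a` if, as far as the graph norm can see, it is smaller than
`G ^ a` by a power of the energy: `U² G^{δ - 2a}` is controlled for some `δ > 0`. -/
def Subcritical (Γ : ℝ) (U : ChainSpace N → ℝ) (a : ℝ) : Prop :=
  Continuous U ∧ ∃ δ : ℝ, 0 < δ ∧ S.Controlled fun x => U x ^ 2 * S.energy Γ x ^ (δ - 2 * a)

variable {S} {Γ : ℝ}

theorem continuous_energy_rpow (hG : ∀ x, 1 ≤ S.energy Γ x) (a : ℝ) :
    Continuous fun x => S.energy Γ x ^ a :=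
  (contDiff_energy Γ).continuous.rpow_const fun x => Or.inl (by linarith [hG x])

namespace PowBound

variable {f g : ChainSpace N → ℝ} {a b : ℝ}

theorem exists_le (hG : ∀ x, 1 ≤ S.energy Γ x) (h : S.PowBound Γ f a) :
    ∃ C, 0 ≤ C ∧ ∀ x, |f x| ≤ C * S.energy Γ x ^ a := by
  obtain ⟨C, hC, h⟩ := h.exists_nonneg
  rw [isBigOWith_top] at h
  refine ⟨C, hC, fun x => (h x).trans_eq ?_⟩
  rw [Real.norm_of_nonneg (Real.rpow_nonneg (by linarith [hG x]) _)]

theorem of_le (hG : ∀ x, 1 ≤ S.energy Γ x) {C : ℝ} (h : ∀ x, |f x| ≤ C * S.energy Γ x ^ a) :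
    S.PowBound Γ f a := by
  refine isBigO_top.2 ⟨C, fun x => (h x).trans_eq ?_⟩
  rw [Real.norm_of_nonneg (Real.rpow_nonneg (by linarith [hG x]) _)]

theorem mono (hG : ∀ x, 1 ≤ S.energy Γ x) (h : S.PowBound Γ f a) (hab : a ≤ b) :
    S.PowBound Γ f b := by
  obtain ⟨C, hC, h⟩ := h.exists_le hG
  exact of_le hG fun x => (h x).trans
    (mul_le_mul_of_nonneg_left (Real.rpow_le_rpow_of_exponent_le (hG x) hab) hC)

theorem mul (hG : ∀ x, 1 ≤ S.energy Γ x) (hf : S.PowBound Γ f a) (hg : S.PowBound Γ g b) :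
    S.PowBound Γ (fun x => f x * g x) (a + b) := by
  have := IsBigO.mul hf hg
  refine this.congr_right fun x => ?_
  rw [Real.rpow_add (by linarith [hG x])]

end PowBound

namespace Subcritical

variable {U V : ChainSpace N → ℝ} {a b : ℝ}

/-- A subcritical function has a controlled square for all small gains `δ`. -/
theorem exists_forall_le (hG : ∀ x, 1 ≤ S.energy Γ x) (h : S.Subcritical Γ U a) :
    ∃ δ₀, 0 < δ₀ ∧ ∀ δ ≤ δ₀, S.Controlled fun x => U x ^ 2 * S.energy Γ x ^ (δ - 2 * a) := by
  obtain ⟨hc, δ₀, h0, h⟩ := h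
  refine ⟨δ₀, h0, fun δ hδ => h.mono ((hc.pow 2).mul (continuous_energy_rpow hG _)) zero_le_one
    fun x => ?_⟩
  rw [one_mul]
  exact mul_le_mul_of_nonneg_left (Real.rpow_le_rpow_of_exponent_le (hG x) (by linarith))
    (sq_nonneg _)

theorem of_powBound (hG : ∀ x, 1 ≤ S.energy Γ x) (hc : Continuous U) (h : S.PowBound Γ U b)
    (hba : b < a) : S.Subcritical Γ U a := by
  obtain ⟨C, hC, h⟩ := h.exists_le hG
  refine ⟨hc, 2 * (a - b), by linarith, Controlled.one.mono
    ((hc.pow 2).mul (continuous_energy_rpow hG _)) (sq_nonneg C) fun x => ?_⟩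
  have hpos : 0 < S.energy Γ x := by linarith [hG x]
  have h1 : U x ^ 2 ≤ C ^ 2 * S.energy Γ x ^ (2 * b) := by
    have := pow_le_pow_left₀ (abs_nonneg _) (h x) 2
    rwa [sq_abs, mul_pow, ← Real.rpow_natCast (S.energy Γ x ^ b), ← Real.rpow_mul hpos.le,
      mul_comm b] at this
  calc U x ^ 2 * S.energy Γ x ^ (2 * (a - b) - 2 * a)
      ≤ C ^ 2 * S.energy Γ x ^ (2 * b) * S.energy Γ x ^ (2 * (a - b) - 2 * a) := by gcongr
    _ = C ^ 2 * 1 := by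
      rw [mul_assoc, ← Real.rpow_add hpos]
      ring_nf
      simp

theorem mono (hG : ∀ x, 1 ≤ S.energy Γ x) (h : S.Subcritical Γ V a) (hc : Continuous U) {C : ℝ}
    (hle : ∀ x, |U x| ≤ C * |V x|) : S.Subcritical Γ U a := by
  obtain ⟨hV, δ, hδ, h⟩ := h
  refine ⟨hc, δ, hδ, h.mono ((hc.pow 2).mul (continuous_energy_rpow hG _)) (sq_nonneg C)
    fun x => ?_⟩
  have h1 := pow_le_pow_left₀ (abs_nonneg _) (hle x) 2
  rw [sq_abs, mul_pow, sq_abs] at h1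
  rw [← mul_assoc]
  exact mul_le_mul_of_nonneg_right h1 (Real.rpow_nonneg (by linarith [hG x]) _)

theorem const_mul (hG : ∀ x, 1 ≤ S.energy Γ x) (h : S.Subcritical Γ U a) (c : ℝ) :
    S.Subcritical Γ (fun x => c * U x) a :=
  h.mono hG (h.1.const_mul c) (C := |c|) fun _ => (abs_mul _ _).le

theorem add (hG : ∀ x, 1 ≤ S.energy Γ x) (hU : S.Subcritical Γ U a) (hV : S.Subcritical Γ V a) :
    S.Subcritical Γ (fun x => U x + V x) a := by
  obtain ⟨δ, h0, h⟩ := hU.exists_forall_le hG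
  obtain ⟨δ', h0', h'⟩ := hV.exists_forall_le hG
  refine ⟨hU.1.add hV.1, min δ δ', lt_min h0 h0',
    ((h (min δ δ') (min_le_left _ _)).add (h' (min δ δ') (min_le_right _ _))).mono
      (((hU.1.add hV.1).pow 2).mul (continuous_energy_rpow hG _)) zero_le_two fun x => ?_⟩
  rw [← add_mul, ← mul_assoc]
  refine mul_le_mul_of_nonneg_right ?_ (Real.rpow_nonneg (by linarith [hG x]) _)
  simp only
  nlinarith [sq_nonneg (U x - V x)]

theorem sub (hG : ∀ x, 1 ≤ S.energy Γ x) (hU : S.Subcritical Γ U a) (hV : S.Subcritical Γ V a) :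
    S.Subcritical Γ (fun x => U x - V x) a := by
  simpa [sub_eq_add_neg] using hU.add hG (hV.const_mul hG (-1))

theorem zero (hG : ∀ x, 1 ≤ S.energy Γ x) : S.Subcritical Γ (fun _ => 0) a :=
  of_powBound hG continuous_const (b := a - 1) (.of_le hG (C := 0) (by simp)) (by linarith)

theorem sum (hG : ∀ x, 1 ≤ S.energy Γ x) {ι : Type*} (s : Finset ι)
    {U : ι → ChainSpace N → ℝ} (h : ∀ i ∈ s, S.Subcritical Γ (U i) a) :
    S.Subcritical Γ (fun x => ∑ i ∈ s, U i x) a := by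
  classical
  induction s using Finset.induction_on with
  | empty => simpa using zero hG
  | insert i s hi ih =>
    simp only [Finset.sum_insert hi]
    exact (h i (Finset.mem_insert_self i s)).add hG
      (ih fun j hj => h j (Finset.mem_insert_of_mem hj))

end Subcritical

/-- The derivative of the propagation function `arctan (U G^s) (W G^t)` in a direction `v`. -/
theorem fderiv_arctan_mul_rpow {U W : ChainSpace N → ℝ} (hU : ContDiff ℝ ∞ U)
    (hW : ContDiff ℝ ∞ W) (hG : ∀ x, 1 ≤ S.energy Γ x) (s t : ℝ) (x v : ChainSpace N) :
    fderiv ℝ (fun y => Real.arctan (U y * S.energy Γ y ^ s) * (W y * S.energy Γ y ^ t)) x v =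
      1 / (1 + (U x * S.energy Γ x ^ s) ^ 2) * (fderiv ℝ U x v * S.energy Γ x ^ s
        + U x * S.energy Γ x ^ s * (s * (fderiv ℝ (S.energy Γ) x v / S.energy Γ x)))
        * (W x * S.energy Γ x ^ t)
      + Real.arctan (U x * S.energy Γ x ^ s) * (fderiv ℝ W x v * S.energy Γ x ^ t
        + W x * S.energy Γ x ^ t * (t * (fderiv ℝ (S.energy Γ) x v / S.energy Γ x))) := by
  have hpos : 0 < S.energy Γ x := by linarith [hG x]
  have dU := (hU.differentiable (by simp) x).hasFDerivAt
  have dW := (hW.differentiable (by simp) x).hasFDerivAt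
  have dG := ((contDiff_energy (S := S) Γ).differentiable (by simp) x).hasFDerivAt
  have d := ((dU.mul (dG.rpow_const (p := s) (Or.inl hpos.ne'))).arctan).mul
    (dW.mul (dG.rpow_const (p := t) (Or.inl hpos.ne')))
  have e : fderiv ℝ (fun y => Real.arctan (U y * S.energy Γ y ^ s) * (W y * S.energy Γ y ^ t)) x
    = _ := d.fderiv
  rw [e]
  simp only [Real.rpow_sub_one hpos.ne']
  simp
  ring

/-- The logarithmic derivatives of the energy in the bath variables and along `Z` are bounded. -/
theorem exists_abs_div_energy_le (hG : ∀ x, 1 ≤ S.energy Γ x) {D : ℝ}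
    (hgap : ∀ x b, S.bathGap b x ^ 2 ≤ D * S.energy Γ x) : ∃ L, 0 ≤ L ∧
      (∀ b x, |pd (r b) (S.energy Γ) x / S.energy Γ x| ≤ L) ∧
      ∀ x, |S.along (S.energy Γ) x / S.energy Γ x| ≤ L := by
  have hD : 0 ≤ D := by
    have := hgap 0 0
    have := hG 0
    by_contra hD
    nlinarith [sq_nonneg (S.bathGap 0 0)]
  refine ⟨∑ b, (1 + D) / S.lam b ^ 2 + ∑ b, |S.bCoef b| * D / S.lam b ^ 2, ?_, ?_, ?_⟩
  · refine add_nonneg (Finset.sum_nonneg fun b _ => ?_) (Finset.sum_nonneg fun b _ => ?_) <;>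
      positivity
  · intro b x
    have hpos : 0 < S.energy Γ x := by linarith [hG x]
    rw [pd_r_energy, abs_div, div_le_iff₀ (abs_pos.2 hpos.ne'), abs_div,
      abs_of_pos hpos, abs_of_pos (lam_sq_pos b), add_mul]
    have e1 : |S.bathGap b x| ≤ (1 + D) * S.energy Γ x := by
      have := hgap x b
      rw [abs_le]
      constructor <;> nlinarith [sq_nonneg (S.bathGap b x - 1), sq_nonneg (S.bathGap b x + 1), hG x]
    have e2 : (1 + D) / S.lam b ^ 2 ≤ ∑ b, (1 + D) / S.lam b ^ 2 :=
      Finset.single_le_sum (f := fun b => (1 + D) / S.lam b ^ 2)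
        (fun b _ => by positivity) (Finset.mem_univ b)
    have e3 : 0 ≤ (∑ b, |S.bCoef b| * D / S.lam b ^ 2) * S.energy Γ x :=
      mul_nonneg (Finset.sum_nonneg fun b _ => by positivity) hpos.le
    have e4 : |S.bathGap b x| / S.lam b ^ 2 ≤ (1 + D) / S.lam b ^ 2 * S.energy Γ x := by
      rw [div_mul_eq_mul_div]
      exact div_le_div_of_nonneg_right e1 (lam_sq_pos b).le
    have := mul_le_mul_of_nonneg_right e2 hpos.le
    linarith
  · intro x
    have hpos : 0 < S.energy Γ x := by linarith [hG x]
    rw [along_energy, abs_div, div_le_iff₀ (abs_pos.2 hpos.ne'), abs_neg, abs_of_pos hpos, add_mul]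
    have e3 : 0 ≤ (∑ b, (1 + D) / S.lam b ^ 2) * S.energy Γ x :=
      mul_nonneg (Finset.sum_nonneg fun b _ => by positivity) hpos.le
    refine ((Finset.abs_sum_le_sum_abs _ _).trans ?_).trans (le_add_of_nonneg_left e3)
    rw [Finset.sum_mul]
    refine Finset.sum_le_sum fun b _ => ?_
    rw [abs_div, abs_mul, abs_of_pos (lam_sq_pos b), abs_of_nonneg (sq_nonneg (S.bathGap b x)),
      div_mul_eq_mul_div, mul_assoc]
    have := hgap x b
    gcongr

theorem mul_sq_sub_le {k y : ℝ} (hk0 : 0 ≤ k) (hk1 : k ≤ 1) (hy : 0 ≤ y) (w e : ℝ) :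
    k / 2 * (w ^ 2 * y) - 1 / 2 * (e ^ 2 * y) ≤ k * ((w ^ 2 + e * w) * y) := by
  have h1 : 0 ≤ k / 2 * (w + e) ^ 2 * y := by positivity
  have h2 : 0 ≤ (1 - k) / 2 * e ^ 2 * y :=
    mul_nonneg (mul_nonneg (by linarith) (sq_nonneg _)) hy
  have : k * ((w ^ 2 + e * w) * y) = k / 2 * (w ^ 2 * y) - 1 / 2 * (e ^ 2 * y)
    + (k / 2 * (w + e) ^ 2 * y + (1 - k) / 2 * e ^ 2 * y) := by ring
  linarith

/-- Where `u` is below the threshold `y^{α - δ}`, the weight `1 / (1 + (u y^{δ - α})²)` is at least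
`1/2`; where it is above, `u²` dominates. -/
theorem sq_mul_rpow_le {y w A β : ℝ} (hy : 1 ≤ y) (hw : |w| ≤ A * y ^ β) (u α δ : ℝ) :
    w ^ 2 * y ^ (δ - 2 * β) ≤ 8 * (1 / (1 + (u * y ^ (δ - α)) ^ 2) / 2 * (w ^ 2 * y ^ (δ - 2 * β)))
      + A ^ 2 * (u ^ 2 * y ^ (3 * δ - 2 * α)) := by
  have hpos : 0 < y := by linarith
  have n1 : 0 ≤ w ^ 2 * y ^ (δ - 2 * β) := by positivity
  have n2 : 0 ≤ A ^ 2 * (u ^ 2 * y ^ (3 * δ - 2 * α)) := by positivity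
  rcases le_total ((u * y ^ (δ - α)) ^ 2) 1 with h5 | h5
  · have : 1 / 2 ≤ 1 / (1 + (u * y ^ (δ - α)) ^ 2) :=
      one_div_le_one_div_of_le (by positivity) (by linarith)
    nlinarith
  · have e1 : w ^ 2 * y ^ (δ - 2 * β) ≤ A ^ 2 * y ^ δ := by
      have e2 := pow_le_pow_left₀ (abs_nonneg _) hw 2
      rw [sq_abs, mul_pow, ← Real.rpow_natCast (y ^ β), ← Real.rpow_mul hpos.le] at e2
      calc _ ≤ A ^ 2 * y ^ (β * (2 : ℕ)) * y ^ (δ - 2 * β) := by gcongr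
        _ = A ^ 2 * y ^ δ := by
          rw [mul_assoc, ← Real.rpow_add hpos]
          push_cast
          ring_nf
    have e3 : u ^ 2 * y ^ (3 * δ - 2 * α) = (u * y ^ (δ - α)) ^ 2 * y ^ δ := by
      rw [mul_pow, ← Real.rpow_natCast (y ^ (δ - α)), ← Real.rpow_mul hpos.le, mul_assoc,
        ← Real.rpow_add hpos]
      push_cast
      ring_nf
    have e4 : A ^ 2 * y ^ δ ≤ A ^ 2 * ((u * y ^ (δ - α)) ^ 2 * y ^ δ) :=
      mul_le_mul_of_nonneg_left (le_mul_of_one_le_left (Real.rpow_nonneg hpos.le _) h5)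
        (sq_nonneg _)
    have e5 : 0 ≤ 8 * (1 / (1 + (u * y ^ (δ - α)) ^ 2) / 2 * (w ^ 2 * y ^ (δ - 2 * β))) := by
      positivity
    rw [e3]
    linarith

/-- The propagation step. If `U` is subcritical at `α`, moves along the flow with speed `W` up to a
subcritical error, and `W` does not change faster than the corresponding rate `G^{β - α}` allows,
then `W` is subcritical at `β`: the function `arctan (U G^{δ - α}) W G^{α - 2β}` is bounded and
its derivative along `Z` dominates `W² G^{δ - 2β}` wherever `U` is small. -/
theorem Subcritical.propagate (hG : ∀ x, 1 ≤ S.energy Γ x) {D : ℝ}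
    (hgap : ∀ x b, S.bathGap b x ^ 2 ≤ D * S.energy Γ x)
    {U W E : ChainSpace N → ℝ} {α β : ℝ} (hU : ContDiff ℝ ∞ U) (hW : ContDiff ℝ ∞ W)
    (h : S.Subcritical Γ U α) (hE : S.Subcritical Γ E β) (hαβ : α ≤ β) (hβ : 1 / 2 ≤ β)
    (hUW : ∀ x, S.along U x = W x + E x) (hWb : S.PowBound Γ W β)
    (hZW : S.PowBound Γ (S.along W) (2 * β - α))
    (hUr : ∀ b x, |pd (r b) U x| ≤ 1) (hWr : ∀ b x, pd (r b) W x = 0) :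
    S.Subcritical Γ W β := by
  obtain ⟨δ₁, h1, c1⟩ := h.exists_forall_le hG
  obtain ⟨δ₂, h2, c2⟩ := hE.exists_forall_le hG
  obtain ⟨A, hA0, hA⟩ := hWb.exists_le hG
  obtain ⟨B, hB0, hB⟩ := hZW.exists_le hG
  obtain ⟨L, hL0, hLr, hLZ⟩ := exists_abs_div_energy_le hG hgap
  -- the error made where `U` is not small is `U² G^{3δ - 2α}`, whence the gain `3δ ≤ δ₁` for `U`;
  -- `δ ≤ 1/2` makes the bath derivatives of `t v` bounded
  obtain ⟨δ, hδ0, hδ1, hδ2, hδ3⟩ : ∃ δ, 0 < δ ∧ 3 * δ ≤ δ₁ ∧ δ ≤ δ₂ ∧ δ ≤ 1 / 2 :=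
    ⟨min (δ₁ / 3) (min δ₂ (1 / 2)), lt_min (by linarith) (lt_min h2 (by norm_num)),
      by linarith [min_le_left (δ₁ / 3) (min δ₂ (1 / 2))],
      (min_le_right _ _).trans (min_le_left _ _), (min_le_right _ _).trans (min_le_right _ _)⟩
  have hc1 := c1 (3 * δ) hδ1
  have hc2 := c2 δ hδ2
  refine ⟨hW.continuous, δ, hδ0, ?_⟩
  have hGc (a : ℝ) : ContDiff ℝ ∞ fun x => S.energy Γ x ^ a :=
    (contDiff_energy Γ).rpow_const_of_ne fun x => by linarith [hG x]
  set t : ChainSpace N → ℝ := fun x => U x * S.energy Γ x ^ (δ - α) with ht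
  set v : ChainSpace N → ℝ := fun x => W x * S.energy Γ x ^ (α - 2 * β) with hv
  have hφ : ContDiff ℝ ∞ fun x => Real.arctan (t x) * v x :=
    (Real.contDiff_arctan.comp (hU.mul (hGc _))).mul (hW.mul (hGc _))
  have hvA (x : ChainSpace N) : |v x| ≤ A := by
    have hpos : 0 < S.energy Γ x := by linarith [hG x]
    have e : S.energy Γ x ^ β * S.energy Γ x ^ (α - 2 * β) ≤ 1 := by
      rw [← Real.rpow_add hpos]
      exact Real.rpow_le_one_of_one_le_of_nonpos (hG x) (by linarith)
    rw [hv]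
    simp only [abs_mul, abs_of_pos (Real.rpow_pos_of_pos hpos _)]
    calc |W x| * S.energy Γ x ^ (α - 2 * β)
        ≤ A * S.energy Γ x ^ β * S.energy Γ x ^ (α - 2 * β) := by gcongr; exact hA x
      _ ≤ A := by rw [mul_assoc]; exact mul_le_of_le_one_right hA0 e
  have harc (s : ℝ) : |Real.arctan s| ≤ 2 := by
    rw [abs_le]
    constructor <;> linarith [Real.arctan_lt_pi_div_two s, Real.neg_pi_div_two_lt_arctan s,
      Real.pi_lt_four]
  have hfrac (s : ℝ) : |1 / (1 + s ^ 2) * s| ≤ 1 := by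
    rw [one_div_mul_eq_div, abs_div, abs_of_pos (show 0 < 1 + s ^ 2 by positivity),
      div_le_one (by positivity), abs_le]
    constructor <;> nlinarith [sq_nonneg (s - 1), sq_nonneg (s + 1)]
  have hfrac1 (s : ℝ) : 1 / (1 + s ^ 2) ≤ 1 := by
    rw [div_le_one (by positivity)]; nlinarith [sq_nonneg s]
  have hfrac0 (s : ℝ) : 0 ≤ 1 / (1 + s ^ 2) := by positivity
  -- the terms in which the powers of the energy are differentiated are bounded
  have rest (x : ChainSpace N) (g : ℝ) (hg : |g| ≤ L) :
      |1 / (1 + t x ^ 2) * (t x * ((δ - α) * g)) * v x| ≤ |δ - α| * L * A ∧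
      |Real.arctan (t x) * (v x * ((α - 2 * β) * g))| ≤ 2 * (A * (|α - 2 * β| * L)) := by
    constructor
    · have e : 1 / (1 + t x ^ 2) * (t x * ((δ - α) * g)) * v x
          = (1 / (1 + t x ^ 2) * t x) * ((δ - α) * g) * v x := by ring
      rw [e, abs_mul, abs_mul, abs_mul (δ - α)]
      have h4 : |1 / (1 + t x ^ 2) * t x| * (|δ - α| * |g|) ≤ 1 * (|δ - α| * L) :=
        mul_le_mul (hfrac _) (by gcongr) (by positivity) zero_le_one
      rw [one_mul] at h4
      exact mul_le_mul h4 (hvA x) (abs_nonneg _) (by positivity)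
    · rw [abs_mul, abs_mul (v x), abs_mul (α - 2 * β)]
      have h4 : |v x| * (|α - 2 * β| * |g|) ≤ A * (|α - 2 * β| * L) :=
        mul_le_mul (hvA x) (by gcongr) (by positivity) hA0
      exact mul_le_mul (harc _) h4 (by positivity) zero_le_two
  set M : ℝ := 2 * A + A + |δ - α| * L * A + 2 * (A * (|α - 2 * β| * L)) with hM
  have hM1 : 0 ≤ |δ - α| * L * A := by positivity
  have hM2 : 0 ≤ 2 * (A * (|α - 2 * β| * L)) := by positivity
  set M' : ℝ := 2 * B + |δ - α| * L * A + 2 * (A * (|α - 2 * β| * L)) with hM'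
  have ctrl : S.Controlled fun x => 8 * M' * 1 + (4 * (E x ^ 2 * S.energy Γ x ^ (δ - 2 * β))
      + A ^ 2 * (U x ^ 2 * S.energy Γ x ^ (3 * δ - 2 * α))) :=
    (Controlled.one.const_mul (by positivity)).add
      ((hc2.const_mul (by norm_num)).add (hc1.const_mul (sq_nonneg A)))
  refine Controlled.of_along ((hW.continuous.pow 2).mul (continuous_energy_rpow hG _)) ctrl hφ
    (M := M) (fun x => ?_) (fun b x => ?_) (c := 8) (by norm_num) fun x => ?_
  · rw [abs_mul]
    have := mul_le_mul (harc (t x)) (hvA x) (abs_nonneg _) zero_le_two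
    linarith
  · have hpos : 0 < S.energy Γ x := by linarith [hG x]
    rw [pd, fderiv_arctan_mul_rpow hU hW hG]
    have w0 := hWr b x
    have u0 := hUr b x
    rw [pd] at w0 u0
    rw [w0, zero_mul, zero_add, mul_add, add_mul]
    obtain ⟨r1, r2⟩ := rest x _ (hLr b x)
    have r3 : |1 / (1 + t x ^ 2) * (fderiv ℝ U x (EuclideanSpace.single (r b) 1)
        * S.energy Γ x ^ (δ - α)) * v x| ≤ A := by
      have e : S.energy Γ x ^ (δ - α) * S.energy Γ x ^ β * S.energy Γ x ^ (α - 2 * β) ≤ 1 := by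
        rw [← Real.rpow_add hpos, ← Real.rpow_add hpos]
        exact Real.rpow_le_one_of_one_le_of_nonpos (hG x) (by linarith)
      have e2 : S.energy Γ x ^ (δ - α) * |v x| ≤ A := by
        rw [hv]
        simp only [abs_mul, abs_of_pos (Real.rpow_pos_of_pos hpos _)]
        calc S.energy Γ x ^ (δ - α) * (|W x| * S.energy Γ x ^ (α - 2 * β))
            ≤ S.energy Γ x ^ (δ - α) * (A * S.energy Γ x ^ β * S.energy Γ x ^ (α - 2 * β)) := by
              gcongr; exact hA x
          _ = A * (S.energy Γ x ^ (δ - α) * S.energy Γ x ^ β * S.energy Γ x ^ (α - 2 * β)) := by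
              ring
          _ ≤ A := mul_le_of_le_one_right hA0 e
      rw [abs_mul, abs_mul, abs_mul, abs_of_nonneg (hfrac0 _),
        abs_of_pos (Real.rpow_pos_of_pos hpos _)]
      calc _ ≤ 1 * (1 * S.energy Γ x ^ (δ - α)) * |v x| := by
            gcongr
            exact hfrac1 _
        _ ≤ A := by rw [one_mul, one_mul]; exact e2
    refine (abs_add_le _ _).trans ?_
    have := abs_add_le (1 / (1 + t x ^ 2) * (fderiv ℝ U x (EuclideanSpace.single (r b) 1)
        * S.energy Γ x ^ (δ - α)) * v x) (1 / (1 + t x ^ 2) * (t x * ((δ - α) *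
        (pd (r b) (S.energy Γ) x / S.energy Γ x))) * v x)
    exact (add_le_add (this.trans (add_le_add r3 r1)) r2).trans (by linarith)
  · have hpos : 0 < S.energy Γ x := by linarith [hG x]
    have hZ : S.along (fun x => Real.arctan (t x) * v x) x = _ :=
      fderiv_arctan_mul_rpow hU hW hG _ _ x (S.drift x)
    obtain ⟨r1, r2⟩ := rest x _ (hLZ x)
    have r3 : |Real.arctan (t x) * (S.along W x * S.energy Γ x ^ (α - 2 * β))| ≤ 2 * B := by
      rw [abs_mul, abs_mul, abs_of_pos (Real.rpow_pos_of_pos hpos _)]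
      have e : |S.along W x| * S.energy Γ x ^ (α - 2 * β) ≤ B := by
        calc _ ≤ B * S.energy Γ x ^ (2 * β - α) * S.energy Γ x ^ (α - 2 * β) := by
              gcongr; exact hB x
          _ = B := by
              rw [mul_assoc, ← Real.rpow_add hpos]
              ring_nf
              simp
      exact mul_le_mul (harc _) e (by positivity) zero_le_two
    -- `k` is the derivative of the arctangent at `t`
    set k : ℝ := 1 / (1 + t x ^ 2) with hk
    have hZ2 : S.along (fun x => Real.arctan (t x) * v x) x
        = k * ((W x ^ 2 + E x * W x) * S.energy Γ x ^ (δ - 2 * β))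
          + k * (t x * ((δ - α) * (S.along (S.energy Γ) x / S.energy Γ x))) * v x
          + Real.arctan (t x) * (S.along W x * S.energy Γ x ^ (α - 2 * β))
          + Real.arctan (t x) * (v x * ((α - 2 * β) *
            (S.along (S.energy Γ) x / S.energy Γ x))) := by
      rw [hZ]
      have e1 : S.energy Γ x ^ (δ - 2 * β)
          = S.energy Γ x ^ (δ - α) * S.energy Γ x ^ (α - 2 * β) := by
        rw [← Real.rpow_add hpos]; ring_nf
      have e2 : fderiv ℝ U x (S.drift x) = W x + E x := hUW x
      rw [e1, e2]
      simp only [hk, ht, hv, along]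
      ring
    have lower : k / 2 * (W x ^ 2 * S.energy Γ x ^ (δ - 2 * β))
        ≤ S.along (fun x => Real.arctan (t x) * v x) x
          + 1 / 2 * (E x ^ 2 * S.energy Γ x ^ (δ - 2 * β)) + M' := by
      have e1 : k / 2 * (W x ^ 2 * S.energy Γ x ^ (δ - 2 * β))
          - 1 / 2 * (E x ^ 2 * S.energy Γ x ^ (δ - 2 * β))
          ≤ k * ((W x ^ 2 + E x * W x) * S.energy Γ x ^ (δ - 2 * β)) :=
        mul_sq_sub_le (hfrac0 _) (hfrac1 _) (Real.rpow_nonneg hpos.le _) _ _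
      rw [hZ2]
      linarith [neg_le_of_abs_le r1, neg_le_of_abs_le r2, neg_le_of_abs_le r3]
    have hwsq := sq_mul_rpow_le (hG x) (hA x) (U x) α δ
    linarith

end OscillatorChain

end

/-! ### Subcriticality along the chain -/

noncomputable section

open Asymptotics

theorem rpow_le_of_rpow_le {y a C g s : ℝ} (hy : 0 ≤ y) (ha : 0 < a) (hC : 0 ≤ C) (hg : 0 ≤ g)
    (h : y ^ a ≤ C * g) (hs : 0 ≤ s) : y ^ s ≤ C ^ (s / a) * g ^ (s / a) := by
  have := Real.rpow_le_rpow (by positivity) h (z := s / a) (by positivity)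
  rwa [← Real.rpow_mul hy, mul_div_cancel₀ _ ha.ne', Real.mul_rpow hC hg] at this

theorem abs_le_one_add_sq_rpow (z : ℝ) : |z| ≤ (1 + z ^ 2) ^ (1 / 2 : ℝ) := by
  rw [← Real.sqrt_eq_rpow]
  exact Real.abs_le_sqrt (by linarith)

theorem one_add_sq_rpow_le (z : ℝ) : (1 + z ^ 2) ^ (1 / 2 : ℝ) ≤ 1 + |z| := by
  rw [← Real.sqrt_eq_rpow, Real.sqrt_le_left (by positivity)]
  nlinarith [abs_nonneg z, sq_abs z]

namespace OscillatorChain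

open ChainCoord

variable {N : ℕ} {S : OscillatorChain N} {Γ : ℝ}

namespace PowBound

variable {f g : ChainSpace N → ℝ} {a b : ℝ}

theorem add (hf : S.PowBound Γ f a) (hg : S.PowBound Γ g a) :
    S.PowBound Γ (fun x => f x + g x) a := IsBigO.add hf hg

theorem sub (hf : S.PowBound Γ f a) (hg : S.PowBound Γ g a) :
    S.PowBound Γ (fun x => f x - g x) a := IsBigO.sub hf hg

theorem const_mul (hf : S.PowBound Γ f a) (c : ℝ) :
    S.PowBound Γ (fun x => c * f x) a := IsBigO.const_mul_left hf c

theorem sum {ι : Type*} (s : Finset ι) {f : ι → ChainSpace N → ℝ}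
    (h : ∀ i ∈ s, S.PowBound Γ (f i) a) : S.PowBound Γ (fun x => ∑ i ∈ s, f i x) a :=
  IsBigO.fun_sum h

theorem of_rpow_le (hG : ∀ x, 1 ≤ S.energy Γ x) {z : ChainSpace N → ℝ} {C : ℝ} (ha : 0 < a)
    (hC : 0 ≤ C) (hz : ∀ x, (1 + z x ^ 2) ^ a ≤ C * S.energy Γ x) {s K : ℝ} (hs : 0 ≤ s)
    (hK : 0 ≤ K) (hf : ∀ x, |f x| ≤ K * (1 + z x ^ 2) ^ s) : S.PowBound Γ f (s / a) :=
  of_le hG (C := K * C ^ (s / a)) fun x => (hf x).trans <| by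
    rw [mul_assoc]
    exact mul_le_mul_of_nonneg_left
      (rpow_le_of_rpow_le (by positivity) ha hC (by linarith [hG x]) (hz x) hs) hK

end PowBound

namespace Subcritical

variable {U V : ChainSpace N → ℝ} {a b : ℝ}

theorem mono_exponent (hG : ∀ x, 1 ≤ S.energy Γ x) (h : S.Subcritical Γ U a) (hab : a ≤ b) :
    S.Subcritical Γ U b := by
  obtain ⟨hc, δ, hδ, h⟩ := h
  refine ⟨hc, δ, hδ, h.mono ((hc.pow 2).mul (continuous_energy_rpow hG _)) zero_le_one fun x => ?_⟩
  rw [one_mul]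
  exact mul_le_mul_of_nonneg_left (Real.rpow_le_rpow_of_exponent_le (hG x) (by linarith))
    (sq_nonneg _)

theorem mono_mul (hG : ∀ x, 1 ≤ S.energy Γ x) (h : S.Subcritical Γ V a) (hc : Continuous U)
    {C : ℝ} (hle : ∀ x, |U x| ≤ C * (|V x| * S.energy Γ x ^ b)) :
    S.Subcritical Γ U (a + b) := by
  obtain ⟨hV, δ, hδ, h⟩ := h
  refine ⟨hc, δ, hδ, h.mono ((hc.pow 2).mul (continuous_energy_rpow hG _)) (sq_nonneg C)
    fun x => ?_⟩
  have hpos : 0 < S.energy Γ x := by linarith [hG x]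
  have h1 := pow_le_pow_left₀ (abs_nonneg _) (hle x) 2
  rw [sq_abs, mul_pow, mul_pow, sq_abs, ← Real.rpow_natCast (S.energy Γ x ^ b),
    ← Real.rpow_mul hpos.le] at h1
  calc U x ^ 2 * S.energy Γ x ^ (δ - 2 * (a + b))
      ≤ C ^ 2 * (V x ^ 2 * S.energy Γ x ^ (b * (2 : ℕ))) * S.energy Γ x ^ (δ - 2 * (a + b)) := by
        gcongr
    _ = C ^ 2 * (V x ^ 2 * (S.energy Γ x ^ (b * (2 : ℕ)) * S.energy Γ x ^ (δ - 2 * (a + b)))) := by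
        ring
    _ = C ^ 2 * (V x ^ 2 * S.energy Γ x ^ (δ - 2 * a)) := by
        rw [← Real.rpow_add hpos]
        push_cast
        ring_nf

theorem one_add_abs (hG : ∀ x, 1 ≤ S.energy Γ x) (h : S.Subcritical Γ U a) (ha : 0 < a) :
    S.Subcritical Γ (fun x => 1 + |U x|) a :=
  (of_powBound hG continuous_const (.of_le hG (C := 1) (a := 0) (by simp)) ha).add hG
    (h.mono hG h.1.abs (C := 1) fun x => by simp)

/-- Powers of a subcritical coordinate of homogeneity `1 / (2a)` are subcritical. -/
theorem rpow (hG : ∀ x, 1 ≤ S.energy Γ x) {C : ℝ} (ha : 0 < a) (hC : 0 ≤ C)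
    (hU : ∀ x, (1 + U x ^ 2) ^ a ≤ C * S.energy Γ x) (h : S.Subcritical Γ U (1 / (2 * a)))
    {s K : ℝ} (hs : 1 / 2 ≤ s) (hc : Continuous V) (hK : 0 ≤ K)
    (hV : ∀ x, |V x| ≤ K * (1 + U x ^ 2) ^ s) : S.Subcritical Γ V (s / a) := by
  have key := (h.one_add_abs hG (by positivity)).mono_mul hG hc (b := (s - 1 / 2) / a)
    (C := K * C ^ ((s - 1 / 2) / a)) fun x => ?_
  · convert key using 1
    field_simp
    ring
  · have h1 := rpow_le_of_rpow_le (by positivity) ha hC (by linarith [hG x]) (hU x)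
      (show 0 ≤ s - 1 / 2 by linarith)
    have h2 : (1 + U x ^ 2) ^ s = (1 + U x ^ 2) ^ (1 / 2 : ℝ) * (1 + U x ^ 2) ^ (s - 1 / 2) := by
      rw [← Real.rpow_add (by positivity)]; ring_nf
    have h3 := one_add_sq_rpow_le (U x)
    have h4 : 0 ≤ (1 + U x ^ 2) ^ (s - 1 / 2) := by positivity
    calc |V x| ≤ K * (1 + U x ^ 2) ^ s := hV x
      _ ≤ K * ((1 + |U x|) * (C ^ ((s - 1 / 2) / a) * S.energy Γ x ^ ((s - 1 / 2) / a))) := by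
          rw [h2]
          gcongr
      _ = _ := by
          rw [abs_of_nonneg (show 0 ≤ 1 + |U x| by positivity)]
          ring

theorem deriv_comp (hG : ∀ x, 1 ≤ S.energy Γ x) {C : ℝ} (ha : 1 < a) (hC : 0 ≤ C)
    (hU : ∀ x, (1 + U x ^ 2) ^ a ≤ C * S.energy Γ x) (h : S.Subcritical Γ U (1 / (2 * a)))
    {Φ : ℝ → ℝ} (hΦ : PotentialGrowth Φ a) (hΦc : Continuous (deriv Φ)) :
    S.Subcritical Γ (fun x => deriv Φ (U x)) (1 - 1 / (2 * a)) := by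
  obtain ⟨K, hK⟩ := hΦ.abs_deriv_le
  have := h.rpow hG (by linarith) hC hU (s := a - 1 / 2) (K := |K|) (by linarith)
    (hΦc.comp h.1) (abs_nonneg _) fun x => (hK (U x)).trans (by gcongr; exact le_abs_self K)
  convert this using 1
  · rfl
  · field_simp

/-- If the force is subcritical then so is the coordinate it depends on. -/
theorem of_deriv_comp (hG : ∀ x, 1 ≤ S.energy Γ x) (ha : 1 < a) (hUc : Continuous U)
    {Φ : ℝ → ℝ} (hΦ : PotentialGrowth Φ a)
    (h : S.Subcritical Γ (fun x => deriv Φ (U x)) (1 - 1 / (2 * a))) :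
    S.Subcritical Γ U (1 / (2 * a)) := by
  obtain ⟨K, hK0, hK⟩ := hΦ.le_abs_deriv
  have hpa : 0 < 1 - 1 / (2 * a) := by
    rw [sub_pos, div_lt_one (by linarith)]; linarith
  obtain ⟨-, δ, hδ, hψ⟩ := h.one_add_abs hG hpa
  have hκ : 1 < 2 * a - 1 := by linarith
  refine ⟨hUc, δ / (2 * a - 1), div_pos hδ (by linarith),
    (Controlled.one.add (hψ.const_mul (sq_nonneg K))).mono
      ((hUc.pow 2).mul (continuous_energy_rpow hG _)) zero_le_one fun x => ?_⟩
  have hpos : 0 < S.energy Γ x := by linarith [hG x]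
  set y := 1 + U x ^ 2 with hy
  have hy0 : 0 < y := by positivity
  set X := y * S.energy Γ x ^ (δ / (2 * a - 1) - 2 * (1 / (2 * a))) with hX
  have hX0 : 0 ≤ X := by positivity
  have h1 : X ≤ 1 + X ^ (2 * a - 1) := by
    rcases le_total X 1 with h | h
    · linarith [Real.rpow_nonneg hX0 (2 * a - 1)]
    · have := Real.rpow_le_rpow_of_exponent_le h hκ.le
      rw [Real.rpow_one] at this
      linarith
  have h2 : X ^ (2 * a - 1) ≤ K ^ 2 * ((1 + |deriv Φ (U x)|) ^ 2
      * S.energy Γ x ^ (δ - 2 * (1 - 1 / (2 * a)))) := by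
    have e1 : X ^ (2 * a - 1) = (y ^ (a - 1 / 2)) ^ 2
        * S.energy Γ x ^ (δ - 2 * (1 - 1 / (2 * a))) := by
      rw [hX, Real.mul_rpow hy0.le (by positivity), ← Real.rpow_mul hpos.le,
        ← Real.rpow_natCast (y ^ (a - 1 / 2)), ← Real.rpow_mul hy0.le]
      congr 2
      · push_cast; ring
      · field_simp
    have e2 := pow_le_pow_left₀ (by positivity) (hK (U x)) 2
    rw [e1, ← mul_assoc, ← mul_pow]
    gcongr
  have h3 : U x ^ 2 * S.energy Γ x ^ (δ / (2 * a - 1) - 2 * (1 / (2 * a))) ≤ X := by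
    rw [hX]
    gcongr
    linarith
  simp only
  linarith

end Subcritical

variable {n m C : ℝ}

/-! #### Bounds of the coordinates and forces -/

theorem EnergyBounds.powBound_of_sq_le (hG : ∀ x, 1 ≤ S.energy Γ x) {f : ChainSpace N → ℝ}
    (h : ∀ x, f x ^ 2 ≤ C * S.energy Γ x) : S.PowBound Γ f (1 / 2) :=
  .of_le hG (C := Real.sqrt C) fun x => by
    have hpos : 0 < S.energy Γ x := by linarith [hG x]
    rw [← Real.sqrt_eq_rpow, ← Real.sqrt_mul' _ hpos.le]
    exact Real.abs_le_sqrt (h x)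

theorem EnergyBounds.powBound_p (hE : EnergyBounds S Γ n m C) (i : Fin (N + 1)) :
    S.PowBound Γ (fun x => x (p i)) (1 / 2) :=
  powBound_of_sq_le hE.one_le fun x => hE.p_le x i

theorem EnergyBounds.powBound_gap (hE : EnergyBounds S Γ n m C) (b : Fin 2) :
    S.PowBound Γ (S.bathGap b) (1 / 2) :=
  powBound_of_sq_le hE.one_le fun x => hE.gap_le x b

theorem PowBound.coord (hG : ∀ x, 1 ≤ S.energy Γ x) {z : ChainSpace N → ℝ} {a : ℝ} (ha : 1 < a)
    (hC : 0 ≤ C) (hz : ∀ x, (1 + z x ^ 2) ^ a ≤ C * S.energy Γ x) :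
    S.PowBound Γ z (1 / (2 * a)) := by
  have := of_rpow_le (f := z) hG (by linarith) hC hz (s := 1 / 2) (by norm_num) zero_le_one
    fun x => by rw [one_mul]; exact abs_le_one_add_sq_rpow _
  convert this using 1
  field_simp

theorem PowBound.deriv_comp (hG : ∀ x, 1 ≤ S.energy Γ x) {z : ChainSpace N → ℝ} {a : ℝ}
    (ha : 1 < a) (hC : 0 ≤ C) (hz : ∀ x, (1 + z x ^ 2) ^ a ≤ C * S.energy Γ x) {Φ : ℝ → ℝ}
    (hΦ : PotentialGrowth Φ a) : S.PowBound Γ (fun x => deriv Φ (z x)) (1 - 1 / (2 * a)) := by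
  obtain ⟨K, hK⟩ := hΦ.abs_deriv_le
  have := of_rpow_le (f := fun x => deriv Φ (z x)) hG (by linarith) hC hz (s := a - 1 / 2)
    (by linarith) (abs_nonneg K)
    fun x => (hK (z x)).trans (by gcongr; exact le_abs_self K)
  convert this using 1
  field_simp

theorem PowBound.deriv_deriv_comp (hG : ∀ x, 1 ≤ S.energy Γ x) {z : ChainSpace N → ℝ} {a : ℝ}
    (ha : 1 < a) (hC : 0 ≤ C) (hz : ∀ x, (1 + z x ^ 2) ^ a ≤ C * S.energy Γ x) {Φ : ℝ → ℝ}
    (hΦ : PotentialGrowth Φ a) :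
    S.PowBound Γ (fun x => deriv (deriv Φ) (z x)) (1 - 1 / a) := by
  obtain ⟨K, hK⟩ := hΦ.abs_deriv_deriv_le
  have := of_rpow_le (f := fun x => deriv (deriv Φ) (z x)) hG (by linarith) hC hz (s := a - 1)
    (by linarith) (abs_nonneg K)
    fun x => (hK (z x)).trans (by gcongr; exact le_abs_self K)
  convert this using 1
  field_simp

theorem EnergyBounds.powBound_r (hE : EnergyBounds S Γ n m C) (hC : 0 ≤ C) (hn : 1 < n)
    (b : Fin 2) : S.PowBound Γ (fun x => x (r b)) (1 / 2) := by
  have h1 := hE.powBound_gap b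
  have h2 := (PowBound.coord hE.one_le hn hC fun x => hE.q_le x (bathSite N b)).mono hE.one_le
    (b := 1 / 2) (by
      apply one_div_le_one_div_of_le <;> linarith)
  have := h1.add (h2.const_mul (S.lam b ^ 2))
  refine this.congr_left fun x => ?_
  simp [bathGap]

theorem one_sub_lt {a b : ℝ} (ha : 1 < a) (hab : a < b) : 1 - 1 / (2 * a) < 1 - 1 / (2 * b) := by
  have : 1 / (2 * b) < 1 / (2 * a) := one_div_lt_one_div_of_lt (by linarith) (by linarith)
  linarith

theorem half_lt_one_sub {a : ℝ} (ha : 1 < a) : 1 / 2 < 1 - 1 / (2 * a) := by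
  have : 1 / (2 * a) < 1 / 2 := one_div_lt_one_div_of_lt (by linarith) (by linarith)
  linarith

theorem EnergyBounds.powBound_drift_p (hE : EnergyBounds S Γ n m C) (hC : 0 ≤ C) (hn : 1 < n)
    (hm : n < m) (h1 : PotentialGrowth S.V₁ n) (h2 : PotentialGrowth S.V₂ m) (i : Fin (N + 1)) :
    S.PowBound Γ (fun x => S.drift x (p i)) (1 - 1 / (2 * m)) := by
  have hG := hE.one_le
  simp only [drift_p]
  refine ((PowBound.sum _ fun b _ => ?_).sub ?_).sub (PowBound.sum _ fun j _ => ?_)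
  · split_ifs
    · exact (hE.powBound_r hC hn b).mono hG (half_lt_one_sub (by linarith)).le
    · exact .of_le hG (C := 0) (by simp)
  · exact (PowBound.deriv_comp hG hn hC (fun x => hE.q_le x i) h1).mono hG (one_sub_lt hn hm).le
  · simp only [mul_comm (deriv S.V₂ _)]
    exact (PowBound.deriv_comp hG (by linarith) hC (fun x => hE.bond_le x j) h2).const_mul _

/-! #### Derivatives along the flow -/

theorem along_bond (j : Fin N) (x : ChainSpace N) :
    S.along (bond j) x = x (p j.succ) - x (p j.castSucc) := by
  have h (k : ChainCoord N) : HasFDerivAt (fun y : ChainSpace N => y k)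
    (EuclideanSpace.proj (𝕜 := ℝ) k) x := (EuclideanSpace.proj (𝕜 := ℝ) k).hasFDerivAt
  have e : fderiv ℝ (bond j) x = _ := ((h (q j.succ)).sub (h (q j.castSucc))).fderiv
  rw [along, e]
  simp [drift_q]

theorem along_gap (b : Fin 2) (x : ChainSpace N) :
    S.along (S.bathGap b) x
      = - (S.lam b ^ 2 * x (p (bathSite N b))) - S.bCoef b * S.bathGap b x := by
  have h (k : ChainCoord N) : HasFDerivAt (fun y : ChainSpace N => y k)
    (EuclideanSpace.proj (𝕜 := ℝ) k) x := (EuclideanSpace.proj (𝕜 := ℝ) k).hasFDerivAt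
  have e : fderiv ℝ (S.bathGap b) x = _ :=
    ((h (r b)).sub ((h (q (bathSite N b))).const_mul (S.lam b ^ 2))).fderiv
  rw [along, e]
  simp [drift_q, drift_r]
  ring

theorem along_const_mul {f : ChainSpace N → ℝ} (hf : ContDiff ℝ ∞ f) (c : ℝ) (x : ChainSpace N) :
    S.along (fun y => c * f y) x = c * S.along f x := by
  simp only [along]
  rw [fderiv_const_mul (hf.differentiable (by simp) x)]
  simp

theorem pd_r_gap_le (b b' : Fin 2) (x : ChainSpace N) : |pd (r b) (S.bathGap b') x| ≤ 1 := by
  have h (k : ChainCoord N) : HasFDerivAt (fun y : ChainSpace N => y k)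
    (EuclideanSpace.proj (𝕜 := ℝ) k) x := (EuclideanSpace.proj (𝕜 := ℝ) k).hasFDerivAt
  have e : fderiv ℝ (S.bathGap b') x = _ :=
    ((h (r b')).sub ((h (q (bathSite N b'))).const_mul (S.lam b' ^ 2))).fderiv
  rw [pd, e]
  simp only [sub_apply, smul_apply, PiLp.proj_apply]
  by_cases hb : b' = b <;> simp [hb]

/-! #### The induction along the chain -/

theorem subcritical_gap (hm : 0 < m) (b : Fin 2) : S.Subcritical Γ (S.bathGap b) (1 / (2 * m)) :=
  ⟨(contDiff_bathGap b).continuous, 2 * (1 / (2 * m)), by positivity,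
    by simpa using Controlled.gap (S := S) b⟩

/-- The first particle: its momentum drives the variable of the left bath. -/
theorem EnergyBounds.subcritical_p_zero (hE : EnergyBounds S Γ n m C) (hC : 0 ≤ C) (hn : 1 < n)
    (hm : n < m) (h1 : PotentialGrowth S.V₁ n) (h2 : PotentialGrowth S.V₂ m) :
    S.Subcritical Γ (fun x => x (p 0)) (1 / 2) := by
  have hG := hE.one_le
  have hm2 : 1 / (2 * m) ≤ 1 / 2 := by apply one_div_le_one_div_of_le <;> linarith
  have hs := subcritical_gap (S := S) (Γ := Γ) (show 0 < m by linarith) 0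
  have hp : ContDiff ℝ ∞ fun x : ChainSpace N => x (p 0) := contDiff_coord _
  -- the bath gap moves with speed `-λ² p₀`, up to a multiple of itself
  have key := Subcritical.propagate hG hE.gap_le (U := S.bathGap 0)
    (W := fun x => -(S.lam 0 ^ 2) * x (p 0)) (E := fun x => -S.bCoef 0 * S.bathGap 0 x)
    (α := 1 / (2 * m)) (β := 1 / 2) (contDiff_bathGap 0) (contDiff_const.mul hp) hs
    ((hs.mono_exponent hG hm2).const_mul hG _) hm2 le_rfl
    (fun x => by rw [along_gap]; simp [bathSite]; ring)
    ((hE.powBound_p 0).const_mul _) ?_ (fun b x => pd_r_gap_le b 0 x) (fun b x => ?_)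
  · refine (key.const_mul hG (-(S.lam 0 ^ 2)⁻¹)).mono hG hp.continuous (C := 1) fun x => ?_
    have := S.lam_ne_zero 0
    rw [one_mul]
    refine le_of_eq ?_
    congr 1
    field_simp
  · have := (hE.powBound_drift_p hC hn hm h1 h2 0).const_mul (-(S.lam 0 ^ 2))
    convert this using 1
    · funext x
      rw [along_const_mul hp, along_coord]
    · ring
  · exact pd_eq_zero_of_invariant (contDiff_const.mul hp) (by simp) x

/-- The propagation from one particle to the next: the momentum of a particle is driven by the force
of the next bond, whose elongation is driven by the momentum of the next particle. -/
theorem EnergyBounds.subcritical_succ (hE : EnergyBounds S Γ n m C) (hC : 0 ≤ C) (hn : 1 < n)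
    (hm : n < m) (h1 : PotentialGrowth S.V₁ n) (h2 : PotentialGrowth S.V₂ m) (j : Fin N)
    (hp : S.Subcritical Γ (fun x => x (p j.castSucc)) (1 / 2))
    (hb : ∀ j' : Fin N, j'.succ ≤ j.castSucc → S.Subcritical Γ (bond j') (1 / (2 * m))) :
    S.Subcritical Γ (bond j) (1 / (2 * m)) ∧ S.Subcritical Γ (fun x => x (p j.succ)) (1 / 2) := by
  have hG := hE.one_le
  have hm1 : 1 < m := by linarith
  have hm2 : 1 / (2 * m) ≤ 1 / 2 := by apply one_div_le_one_div_of_le <;> linarith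
  have hhalf := half_lt_one_sub hm1
  have cp (i : Fin (N + 1)) : ContDiff ℝ ∞ fun x : ChainSpace N => x (p i) := contDiff_coord _
  have cV : ContDiff ℝ ∞ fun x : ChainSpace N => deriv S.V₂ (bond j x) :=
    contDiff_deriv_V₂.comp (contDiff_bond _)
  -- in the acceleration of particle `j`, the bath variable and the pinning force are of lower order
  -- (the latter because `n < m`), and the force of the preceding bond is subcritical by `hb`
  have force : S.Subcritical Γ (fun x => deriv S.V₂ (bond j x)) (1 - 1 / (2 * m)) := by
    refine Subcritical.propagate hG hE.gap_le (U := fun x => x (p j.castSucc))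
      (W := fun x => deriv S.V₂ (bond j x))
      (E := fun x => ∑ b : Fin 2, (if j.castSucc = bathSite N b then x (r b) else 0)
        - deriv S.V₁ (x (q j.castSucc)) - ∑ j' : Fin N,
          (if j.castSucc = j'.succ then deriv S.V₂ (bond j' x) else 0))
      (α := 1 / 2) (β := 1 - 1 / (2 * m)) (cp _) cV hp ?_ hhalf.le hhalf.le (fun x => ?_)
      (PowBound.deriv_comp hG hm1 hC (fun x => hE.bond_le x j) h2) ?_ (fun b x => ?_)
      (fun b x => pd_eq_zero_of_invariant cV (by simp [bond]) x)
    · refine ((Subcritical.sum hG _ fun b _ => ?_).sub hG ?_).sub hG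
        (Subcritical.sum hG _ fun j' _ => ?_)
      · split_ifs
        · exact .of_powBound hG (contDiff_coord _).continuous (hE.powBound_r hC hn b) hhalf
        · exact .zero hG
      · exact .of_powBound hG (contDiff_deriv_V₁.continuous.comp (contDiff_coord _).continuous)
          (PowBound.deriv_comp hG hn hC (fun x => hE.q_le x _) h1) (one_sub_lt hn hm)
      · split_ifs with hj
        · exact (hb j' hj.ge).deriv_comp hG hm1 hC (fun x => hE.bond_le x j') h2
            contDiff_deriv_V₂.continuous
        · exact .zero hG
    · rw [along_coord, drift_p]
      simp [mul_sub, Finset.sum_sub_distrib]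
      ring
    · have := (PowBound.deriv_deriv_comp hG hm1 hC (fun x => hE.bond_le x j) h2).mul hG
        ((hE.powBound_p j.succ).sub (hE.powBound_p j.castSucc))
      convert this using 1
      · funext x
        rw [along_comp (contDiff_bond j) (h' := deriv (deriv S.V₂))
          ((contDiff_deriv_V₂.differentiable (by simp) _).hasDerivAt), along_bond]
      · field_simp
        ring
    · rw [pd_coord]; simp
  have hbond := Subcritical.of_deriv_comp hG hm1 (contDiff_bond j).continuous h2 force
  refine ⟨hbond, ?_⟩
  refine Subcritical.propagate hG hE.gap_le (U := bond j) (W := fun x => x (p j.succ))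
    (E := fun x => -1 * x (p j.castSucc)) (α := 1 / (2 * m)) (β := 1 / 2) (contDiff_bond j)
    (cp _) hbond (hp.const_mul hG _) hm2 le_rfl (fun x => by rw [along_bond]; ring)
    (hE.powBound_p _) ?_ (fun b x => ?_) (fun b x => ?_)
  · convert hE.powBound_drift_p hC hn hm h1 h2 j.succ using 1
    · funext x; rw [along_coord]
    · ring
  · rw [pd_eq_zero_of_invariant (contDiff_bond j) (by simp [bond])]; simp
  · rw [pd_coord]; simp

theorem EnergyBounds.subcritical_p_bond (hE : EnergyBounds S Γ n m C) (hC : 0 ≤ C) (hn : 1 < n)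
    (hm : n < m) (h1 : PotentialGrowth S.V₁ n) (h2 : PotentialGrowth S.V₂ m) (i : Fin (N + 1)) :
    S.Subcritical Γ (fun x => x (p i)) (1 / 2) ∧
      ∀ j : Fin N, j.succ ≤ i → S.Subcritical Γ (bond j) (1 / (2 * m)) := by
  induction i using Fin.induction with
  | zero =>
    exact ⟨hE.subcritical_p_zero hC hn hm h1 h2, fun j hj => absurd (Fin.le_zero_iff.1 hj)
      (Fin.succ_ne_zero j)⟩
  | succ i ih =>
    obtain ⟨hb, hp⟩ := hE.subcritical_succ hC hn hm h1 h2 i ih.1 ih.2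
    refine ⟨hp, fun j hj => ?_⟩
    rcases (Fin.succ_le_succ_iff.1 hj).lt_or_eq with h | h
    · exact ih.2 j (by rw [Fin.le_def, Fin.lt_def] at *; simpa using h)
    · exact h ▸ hb

/-! #### The centre of mass -/

theorem EnergyBounds.powBound_q_sub (hE : EnergyBounds S Γ n m C) (hC : 0 ≤ C) (hm : 1 < m)
    (i : Fin (N + 1)) : S.PowBound Γ (fun x => x (q i) - x (q 0)) (1 / (2 * m)) := by
  induction i using Fin.induction with
  | zero => exact .of_le hE.one_le (C := 0) (by simp)
  | succ i ih =>
    refine (ih.add (PowBound.coord hE.one_le hm hC fun x => hE.bond_le x i)).congr_left fun x => ?_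
    simp [bond]

/-- As bonds are stiffer than the pinning, the pinning forces on any two particles agree up to a
lower power of the energy. -/
theorem EnergyBounds.powBound_deriv_V₁_sub (hE : EnergyBounds S Γ n m C) (hC : 0 ≤ C) (hn : 1 < n)
    (hm : n < m) (h1 : PotentialGrowth S.V₁ n) (i : Fin (N + 1)) :
    S.PowBound Γ (fun x => deriv S.V₁ (x (q 0)) - deriv S.V₁ (x (q i)))
      (1 - 1 / n + 1 / (2 * m)) := by
  have hG := hE.one_le
  obtain ⟨K, hK⟩ := h1.abs_deriv_deriv_le
  have bd (x : ChainSpace N) : |deriv S.V₁ (x (q 0)) - deriv S.V₁ (x (q i))|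
      ≤ (|K| * ((1 + x (q 0) ^ 2) ^ (n - 1) + (1 + x (q i) ^ 2) ^ (n - 1)))
        * |x (q i) - x (q 0)| := by
    rw [abs_sub_comm]
    refine (convex_uIcc (x (q 0)) (x (q i))).norm_image_sub_le_of_norm_deriv_le (f := deriv S.V₁)
      (fun z _ => contDiff_deriv_V₁.differentiable (by simp) z) (fun z hz => ?_)
      Set.left_mem_uIcc Set.right_mem_uIcc
    refine ((Real.norm_eq_abs _).trans_le (hK z)).trans ?_
    refine (mul_le_mul_of_nonneg_right (le_abs_self K) (by positivity)).trans
      (mul_le_mul_of_nonneg_left ?_ (abs_nonneg K))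
    have hz2 : z ^ 2 ≤ max (x (q 0) ^ 2) (x (q i) ^ 2) := by
      have h3 : |z| ≤ max |x (q 0)| |x (q i)| := by
        rw [Set.mem_uIcc] at hz
        rcases hz with ⟨u, v⟩ | ⟨u, v⟩
        · exact abs_le_max_abs_abs u v
        · rw [max_comm]; exact abs_le_max_abs_abs u v
      rcases le_max_iff.1 h3 with h | h
      · exact le_max_of_le_left (sq_le_sq.2 h)
      · exact le_max_of_le_right (sq_le_sq.2 h)
    have p1 : 0 ≤ (1 + x (q 0) ^ 2) ^ (n - 1) := by positivity
    have p2 : 0 ≤ (1 + x (q i) ^ 2) ^ (n - 1) := by positivity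
    rcases le_max_iff.1 hz2 with h | h
    · have := Real.rpow_le_rpow (by positivity) (show 1 + z ^ 2 ≤ 1 + x (q 0) ^ 2 by linarith)
        (z := n - 1) (by linarith)
      linarith
    · have := Real.rpow_le_rpow (by positivity) (show 1 + z ^ 2 ≤ 1 + x (q i) ^ 2 by linarith)
        (z := n - 1) (by linarith)
      linarith
  have pw (i : Fin (N + 1)) : S.PowBound Γ (fun x => (1 + x (q i) ^ 2) ^ (n - 1)) (1 - 1 / n) := by
    have := PowBound.of_rpow_le (f := fun x => (1 + x (q i) ^ 2) ^ (n - 1)) hG (by linarith) hC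
      (fun x => hE.q_le x i) (s := n - 1) (by linarith) zero_le_one
      fun x => by rw [one_mul, abs_of_nonneg (by positivity)]
    convert this using 1
    field_simp
  have := (((pw 0).add (pw i)).const_mul |K|).mul hG
    (hE.powBound_q_sub hC (by linarith : (1 : ℝ) < m) i)
  obtain ⟨A, hA0, hA⟩ := this.exists_le hG
  refine .of_le hG (C := A) fun x => (bd x).trans (le_trans (le_of_eq ?_) (hA x))
  rw [abs_mul, abs_of_nonneg (a := |K| * _) (by positivity)]

/-- The total momentum is driven by the pinning forces alone, which makes the positions
subcritical. -/
theorem EnergyBounds.subcritical_q (hE : EnergyBounds S Γ n m C) (hC : 0 ≤ C) (hn : 1 < n)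
    (hm : n < m) (h1 : PotentialGrowth S.V₁ n) (h2 : PotentialGrowth S.V₂ m) (i : Fin (N + 1)) :
    S.Subcritical Γ (fun x => x (q i)) (1 / (2 * n)) := by
  have hG := hE.one_le
  have hhalf := half_lt_one_sub hn
  have cq (i : Fin (N + 1)) : ContDiff ℝ ∞ fun x : ChainSpace N => x (q i) := contDiff_coord _
  have cV (i : Fin (N + 1)) : ContDiff ℝ ∞ fun x : ChainSpace N => deriv S.V₁ (x (q i)) :=
    contDiff_deriv_V₁.comp (cq i)
  have cP : ContDiff ℝ ∞ fun x : ChainSpace N => ∑ i : Fin (N + 1), x (p i) := by fun_prop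
  have hmn : 1 / (2 * m) < 1 / (2 * n) := one_div_lt_one_div_of_lt (by linarith) (by linarith)
  have hnn : 1 / n = 1 / (2 * n) + 1 / (2 * n) := by field_simp; norm_num
  -- the bond forces cancel in the derivative of the total momentum, and the pinning forces are
  -- replaced by `N + 1` copies of the one on the first particle
  have key : S.Subcritical Γ (fun x => (-(N + 1 : ℝ)) * deriv S.V₁ (x (q 0)))
      (1 - 1 / (2 * n)) := by
    refine Subcritical.propagate hG hE.gap_le (U := fun x => ∑ i : Fin (N + 1), x (p i))
      (E := fun x => ∑ i : Fin (N + 1), (deriv S.V₁ (x (q 0)) - deriv S.V₁ (x (q i)))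
        + ∑ b : Fin 2, x (r b))
      (α := 1 / 2) cP (contDiff_const.mul (cV 0))
      (Subcritical.sum hG _ fun i _ => (hE.subcritical_p_bond hC hn hm h1 h2 i).1) ?_
      hhalf.le hhalf.le (fun x => ?_)
      ((PowBound.deriv_comp hG hn hC (fun x => hE.q_le x 0) h1).const_mul _) ?_ (fun b x => ?_)
      (fun b x => pd_eq_zero_of_invariant (contDiff_const.mul (cV 0)) (by simp) x)
    · refine (Subcritical.sum hG _ fun i _ => ?_).add hG (Subcritical.sum hG _ fun b _ => ?_)
      · exact .of_powBound hG ((cV 0).sub (cV i)).continuous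
          (hE.powBound_deriv_V₁_sub hC hn hm h1 i) (by linarith)
      · exact .of_powBound hG (contDiff_coord _).continuous (hE.powBound_r hC hn b) hhalf
    · have e : fderiv ℝ (fun x : ChainSpace N => ∑ i : Fin (N + 1), x (p i)) x = _ :=
        (HasFDerivAt.fun_sum fun i (_ : i ∈ Finset.univ) =>
          (EuclideanSpace.proj (𝕜 := ℝ) (p (N := N) i)).hasFDerivAt).fderiv
      rw [along, e]
      have e1 : ∑ i : Fin (N + 1), ∑ b : Fin 2, (if i = bathSite N b then x (r b) else 0)
          = ∑ b : Fin 2, x (r b) := by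
        rw [Finset.sum_comm]
        simp
      have e2 : ∑ i : Fin (N + 1), ∑ j : Fin N, deriv S.V₂ (bond j x) *
          ((if i = j.succ then 1 else 0) - (if i = j.castSucc then 1 else 0)) = 0 := by
        rw [Finset.sum_comm]
        refine Finset.sum_eq_zero fun j _ => ?_
        simp [mul_sub, Finset.sum_sub_distrib]
      simp only [sum_apply, PiLp.proj_apply, drift_p,
        Finset.sum_sub_distrib, e1]
      simp only [mul_sub, Finset.sum_sub_distrib] at e2 ⊢
      simp at e2 ⊢
      linarith
    · have := ((PowBound.deriv_deriv_comp hG hn hC (fun x => hE.q_le x 0) h1).mul hG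
        (hE.powBound_p 0)).const_mul (-(N + 1 : ℝ))
      convert this using 1
      · funext x
        rw [along_const_mul (cV 0), along_comp (cq 0) (h' := deriv (deriv S.V₁))
          ((contDiff_deriv_V₁.differentiable (by simp) _).hasDerivAt), along_coord, drift_q]
      · rw [hnn]
        ring
    · rw [pd_eq_zero_of_invariant cP (by simp)]; simp
  have force : S.Subcritical Γ (fun x => deriv S.V₁ (x (q 0))) (1 - 1 / (2 * n)) := by
    refine (key.const_mul hG (-(N + 1 : ℝ)⁻¹)).mono hG (cV 0).continuous (C := 1) fun x => ?_
    rw [one_mul]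
    refine le_of_eq ?_
    congr 1
    field_simp
  have q0 := Subcritical.of_deriv_comp hG hn (cq 0).continuous h1 force
  have diff : S.Subcritical Γ (fun x => x (q i) - x (q 0)) (1 / (2 * n)) :=
    .of_powBound hG ((cq i).sub (cq 0)).continuous
      (hE.powBound_q_sub hC (by linarith : (1 : ℝ) < m) i) hmn
  simpa using diff.add hG q0

/-- All parts of the energy are subcritical, hence a positive power of the energy is controlled. -/
theorem EnergyBounds.exists_controlled_rpow (hE : EnergyBounds S Γ n m C) (hC : 0 ≤ C)
    (hn : 1 < n) (hm : n < m) (h1 : PotentialGrowth S.V₁ n) (h2 : PotentialGrowth S.V₂ m) :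
    ∃ δ : ℝ, 0 < δ ∧ S.Controlled fun x => S.energy Γ x ^ δ := by
  have hG := hE.one_le
  have hm1 : 1 < m := by linarith
  have hm2 : 1 / (2 * m) ≤ 1 / 2 := by apply one_div_le_one_div_of_le <;> linarith
  have rp {z : ChainSpace N → ℝ} (hz : Continuous z) {a : ℝ} (ha : 1 < a)
      (hza : ∀ x, (1 + z x ^ 2) ^ a ≤ C * S.energy Γ x)
      (h : S.Subcritical Γ z (1 / (2 * a))) :
      S.Subcritical Γ (fun x => (1 + z x ^ 2) ^ (a / 2)) (1 / 2) := by
    have := h.rpow hG (V := fun x => (1 + z x ^ 2) ^ (a / 2)) (by linarith) hC hza (s := a / 2)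
      (by linarith)
      ((continuous_const.add (hz.pow 2)).rpow_const fun x =>
        Or.inl (show 1 + z x ^ 2 ≠ 0 by positivity)) zero_le_one
      fun x => by rw [one_mul, abs_of_nonneg (by positivity)]
    convert this using 1
    field_simp
  have hone : S.Subcritical Γ (fun _ => 1) (1 / 2) :=
    .of_powBound hG continuous_const (.of_le hG (C := 1) (a := 0) (by simp)) (by norm_num)
  have habs {z : ChainSpace N → ℝ} (h : S.Subcritical Γ z (1 / 2)) :
      S.Subcritical Γ (fun x => |z x|) (1 / 2) :=
    h.mono hG h.1.abs (C := 1) fun x => by simp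
  have total := (((hone.add hG
    (Subcritical.sum hG Finset.univ fun i _ => habs (hE.subcritical_p_bond hC hn hm h1 h2 i).1)).add
      hG (Subcritical.sum hG Finset.univ fun i _ => rp (contDiff_coord _).continuous hn
        (fun x => hE.q_le x i) (hE.subcritical_q hC hn hm h1 h2 i))).add
    hG (Subcritical.sum hG Finset.univ fun j _ => rp (contDiff_bond j).continuous hm1
        (fun x => hE.bond_le x j)
        ((hE.subcritical_p_bond hC hn hm h1 h2 (Fin.last N)).2 j (Fin.le_last _)))).add
    hG (Subcritical.sum hG Finset.univ fun b _ =>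
      habs ((subcritical_gap (show 0 < m by linarith) b).mono_exponent hG hm2))
  obtain ⟨hc, δ, hδ, ctrl⟩ := total
  refine ⟨δ, hδ, ctrl.mono (continuous_energy_rpow hG _) hC fun x => ?_⟩
  have hpos : 0 < S.energy Γ x := by linarith [hG x]
  have sq_rpow (z a : ℝ) : (1 + z ^ 2) ^ a = ((1 + z ^ 2) ^ (a / 2)) ^ 2 := by
    rw [← Real.rpow_natCast ((1 + z ^ 2) ^ (a / 2)), ← Real.rpow_mul (by positivity)]
    push_cast
    ring_nf
  have s1 : ∑ i : Fin (N + 1), x (p i) ^ 2 ≤ (∑ i : Fin (N + 1), |x (p i)|) ^ 2 := by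
    simpa using Finset.sum_sq_le_sq_sum_of_nonneg (s := Finset.univ) (f := fun i => |x (p i)|)
      fun i _ => abs_nonneg _
  have s2 : ∑ i : Fin (N + 1), (1 + x (q i) ^ 2) ^ n
      ≤ (∑ i : Fin (N + 1), (1 + x (q i) ^ 2) ^ (n / 2)) ^ 2 := by
    simp only [sq_rpow _ n]
    exact Finset.sum_sq_le_sq_sum_of_nonneg fun i _ => by positivity
  have s3 : ∑ j : Fin N, (1 + bond j x ^ 2) ^ m
      ≤ (∑ j : Fin N, (1 + bond j x ^ 2) ^ (m / 2)) ^ 2 := by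
    simp only [sq_rpow _ m]
    exact Finset.sum_sq_le_sq_sum_of_nonneg fun i _ => by positivity
  have s4 : ∑ b : Fin 2, S.bathGap b x ^ 2 ≤ (∑ b : Fin 2, |S.bathGap b x|) ^ 2 := by
    simpa using Finset.sum_sq_le_sq_sum_of_nonneg (s := Finset.univ) (f := fun b => |S.bathGap b x|)
      fun i _ => abs_nonneg _
  have n1 : 0 ≤ ∑ i : Fin (N + 1), |x (p i)| := Finset.sum_nonneg fun i _ => abs_nonneg _
  have n2 : 0 ≤ ∑ i : Fin (N + 1), (1 + x (q i) ^ 2) ^ (n / 2) :=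
    Finset.sum_nonneg fun i _ => by positivity
  have n3 : 0 ≤ ∑ j : Fin N, (1 + bond j x ^ 2) ^ (m / 2) :=
    Finset.sum_nonneg fun i _ => by positivity
  have n4 : 0 ≤ ∑ b : Fin 2, |S.bathGap b x| := Finset.sum_nonneg fun i _ => abs_nonneg _
  have five {a b c d : ℝ} (ha : 0 ≤ a) (hb : 0 ≤ b) (hc : 0 ≤ c) (hd : 0 ≤ d) :
      1 + a ^ 2 + b ^ 2 + c ^ 2 + d ^ 2 ≤ (1 + a + b + c + d) ^ 2 := by
    have : (1 + a + b + c + d) ^ 2 = 1 + a ^ 2 + b ^ 2 + c ^ 2 + d ^ 2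
      + 2 * (a + b + c + d + a * b + a * c + a * d + b * c + b * d + c * d) := by ring
    have : 0 ≤ a + b + c + d + a * b + a * c + a * d + b * c + b * d + c * d := by positivity
    linarith
  have hle := (hE.le x).trans (mul_le_mul_of_nonneg_left
    ((show _ ≤ _ by linarith).trans (five n1 n2 n3 n4)) hC)
  have e : S.energy Γ x ^ δ = S.energy Γ x * S.energy Γ x ^ (δ - 2 * (1 / 2)) := by
    rw [← Real.rpow_one_add' hpos.le (by ring_nf; exact hδ.ne')]
    ring_nf
  rw [e, ← mul_assoc]
  exact mul_le_mul_of_nonneg_right hle (Real.rpow_nonneg hpos.le _)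

end OscillatorChain

end

/-! ### Energy cutoffs -/

noncomputable section

open Asymptotics

/-- The profile of the cutoffs: a smooth function equal to `1` on `(-∞, 1]` and to `0` on
`[2, ∞)`. -/
def cutProfile (t : ℝ) : ℝ := Real.smoothTransition (2 - t)

theorem contDiff_cutProfile : ContDiff ℝ ∞ cutProfile :=
  Real.smoothTransition.contDiff.comp (contDiff_const.sub contDiff_id)

theorem deriv_cutProfile_eq_zero {t : ℝ} (ht : t ∉ Set.Icc (1 : ℝ) 2) : deriv cutProfile t = 0 := by
  rw [Set.mem_Icc, not_and_or, not_le, not_le] at ht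
  rcases ht with h | h
  · have : cutProfile =ᶠ[nhds t] fun _ => 1 := by
      filter_upwards [Iio_mem_nhds h] with s hs
      exact Real.smoothTransition.one_of_one_le (by linarith [Set.mem_Iio.1 hs])
    rw [this.deriv_eq]; simp
  · have : cutProfile =ᶠ[nhds t] fun _ => 0 := by
      filter_upwards [Ioi_mem_nhds h] with s hs
      exact Real.smoothTransition.zero_of_nonpos (by linarith [Set.mem_Ioi.1 hs])
    rw [this.deriv_eq]; simp

theorem hasCompactSupport_deriv_cutProfile : HasCompactSupport (deriv cutProfile) :=
  HasCompactSupport.intro isCompact_Icc fun _ ht => deriv_cutProfile_eq_zero ht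

theorem deriv_deriv_cutProfile_eq_zero {t : ℝ} (ht : t ∉ Set.Icc (1 : ℝ) 2) :
    deriv (deriv cutProfile) t = 0 := by
  have : deriv cutProfile =ᶠ[nhds t] fun _ => 0 := by
    filter_upwards [isClosed_Icc.isOpen_compl.mem_nhds ht] with s hs
    exact deriv_cutProfile_eq_zero hs
  rw [this.deriv_eq]; simp

theorem contDiff_deriv_cutProfile : ContDiff ℝ ∞ (deriv cutProfile) :=
  (contDiff_infty_iff_deriv.1 contDiff_cutProfile).2

theorem exists_abs_deriv_cutProfile_le : ∃ M, 0 ≤ M ∧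
    (∀ t, |deriv cutProfile t| ≤ M) ∧ ∀ t, |deriv (deriv cutProfile) t| ≤ M := by
  obtain ⟨M₁, h1⟩ := contDiff_deriv_cutProfile.continuous.bounded_above_of_compact_support
    hasCompactSupport_deriv_cutProfile
  obtain ⟨M₂, h2⟩ := ((contDiff_infty_iff_deriv.1
    contDiff_deriv_cutProfile).2).continuous.bounded_above_of_compact_support
    hasCompactSupport_deriv_cutProfile.deriv
  exact ⟨max M₁ M₂, (norm_nonneg _).trans ((h1 0).trans (le_max_left _ _)),
    fun t => (h1 t).trans (le_max_left _ _), fun t => (h2 t).trans (le_max_right _ _)⟩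

namespace OscillatorChain

open ChainCoord

variable {N : ℕ} {S : OscillatorChain N} {Γ n m C : ℝ}

theorem EnergyBounds.isCompact_le (hE : EnergyBounds S Γ n m C) (hC : 0 ≤ C) (hn : 1 < n) (R : ℝ) :
    IsCompact {x | S.energy Γ x ≤ R} := by
  have hclosed : IsClosed {x | S.energy Γ x ≤ R} :=
    isClosed_le (contDiff_energy Γ).continuous continuous_const
  have bound (x : ChainSpace N) (hx : S.energy Γ x ≤ R) (k : ChainCoord N) :
      |x k| ≤ (C * R + 1) + (∑ b, S.lam b ^ 2) * (C * R) := by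
    have hCR : C * S.energy Γ x ≤ C * R := mul_le_mul_of_nonneg_left hx hC
    have hCR0 : 0 ≤ C * R := le_trans (by have := hE.one_le x; positivity) hCR
    have hs : 0 ≤ (∑ b, S.lam b ^ 2) * (C * R) :=
      mul_nonneg (Finset.sum_nonneg fun b _ => sq_nonneg _) hCR0
    have sqb {z : ℝ} (hz : z ^ 2 ≤ C * R) : |z| ≤ C * R + 1 := by
      rw [abs_le]
      constructor <;> nlinarith [sq_nonneg (z - 1), sq_nonneg (z + 1)]
    have hq (i : Fin (N + 1)) : |x (q i)| ≤ C * R := by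
      have h1 := (hE.q_le x i).trans hCR
      have h2 := Real.rpow_le_rpow_of_exponent_le (one_le_one_add_sq (x (q i))) hn.le
      rw [Real.rpow_one] at h2
      have h3 : |x (q i)| ≤ 1 + x (q i) ^ 2 := by
        rw [abs_le]
        constructor <;> nlinarith [sq_nonneg (x (q i) - 1), sq_nonneg (x (q i) + 1)]
      linarith
    rcases k with i | i | b
    · have := sqb ((hE.p_le x i).trans hCR)
      linarith
    · have := hq i
      linarith
    · have h1 := sqb ((hE.gap_le x b).trans hCR)
      have h2 : x (r b) = S.bathGap b x + S.lam b ^ 2 * x (q (bathSite N b)) := by simp [bathGap]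
      have h3 : S.lam b ^ 2 ≤ ∑ b, S.lam b ^ 2 :=
        Finset.single_le_sum (f := fun b => S.lam b ^ 2) (fun b _ => sq_nonneg _) (Finset.mem_univ b)
      change |x (r b)| ≤ _
      rw [h2]
      refine (abs_add_le _ _).trans (add_le_add h1 ?_)
      rw [abs_mul, abs_of_nonneg (sq_nonneg _)]
      exact mul_le_mul h3 (hq _) (abs_nonneg _) (Finset.sum_nonneg fun b _ => sq_nonneg _)
  set B := (C * R + 1) + (∑ b, S.lam b ^ 2) * (C * R)
  have hcomp : IsCompact ((EuclideanSpace.equiv (ChainCoord N) ℝ).toHomeomorph ⁻¹'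
      Set.univ.pi fun _ => Set.Icc (-B) B) :=
    (Homeomorph.isCompact_preimage _).2 (isCompact_univ_pi fun _ => isCompact_Icc)
  refine hcomp.of_isClosed_subset hclosed fun x hx => ?_
  rw [Set.mem_preimage, Set.mem_univ_pi]
  exact fun k => abs_le.1 (bound x hx k)

/-- The cutoff `χ(G / R)`. -/
def energyCut (S : OscillatorChain N) (Γ R : ℝ) (x : ChainSpace N) : ℝ :=
  cutProfile (S.energy Γ x / R)

theorem contDiff_energyCut (R : ℝ) : ContDiff ℝ ∞ (S.energyCut Γ R) :=
  contDiff_cutProfile.comp ((contDiff_energy Γ).div_const R)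

theorem energyCut_nonneg (R : ℝ) (x : ChainSpace N) : 0 ≤ S.energyCut Γ R x :=
  Real.smoothTransition.nonneg _

theorem energyCut_le_one (R : ℝ) (x : ChainSpace N) : S.energyCut Γ R x ≤ 1 :=
  Real.smoothTransition.le_one _

theorem energyCut_eq_one {R : ℝ} (hR : 0 < R) {x : ChainSpace N} (hx : S.energy Γ x ≤ R) :
    S.energyCut Γ R x = 1 :=
  Real.smoothTransition.one_of_one_le (by
    have := (div_le_one hR).2 hx
    linarith)

theorem energyCut_eq_zero {R : ℝ} (hR : 0 < R) {x : ChainSpace N} (hx : 2 * R ≤ S.energy Γ x) :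
    S.energyCut Γ R x = 0 :=
  Real.smoothTransition.zero_of_nonpos (by
    have := (le_div_iff₀ hR).2 hx
    linarith)

theorem EnergyBounds.hasCompactSupport_energyCut (hE : EnergyBounds S Γ n m C) (hC : 0 ≤ C)
    (hn : 1 < n) {R : ℝ} (hR : 0 < R) : HasCompactSupport (S.energyCut Γ R) :=
  HasCompactSupport.intro (hE.isCompact_le hC hn (2 * R)) fun _ hx =>
    energyCut_eq_zero hR (not_le.1 hx).le

theorem fderiv_energyCut (R : ℝ) (x v : ChainSpace N) :
    fderiv ℝ (S.energyCut Γ R) x v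
      = deriv cutProfile (S.energy Γ x / R) * (fderiv ℝ (S.energy Γ) x v / R) := by
  have h1 := (contDiff_cutProfile.differentiable (by simp) (S.energy Γ x * R⁻¹)).hasDerivAt
  have h2 := ((contDiff_energy (S := S) Γ).differentiable (by simp) x).hasFDerivAt.mul_const R⁻¹
  have e := (h1.comp_hasFDerivAt x h2).fderiv
  have e' : fderiv ℝ (S.energyCut Γ R) x = _ := e
  rw [e']
  simp only [smul_apply, smul_eq_mul, div_eq_mul_inv]
  ring

theorem pd_energyCut (R : ℝ) (b : Fin 2) (x : ChainSpace N) :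
    pd (r b) (S.energyCut Γ R) x
      = deriv cutProfile (S.energy Γ x / R) * (S.bathGap b x * (S.lam b ^ 2 * R)⁻¹) := by
  rw [pd, fderiv_energyCut]
  have := pd_r_energy (S := S) Γ x b
  rw [pd] at this
  rw [this]
  simp only [div_eq_mul_inv, mul_inv]
  ring

theorem pd_gap (b : Fin 2) (x : ChainSpace N) : pd (r b) (S.bathGap b) x = 1 := by
  have h (k : ChainCoord N) : HasFDerivAt (fun y : ChainSpace N => y k)
    (EuclideanSpace.proj (𝕜 := ℝ) k) x := (EuclideanSpace.proj (𝕜 := ℝ) k).hasFDerivAt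
  have e : fderiv ℝ (S.bathGap b) x = _ :=
    ((h (r b)).sub ((h (q (bathSite N b))).const_mul (S.lam b ^ 2))).fderiv
  rw [pd, e]
  simp

theorem pd_pd_energyCut (R : ℝ) (b : Fin 2) (x : ChainSpace N) :
    pd (r b) (pd (r b) (S.energyCut Γ R)) x
      = deriv (deriv cutProfile) (S.energy Γ x / R)
          * (S.bathGap b x ^ 2 * (S.lam b ^ 2 * R)⁻¹ ^ 2)
        + deriv cutProfile (S.energy Γ x / R) * (S.lam b ^ 2 * R)⁻¹ := by
  have e : pd (r b) (S.energyCut Γ R) = fun x =>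
      deriv cutProfile (S.energy Γ x / R) * (S.bathGap b x * (S.lam b ^ 2 * R)⁻¹) :=
    funext fun x => pd_energyCut R b x
  have c1 : ContDiff ℝ ∞ fun x => S.energy Γ x / R := (contDiff_energy Γ).div_const R
  have c2 : ContDiff ℝ ∞ fun x => deriv cutProfile (S.energy Γ x / R) :=
    contDiff_deriv_cutProfile.comp c1
  have h1 : pd (r b) (fun x => deriv cutProfile (S.energy Γ x / R)) x
      = deriv (deriv cutProfile) (S.energy Γ x / R) * (S.bathGap b x * (S.lam b ^ 2 * R)⁻¹) := by
    rw [pd_comp c1 (h' := deriv (deriv cutProfile))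
      (contDiff_deriv_cutProfile.differentiable (by simp) _).hasDerivAt]
    congr 1
    have h2 := ((contDiff_energy (S := S) Γ).differentiable (by simp) x).hasFDerivAt.mul_const R⁻¹
    have h3 := pd_r_energy (S := S) Γ x b
    rw [pd] at h3 ⊢
    simp only [div_eq_mul_inv]
    rw [h2.fderiv]
    simp only [smul_apply, smul_eq_mul, h3, div_eq_mul_inv, mul_inv]
    ring
  rw [e, pd_mul c2 ((contDiff_bathGap b).mul contDiff_const), h1,
    pd_mul (contDiff_bathGap b) contDiff_const, pd_gap]
  simp [pd]
  ring

/-- Second-order Leibniz rule for `K`: the commutator with a multiplication operator. -/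
theorem realK_mul (σ : ℝ) {f χ : ChainSpace N → ℝ} (hf : ContDiff ℝ ∞ f) (hχ : ContDiff ℝ ∞ χ)
    (x : ChainSpace N) :
    S.realK σ (fun y => χ y * f y) x = χ x * S.realK σ f x
      - ∑ b : Fin 2, S.cSq b * (2 * pd (r b) χ x * pd (r b) f x + pd (r b) (pd (r b) χ) x * f x)
      - σ * S.along χ x * f x := by
  have h2 (b : Fin 2) : pd (r b) (pd (r b) fun y => χ y * f y) x
      = χ x * pd (r b) (pd (r b) f) x + 2 * pd (r b) χ x * pd (r b) f x
        + pd (r b) (pd (r b) χ) x * f x := by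
    have e : (pd (r b) fun y => χ y * f y) = fun y => pd (r b) χ y * f y + χ y * pd (r b) f y :=
      funext fun y => pd_mul hχ hf y
    have c1 : ContDiff ℝ ∞ fun y => pd (r b) χ y * f y := (contDiff_pd hχ).mul hf
    have c2 : ContDiff ℝ ∞ fun y => χ y * pd (r b) f y := hχ.mul (contDiff_pd hf)
    have e2 : pd (r b) (fun y => pd (r b) χ y * f y + χ y * pd (r b) f y) x
        = pd (r b) (fun y => pd (r b) χ y * f y) x + pd (r b) (fun y => χ y * pd (r b) f y) x := by
      rw [pd, fderiv_fun_add (c1.differentiable (by simp) x) (c2.differentiable (by simp) x)]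
      rfl
    rw [e, e2, pd_mul (contDiff_pd hχ) hf, pd_mul hχ (contDiff_pd hf)]
    ring
  simp only [realK, h2, along_mul hχ hf, Fin.sum_univ_two]
  ring

/-- The derivatives of the energy cutoffs that occur in their commutator with `K` are bounded
uniformly in the cutoff parameter. -/
theorem EnergyBounds.exists_energyCut_bound (hE : EnergyBounds S Γ n m C) (hC : 0 ≤ C) :
    ∃ M, 0 ≤ M ∧ ∀ R, 1 ≤ R → ∀ x, (∀ b, |pd (r b) (S.energyCut Γ R) x| ≤ M) ∧
      (∀ b, |pd (r b) (pd (r b) (S.energyCut Γ R)) x| ≤ M) ∧ |S.along (S.energyCut Γ R) x| ≤ M := by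
  obtain ⟨M, hM0, h1, h2⟩ := exists_abs_deriv_cutProfile_le
  obtain ⟨L, hL0, -, hL⟩ := exists_abs_div_energy_le hE.one_le hE.gap_le
  set A : ℝ := ∑ b : Fin 2, (1 / S.lam b ^ 2 + (1 / S.lam b ^ 2) ^ 2) with hA
  have hA0 : 0 ≤ A := Finset.sum_nonneg fun b _ => by positivity
  have hAb (b : Fin 2) : 1 / S.lam b ^ 2 ≤ A ∧ (1 / S.lam b ^ 2) ^ 2 ≤ A := by
    have := Finset.single_le_sum (f := fun b => 1 / S.lam b ^ 2 + (1 / S.lam b ^ 2) ^ 2)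
      (fun b _ => by positivity) (Finset.mem_univ b)
    have e1 : 0 ≤ 1 / S.lam b ^ 2 := by positivity
    have e2 : 0 ≤ (1 / S.lam b ^ 2) ^ 2 := by positivity
    constructor <;> linarith
  refine ⟨M * ((2 * C + 1) * A) + M * (2 * C * A) + M * A + M * (2 * L), by positivity,
    fun R hR x => ?_⟩
  have hR0 : 0 < R := by linarith
  have hpos : 0 < S.energy Γ x := by linarith [hE.one_le x]
  have k1 : 0 ≤ M * ((2 * C + 1) * A) := by positivity
  have k2 : 0 ≤ M * (2 * C * A) := by positivity
  have k3 : 0 ≤ M * A := by positivity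
  have k4 : 0 ≤ M * (2 * L) := by positivity
  by_cases hx : S.energy Γ x / R ∈ Set.Icc (1 : ℝ) 2
  · have hx2 : S.energy Γ x ≤ 2 * R := by
      have := hx.2
      rwa [div_le_iff₀ hR0] at this
    have g1 (b : Fin 2) : S.bathGap b x ^ 2 ≤ 2 * C * R := by
      have := (hE.gap_le x b).trans (mul_le_mul_of_nonneg_left hx2 hC)
      linarith
    have inv (b : Fin 2) : (S.lam b ^ 2 * R)⁻¹ = 1 / S.lam b ^ 2 * R⁻¹ := by
      rw [mul_inv, one_div]
    have hRi : 0 < R⁻¹ := inv_pos.2 hR0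
    have hRi1 : R⁻¹ ≤ 1 := inv_le_one_of_one_le₀ hR
    refine ⟨fun b => ?_, fun b => ?_, ?_⟩
    · rw [pd_energyCut, abs_mul]
      have : |S.bathGap b x * (S.lam b ^ 2 * R)⁻¹| ≤ (2 * C + 1) * A := by
        rw [inv, abs_mul, abs_of_nonneg (a := 1 / S.lam b ^ 2 * R⁻¹) (by positivity)]
        have e1 : |S.bathGap b x| ≤ (2 * C + 1) * R := by
          rw [abs_le]
          have := g1 b
          constructor <;>
            nlinarith [sq_nonneg (S.bathGap b x - 1), sq_nonneg (S.bathGap b x + 1)]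
        calc |S.bathGap b x| * (1 / S.lam b ^ 2 * R⁻¹)
            ≤ (2 * C + 1) * R * (A * R⁻¹) := by
              gcongr
              exact (hAb b).1
          _ = (2 * C + 1) * A := by field_simp
      have := mul_le_mul (h1 (S.energy Γ x / R)) this (abs_nonneg _) hM0
      linarith
    · rw [pd_pd_energyCut]
      refine (abs_add_le _ _).trans ?_
      rw [abs_mul, abs_mul (deriv cutProfile _)]
      have e1 : |S.bathGap b x ^ 2 * (S.lam b ^ 2 * R)⁻¹ ^ 2| ≤ 2 * C * A := by
        rw [inv, abs_of_nonneg (by positivity), mul_pow]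
        calc S.bathGap b x ^ 2 * ((1 / S.lam b ^ 2) ^ 2 * R⁻¹ ^ 2)
            ≤ 2 * C * R * (A * (R⁻¹ * 1)) := by
              rw [sq R⁻¹]
              gcongr
              · exact g1 b
              · exact (hAb b).2
          _ = 2 * C * A := by field_simp
      have e2 : |(S.lam b ^ 2 * R)⁻¹| ≤ A := by
        rw [inv, abs_of_nonneg (by positivity)]
        calc 1 / S.lam b ^ 2 * R⁻¹ ≤ A * 1 := by
              gcongr
              exact (hAb b).1
          _ = A := mul_one _
      have u1 := mul_le_mul (h2 (S.energy Γ x / R)) e1 (abs_nonneg _) hM0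
      have u2 := mul_le_mul (h1 (S.energy Γ x / R)) e2 (abs_nonneg _) hM0
      linarith
    · rw [along, fderiv_energyCut, abs_mul]
      have e1 : |fderiv ℝ (S.energy Γ) x (S.drift x) / R| ≤ 2 * L := by
        have := hL x
        rw [along, abs_div, abs_of_pos hpos, div_le_iff₀ hpos] at this
        rw [abs_div, abs_of_pos hR0, div_le_iff₀ hR0]
        nlinarith
      have := mul_le_mul (h1 (S.energy Γ x / R)) e1 (abs_nonneg _) hM0
      linarith
  · have z1 := deriv_cutProfile_eq_zero hx
    have z2 := deriv_deriv_cutProfile_eq_zero hx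
    refine ⟨fun b => ?_, fun b => ?_, ?_⟩
    · rw [pd_energyCut, z1]; simp; linarith
    · rw [pd_pd_energyCut, z1, z2]; simp; linarith
    · rw [along, fderiv_energyCut, z1]; simp; linarith

theorem energyCut_derivs_eq_zero {R : ℝ} (hR : 0 < R) {x : ChainSpace N}
    (hx : 2 * R < S.energy Γ x) : (∀ b, pd (r b) (S.energyCut Γ R) x = 0) ∧
      (∀ b, pd (r b) (pd (r b) (S.energyCut Γ R)) x = 0) ∧ S.along (S.energyCut Γ R) x = 0 := by
  have hx' : S.energy Γ x / R ∉ Set.Icc (1 : ℝ) 2 := fun h => by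
    have := h.2
    rw [div_le_iff₀ hR] at this
    linarith
  have z1 := deriv_cutProfile_eq_zero hx'
  have z2 := deriv_deriv_cutProfile_eq_zero hx'
  refine ⟨fun b => ?_, fun b => ?_, ?_⟩
  · rw [pd_energyCut, z1]; simp
  · rw [pd_pd_energyCut, z1, z2]; simp
  · rw [along, fderiv_energyCut, z1]; simp

/-- A local form of the dissipation estimate (Caccioppoli inequality), uniform in the cutoff. -/
theorem EnergyBounds.exists_caccioppoli (hE : EnergyBounds S Γ n m C) (hC : 0 ≤ C) (hn : 1 < n) :
    ∃ A, 0 ≤ A ∧ ∀ R, 1 ≤ R → ∀ σ : ℝ, |σ| = 1 → ∀ f : ChainSpace N → ℝ, ContDiff ℝ ∞ f →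
      ∀ b, ∫ x, S.energyCut Γ R x ^ 2 * pd (r b) f x ^ 2
        ≤ A * ∫ x in {x | S.energy Γ x ≤ 2 * R}, (S.realK σ f x ^ 2 + f x ^ 2) := by
  obtain ⟨M, hM0, hM⟩ := hE.exists_energyCut_bound hC
  set B : ℝ := 1 + M + ∑ b : Fin 2, 2 * S.cSq b * M ^ 2 with hB
  have hcS (b : Fin 2) := cSq_pos (S := S) b
  have haS (b : Fin 2) := aSq_pos (S := S) b
  have hsum0 : 0 ≤ ∑ b : Fin 2, 2 * S.cSq b * M ^ 2 :=
    Finset.sum_nonneg fun b _ => by have := hcS b; positivity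
  have hB0 : 0 ≤ B := by positivity
  set A : ℝ := ∑ b : Fin 2, 2 / S.cSq b with hA
  have hA0 : 0 ≤ A := Finset.sum_nonneg fun b _ => by have := hcS b; positivity
  refine ⟨A * B, by positivity, fun R hR σ hσ f hf b => ?_⟩
  have hR0 : 0 < R := by linarith
  set η := S.energyCut Γ R with hη
  have cη : ContDiff ℝ ∞ η := contDiff_energyCut R
  have sη : HasCompactSupport η := hE.hasCompactSupport_energyCut hC hn hR0
  have h0 := integral_mul_realK (S := S) σ hf (cη.mul cη) (Or.inr sη.mul_right)
  set K : Set (ChainSpace N) := {x | S.energy Γ x ≤ 2 * R} with hK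
  have Kc : IsCompact K := hE.isCompact_le hC hn _
  have Km : MeasurableSet K := Kc.isClosed.measurableSet
  have hfc := hf.continuous
  have hKc := continuous_realK (S := S) hf σ
  have hηc := cη.continuous
  have hpf (b : Fin 2) : Continuous (pd (r b) f) := (contDiff_pd hf).continuous
  have hpη (b : Fin 2) : Continuous (pd (r b) fun x => η x * η x) :=
    (contDiff_pd (cη.mul cη)).continuous
  have hg (b : Fin 2) : Continuous (S.bathGap b) := (contDiff_bathGap b).continuous
  have hZ : Continuous (S.along fun x => η x * η x) := (contDiff_along (cη.mul cη)).continuous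
  have i1 : Integrable (K.indicator fun x => S.realK σ f x ^ 2 + f x ^ 2) :=
    (ContinuousOn.integrableOn_compact Kc (by fun_prop)).integrable_indicator Km
  have i2 : Integrable fun x => η x ^ 2 * pd (r b) f x ^ 2 :=
    integrable_of_tsupport (by fun_prop) sη fun x hx => by
      simp [image_eq_zero_of_notMem_tsupport hx]
  have i3 : Integrable fun x => η x * η x * f x * S.realK σ f x - ∑ b : Fin 2,
        (S.cSq b * (η x * η x * pd (r b) f x ^ 2 + pd (r b) (fun x => η x * η x) x * f x
          * pd (r b) f x) + S.aSq b * (η x * η x * S.bathGap b x ^ 2 * f x ^ 2))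
        - σ / 2 * S.along (fun x => η x * η x) x * f x ^ 2 :=
    integrable_of_tsupport (by fun_prop) sη fun x hx => by
      simp [image_eq_zero_of_notMem_tsupport hx, pd_mul cη cη, along_mul cη cη]
  have pw (x : ChainSpace N) : η x * η x * f x * S.realK σ f x - ∑ b : Fin 2,
        (S.cSq b * (η x * η x * pd (r b) f x ^ 2 + pd (r b) (fun x => η x * η x) x * f x
          * pd (r b) f x) + S.aSq b * (η x * η x * S.bathGap b x ^ 2 * f x ^ 2))
        - σ / 2 * S.along (fun x => η x * η x) x * f x ^ 2
      ≤ B * K.indicator (fun x => S.realK σ f x ^ 2 + f x ^ 2) x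
        - S.cSq b / 2 * (η x ^ 2 * pd (r b) f x ^ 2) := by
    by_cases hx : x ∈ K
    · rw [Set.indicator_of_mem hx]
      obtain ⟨m1, -, m3⟩ := hM R hR x
      have e0 : 0 ≤ η x := energyCut_nonneg R x
      have e1 : η x ≤ 1 := energyCut_le_one R x
      have e2 : η x ^ 2 ≤ 1 := pow_le_one₀ e0 e1
      have t1 : η x * η x * f x * S.realK σ f x ≤ S.realK σ f x ^ 2 + f x ^ 2 := by
        have : f x * S.realK σ f x ≤ 1 / 2 * (S.realK σ f x ^ 2 + f x ^ 2) := by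
          nlinarith [sq_nonneg (f x - S.realK σ f x)]
        have h3 : η x ^ 2 * (f x * S.realK σ f x)
            ≤ η x ^ 2 * (1 / 2 * (S.realK σ f x ^ 2 + f x ^ 2)) :=
          mul_le_mul_of_nonneg_left this (sq_nonneg _)
        have h4 : η x ^ 2 * (1 / 2 * (S.realK σ f x ^ 2 + f x ^ 2))
            ≤ 1 * (1 / 2 * (S.realK σ f x ^ 2 + f x ^ 2)) :=
          mul_le_mul_of_nonneg_right e2 (by positivity)
        nlinarith [sq_nonneg (f x), sq_nonneg (S.realK σ f x)]
      have t2 : -(σ / 2 * S.along (fun x => η x * η x) x * f x ^ 2) ≤ M * f x ^ 2 := by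
        rw [along_mul cη cη]
        have : |σ / 2 * (S.along η x * η x + η x * S.along η x)| ≤ M := by
          have e : σ / 2 * (S.along η x * η x + η x * S.along η x) = σ * (η x * S.along η x) := by
            ring
          rw [e, abs_mul, hσ, one_mul, abs_mul, abs_of_nonneg e0]
          calc η x * |S.along η x| ≤ 1 * M := by gcongr
            _ = M := one_mul M
        nlinarith [neg_le_of_abs_le this, sq_nonneg (f x)]
      have t3 (b : Fin 2) : S.cSq b / 2 * (η x ^ 2 * pd (r b) f x ^ 2)
          - 2 * S.cSq b * M ^ 2 * f x ^ 2 ≤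
          S.cSq b * (η x * η x * pd (r b) f x ^ 2 + pd (r b) (fun x => η x * η x) x * f x
          * pd (r b) f x) + S.aSq b * (η x * η x * S.bathGap b x ^ 2 * f x ^ 2) := by
        rw [pd_mul cη cη]
        have u1 : 0 ≤ S.aSq b * (η x * η x * S.bathGap b x ^ 2 * f x ^ 2) := by
          have := haS b; positivity
        have u2 : pd (r b) η x ^ 2 ≤ M ^ 2 := sq_le_sq' (by linarith [neg_le_of_abs_le (m1 b)])
          (le_of_abs_le (m1 b))
        have u3 : 0 ≤ S.cSq b / 2 * (η x * pd (r b) f x + 2 * pd (r b) η x * f x) ^ 2 := by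
          have := hcS b; positivity
        have u4 : 0 ≤ 2 * S.cSq b * f x ^ 2 * (M ^ 2 - pd (r b) η x ^ 2) := by
          have := hcS b
          have : 0 ≤ M ^ 2 - pd (r b) η x ^ 2 := by linarith
          positivity
        linarith
      have t4 : ∑ b : Fin 2, (S.cSq b / 2 * (η x ^ 2 * pd (r b) f x ^ 2)
          - 2 * S.cSq b * M ^ 2 * f x ^ 2) ≤ _ := Finset.sum_le_sum fun b _ => t3 b
      have t5 : S.cSq b / 2 * (η x ^ 2 * pd (r b) f x ^ 2) ≤
          ∑ b : Fin 2, S.cSq b / 2 * (η x ^ 2 * pd (r b) f x ^ 2) :=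
        Finset.single_le_sum (f := fun b => S.cSq b / 2 * (η x ^ 2 * pd (r b) f x ^ 2))
          (fun b _ => by have := hcS b; positivity) (Finset.mem_univ b)
      rw [Finset.sum_sub_distrib, ← Finset.sum_mul] at t4
      have t6 : 0 ≤ (M + ∑ b : Fin 2, 2 * S.cSq b * M ^ 2) * S.realK σ f x ^ 2 := by positivity
      rw [hB]
      linarith
    · rw [Set.indicator_of_notMem hx]
      have z := energyCut_eq_zero (S := S) (Γ := Γ) hR0 (not_le.1 hx).le
      rw [← hη] at z
      simp [pd_mul cη cη, along_mul cη cη, z]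
  have h1 : 0 ≤ ∫ x, (B * K.indicator (fun x => S.realK σ f x ^ 2 + f x ^ 2) x
        - S.cSq b / 2 * (η x ^ 2 * pd (r b) f x ^ 2)) := by
    rw [← h0]
    exact integral_mono i3 ((i1.const_mul B).sub (i2.const_mul _)) pw
  rw [integral_sub (i1.const_mul B) (i2.const_mul _), integral_const_mul, integral_const_mul,
    integral_indicator Km] at h1
  have hI : 0 ≤ ∫ x in K, (S.realK σ f x ^ 2 + f x ^ 2) := integral_nonneg fun x => by positivity
  have hAb : 2 / S.cSq b ≤ A := Finset.single_le_sum (f := fun b => 2 / S.cSq b)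
    (fun b _ => by have := hcS b; positivity) (Finset.mem_univ b)
  have h2 : ∫ x, η x ^ 2 * pd (r b) f x ^ 2
      ≤ 2 / S.cSq b * (B * ∫ x in K, (S.realK σ f x ^ 2 + f x ^ 2)) := by
    rw [div_mul_eq_mul_div, le_div_iff₀ (hcS b)]
    linarith
  refine h2.trans ?_
  rw [mul_assoc]
  exact mul_le_mul_of_nonneg_right hAb (by positivity)

/-- The graph norm of a function cut off at a level of the energy is bounded, uniformly in the
level, by the graph norm on a sublevel set of the energy. -/
theorem EnergyBounds.exists_graphSq_energyCut_le (hE : EnergyBounds S Γ n m C) (hC : 0 ≤ C)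
    (hn : 1 < n) :
    ∃ A, 0 ≤ A ∧ ∀ R, 1 ≤ R → ∀ σ : ℝ, |σ| = 1 → ∀ f : ChainSpace N → ℝ, ContDiff ℝ ∞ f →
      S.graphSq σ (fun x => S.energyCut Γ R x * f x)
        ≤ A * ∫ x in {x | S.energy Γ x ≤ 4 * R}, (S.realK σ f x ^ 2 + f x ^ 2) := by
  obtain ⟨M, hM0, hM⟩ := hE.exists_energyCut_bound hC
  obtain ⟨A, hA0, hA⟩ := hE.exists_caccioppoli hC hn
  have hcS (b : Fin 2) := cSq_pos (S := S) b
  -- the commutator is a sum of six terms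
  set c : ℝ := ∑ b : Fin 2, S.cSq b with hc
  have hc0 : 0 ≤ c := Finset.sum_nonneg fun b _ => (hcS b).le
  have hcb (b : Fin 2) : S.cSq b ≤ c :=
    Finset.single_le_sum (f := fun b => S.cSq b) (fun b _ => (hcS b).le) (Finset.mem_univ b)
  set B : ℝ := 6 * (1 + 2 * (c * M) ^ 2 + M ^ 2) + 1 with hB
  set D : ℝ := 24 * (c * M) ^ 2 with hD
  have hB0 : 0 ≤ B := by positivity
  have hD0 : 0 ≤ D := by positivity
  refine ⟨B + 2 * (D * A), by positivity, fun R hR σ hσ f hf => ?_⟩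
  have hR0 : 0 < R := by linarith
  have hfc := hf.continuous
  have hKc := continuous_realK (S := S) hf σ
  have hpf (b : Fin 2) : Continuous (pd (r b) f) := (contDiff_pd hf).continuous
  set χ := S.energyCut Γ R with hχ
  set η := S.energyCut Γ (2 * R) with hη
  have cχ : ContDiff ℝ ∞ χ := contDiff_energyCut R
  have cη : ContDiff ℝ ∞ η := contDiff_energyCut _
  have hηc := cη.continuous
  have sχ : HasCompactSupport χ := hE.hasCompactSupport_energyCut hC hn hR0
  have sη : HasCompactSupport η := hE.hasCompactSupport_energyCut hC hn (by linarith)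
  set K : Set (ChainSpace N) := {x | S.energy Γ x ≤ 4 * R} with hK
  have Kc : IsCompact K := hE.isCompact_le hC hn _
  have Km : MeasurableSet K := Kc.isClosed.measurableSet
  have i1 : Integrable (K.indicator fun x => S.realK σ f x ^ 2 + f x ^ 2) :=
    (ContinuousOn.integrableOn_compact Kc (by fun_prop)).integrable_indicator Km
  have i2 (b : Fin 2) : Integrable fun x => η x ^ 2 * pd (r b) f x ^ 2 :=
    integrable_of_tsupport (by fun_prop) sη fun x hx => by
      simp [image_eq_zero_of_notMem_tsupport hx]
  have pw (x : ChainSpace N) : S.realK σ (fun x => χ x * f x) x ^ 2 + (χ x * f x) ^ 2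
      ≤ B * K.indicator (fun x => S.realK σ f x ^ 2 + f x ^ 2) x
        + ∑ b : Fin 2, D * (η x ^ 2 * pd (r b) f x ^ 2) := by
    rw [realK_mul σ hf cχ]
    by_cases hx : S.energy Γ x ≤ 2 * R
    · have hxK : x ∈ K := by rw [hK, Set.mem_ofPred_eq]; linarith
      rw [Set.indicator_of_mem hxK]
      have η1 : η x = 1 := energyCut_eq_one (by linarith) hx
      rw [η1]
      obtain ⟨m1, m2, m3⟩ := hM R hR x
      have e0 : 0 ≤ χ x := energyCut_nonneg R x
      have e1 : χ x ≤ 1 := energyCut_le_one R x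
      have sq1 {a k : ℝ} (ha : |a| ≤ k) (z : ℝ) : (a * z) ^ 2 ≤ k ^ 2 * z ^ 2 := by
        rw [mul_pow]
        exact mul_le_mul_of_nonneg_right (sq_le_sq' (by linarith [neg_le_of_abs_le ha])
          (le_of_abs_le ha)) (sq_nonneg _)
      have bd (b : Fin 2) {a : ℝ} (ha : |a| ≤ M) : |S.cSq b * a| ≤ c * M := by
        rw [abs_mul, abs_of_pos (hcS b)]
        exact mul_le_mul (hcb b) ha (abs_nonneg _) hc0
      have hχa : |χ x| ≤ 1 := by rw [abs_of_nonneg e0]; exact e1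
      have v1 := sq1 hχa (S.realK σ f x)
      have v2 := sq1 hχa (f x)
      have v3 (b : Fin 2) := sq1 (bd b (m1 b)) (pd (r b) f x)
      have v4 (b : Fin 2) := sq1 (bd b (m2 b)) (f x)
      have v5 := sq1 (show |σ * S.along χ x| ≤ M by rw [abs_mul, hσ, one_mul]; exact m3) (f x)
      have six (a b c d e g : ℝ) : (a - (b + c + (d + e)) - g) ^ 2
          ≤ 6 * (a ^ 2 + b ^ 2 + c ^ 2 + d ^ 2 + e ^ 2 + g ^ 2) := by
        have := sq_sum_le_card_mul_sum_sq (s := Finset.univ) (f := ![a, -b, -c, -d, -e, -g])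
        simp [Fin.sum_univ_succ] at this
        refine le_trans (le_of_eq ?_) (this.trans (le_of_eq ?_)) <;> ring
      have w := six (χ x * S.realK σ f x) (2 * (S.cSq 0 * pd (r 0) χ x * pd (r 0) f x))
        (S.cSq 0 * pd (r 0) (pd (r 0) χ) x * f x)
        (2 * (S.cSq 1 * pd (r 1) χ x * pd (r 1) f x))
        (S.cSq 1 * pd (r 1) (pd (r 1) χ) x * f x) (σ * S.along χ x * f x)
      simp only [Fin.sum_univ_two]
      have w' : (χ x * S.realK σ f x - (S.cSq 0 * (2 * pd (r 0) χ x * pd (r 0) f x +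
          pd (r 0) (pd (r 0) χ) x * f x) + S.cSq 1 * (2 * pd (r 1) χ x * pd (r 1) f x +
          pd (r 1) (pd (r 1) χ) x * f x)) - σ * S.along χ x * f x) ^ 2 ≤ _ :=
        le_trans (le_of_eq (by ring)) w
      have z1 : 0 ≤ ((c * M) ^ 2 * 12 + 6 * M ^ 2 + 1) * S.realK σ f x ^ 2 := by positivity
      have z2 : 0 ≤ 6 * f x ^ 2 := by positivity
      have v30 := v3 0
      have v31 := v3 1
      have v40 := v4 0
      have v41 := v4 1
      rw [hB, hD]
      rw [mul_pow 2, mul_pow 2] at w'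
      linarith
    · obtain ⟨d1, d2, d3⟩ := energyCut_derivs_eq_zero (S := S) (Γ := Γ) hR0 (not_le.1 hx)
      have z : χ x = 0 := energyCut_eq_zero hR0 (not_le.1 hx).le
      rw [z, d3]
      simp only [hχ, d1, d2]
      have u1 : 0 ≤ K.indicator (fun x => S.realK σ f x ^ 2 + f x ^ 2) x :=
        Set.indicator_nonneg (fun x _ => by positivity) x
      have u2 : 0 ≤ ∑ b : Fin 2, D * (η x ^ 2 * pd (r b) f x ^ 2) :=
        Finset.sum_nonneg fun b _ => by positivity
      simp
      positivity
  rw [graphSq_eq (cχ.mul hf) sχ.mul_right]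
  have i3 : Integrable fun x => B * K.indicator (fun x => S.realK σ f x ^ 2 + f x ^ 2) x
      + ∑ b : Fin 2, D * (η x ^ 2 * pd (r b) f x ^ 2) :=
    (i1.const_mul B).add (integrable_finsetSum _ fun b _ => (i2 b).const_mul D)
  refine (integral_mono ((integrable_realK_sq (cχ.mul hf) sχ.mul_right).add
    (integrable_sq (cχ.mul hf) sχ.mul_right)) i3 pw).trans ?_
  rw [integral_add (i1.const_mul B) (integrable_finsetSum _ fun b _ => (i2 b).const_mul D),
    integral_finsetSum _ fun b _ => (i2 b).const_mul D, integral_const_mul, integral_indicator Km]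
  simp only [integral_const_mul]
  have e4 : {x | S.energy Γ x ≤ 2 * (2 * R)} = K := by
    simp only [hK]; ring_nf
  have hb (b : Fin 2) := mul_le_mul_of_nonneg_left (hA (2 * R) (by linarith) σ hσ f hf b) hD0
  simp only [e4] at hb
  rw [Fin.sum_univ_two]
  linarith [hb 0, hb 1]

end OscillatorChain

end

/-! ### Mollification in `L²` -/

noncomputable section

open Filter Topology

theorem eLpNorm_two_sq {α : Type*} {mα : MeasurableSpace α} (u : α → ℝ) (μ : Measure α) :
    eLpNorm u 2 μ ^ 2 = ∫⁻ x, ‖u x‖ₑ ^ 2 ∂μ := by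
  rw [eLpNorm_eq_lintegral_rpow_enorm_toReal (by simp) (by simp), ← ENNReal.rpow_natCast,
    ← ENNReal.rpow_mul]
  simp

theorem eLpNorm_two_sq_eq_ofReal {α : Type*} {mα : MeasurableSpace α} {u : α → ℝ}
    {μ : Measure α} (hu : Integrable (fun x => u x ^ 2) μ) :
    eLpNorm u 2 μ ^ 2 = ENNReal.ofReal (∫ x, u x ^ 2 ∂μ) := by
  rw [eLpNorm_two_sq, ofReal_integral_eq_lintegral_ofReal hu (ae_of_all _ fun x => sq_nonneg _)]
  refine lintegral_congr fun x => ?_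
  rw [Real.enorm_eq_ofReal_abs, ← ENNReal.ofReal_pow (abs_nonneg _), sq_abs]

section Mollification

variable {E : Type*} [NormedAddCommGroup E] [InnerProductSpace ℝ E] [FiniteDimensional ℝ E]
  [MeasurableSpace E] [BorelSpace E]

/-- Translations are continuous in `L²`. -/
theorem tendsto_eLpNorm_translate_sub {f : E → ℝ} (hf : MemLp f 2 (volume : Measure E)) :
    Tendsto (fun z => eLpNorm (fun x => f (x - z) - f x) 2 volume) (𝓝 0) (𝓝 0) := by
  let g : C(E, C(E, E)) :=
    (ContinuousMap.mk (fun a : E × E => a.2 - a.1) (by fun_prop)).curry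
  have hmp (z : E) : MeasurePreserving (g z) volume volume := measurePreserving_sub_right volume z
  have h1 : Tendsto (fun z => Lp.compMeasurePreserving (g z) (hmp z) (hf.toLp f)) (𝓝 0)
      (𝓝 (Lp.compMeasurePreserving (g 0) (hmp 0) (hf.toLp f))) :=
    Tendsto.compMeasurePreservingLp tendsto_const_nhds (g.continuous.tendsto 0) hmp (hmp 0)
      (by simp)
  have h2 := tendsto_iff_edist_tendsto_0.1 h1
  refine h2.congr fun z => ?_
  rw [Lp.edist_def]
  refine eLpNorm_congr_ae ?_
  have e1 (z : E) : (Lp.compMeasurePreserving (g z) (hmp z) (hf.toLp f) : E → ℝ) =ᵐ[volume]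
      fun x => f (x - z) :=
    (Lp.coeFn_compMeasurePreserving _ (hmp z)).trans
      ((hmp z).quasiMeasurePreserving.ae_eq_comp hf.coeFn_toLp)
  filter_upwards [e1 z, e1 0] with x hx hx0
  rw [Pi.sub_apply, hx, hx0, sub_zero]

/-- Schur-type bound: averaging the increments of `f` against a kernel concentrated at distance at
most `δ` of the diagonal is bounded by the `L²` modulus of continuity of `f`. -/
theorem eLpNorm_integral_sub_mul_le {f : E → ℝ} (hf : Measurable f) {k : E → E → ℝ} {B : Set E}
    (hB : MeasurableSet B) {δ : ℝ} {a τ : ℝ≥0∞}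
    (hk : ∀ x ∈ B, ∀ y, ‖k x y‖ₑ ≤ (Metric.closedBall x δ).indicator (fun _ => a) y)
    (hτ : ∀ z ∈ Metric.closedBall (0 : E) δ,
      eLpNorm (fun x => f (x - z) - f x) 2 volume ≤ τ) :
    eLpNorm (fun x => ∫ y, (f y - f x) * k x y) 2 (volume.restrict B)
      ≤ a * volume (Metric.closedBall (0 : E) δ) * τ := by
  set D : Set E := Metric.closedBall (0 : E) δ with hD
  have mD : MeasurableSet D := Metric.isClosed_closedBall.measurableSet
  have pt (x : E) (hx : x ∈ B) : ‖∫ y, (f y - f x) * k x y‖ₑ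
      ≤ a * ∫⁻ z in D, ‖f (x - z) - f x‖ₑ := by
    calc ‖∫ y, (f y - f x) * k x y‖ₑ ≤ ∫⁻ y, ‖(f y - f x) * k x y‖ₑ :=
          enorm_integral_le_lintegral_enorm _
      _ = ∫⁻ z, ‖(f (x - z) - f x) * k x (x - z)‖ₑ :=
          (lintegral_sub_left_eq_self (fun y => ‖(f y - f x) * k x y‖ₑ) x).symm
      _ ≤ ∫⁻ z, D.indicator (fun z => a * ‖f (x - z) - f x‖ₑ) z := by
          refine lintegral_mono fun z => ?_
          rw [enorm_mul]
          have := hk x hx (x - z)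
          by_cases hz : z ∈ D
          · rw [Set.indicator_of_mem hz, mul_comm a]
            rw [Set.indicator_of_mem (by simpa [hD] using hz)] at this
            gcongr
          · rw [Set.indicator_of_notMem (by simpa [hD] using hz)] at this
            rw [nonpos_iff_eq_zero.1 this]
            simp
      _ = a * ∫⁻ z in D, ‖f (x - z) - f x‖ₑ := by
          rw [lintegral_indicator mD, lintegral_const_mul]
          fun_prop
  have cs (x : E) : (∫⁻ z in D, ‖f (x - z) - f x‖ₑ) ^ 2
      ≤ volume D * ∫⁻ z in D, ‖f (x - z) - f x‖ₑ ^ 2 := by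
    have h := ENNReal.lintegral_mul_le_Lp_mul_Lq (volume.restrict D)
      (Real.holderConjugate_iff.2 ⟨by norm_num, by norm_num⟩ : Real.HolderConjugate 2 2)
      (f := fun _ => 1) (g := fun z => ‖f (x - z) - f x‖ₑ) aemeasurable_const
      (by fun_prop)
    have h' := pow_le_pow_left₀ zero_le h 2
    simp only [Pi.mul_apply, one_mul, ENNReal.one_rpow, lintegral_const, Measure.restrict_apply,
      MeasurableSet.univ, Set.univ_inter, mul_pow] at h'
    rw [← ENNReal.rpow_natCast, ← ENNReal.rpow_natCast, ← ENNReal.rpow_mul, ← ENNReal.rpow_natCast,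
      ← ENNReal.rpow_mul] at h'
    simpa using h'
  have main : eLpNorm (fun x => ∫ y, (f y - f x) * k x y) 2 (volume.restrict B) ^ 2
      ≤ (a * volume D * τ) ^ 2 := by
    rw [eLpNorm_two_sq]
    calc ∫⁻ x in B, ‖∫ y, (f y - f x) * k x y‖ₑ ^ 2
        ≤ ∫⁻ x in B, a ^ 2 * (volume D * ∫⁻ z in D, ‖f (x - z) - f x‖ₑ ^ 2) := by
          refine setLIntegral_mono' hB fun x hx => ?_
          calc _ ≤ (a * ∫⁻ z in D, ‖f (x - z) - f x‖ₑ) ^ 2 := by gcongr; exact pt x hx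
            _ ≤ _ := by rw [mul_pow]; gcongr; exact cs x
      _ ≤ ∫⁻ x, a ^ 2 * (volume D * ∫⁻ z in D, ‖f (x - z) - f x‖ₑ ^ 2) :=
          setLIntegral_le_lintegral _ _
      _ = a ^ 2 * (volume D * ∫⁻ x, ∫⁻ z in D, ‖f (x - z) - f x‖ₑ ^ 2) := by
          have hm : Measurable fun x => ∫⁻ z in D, ‖f (x - z) - f x‖ₑ ^ 2 :=
            Measurable.lintegral_prod_right' (f := fun w : E × E => ‖f (w.1 - w.2) - f w.1‖ₑ ^ 2)
              (by fun_prop)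
          rw [lintegral_const_mul _ (by fun_prop), lintegral_const_mul _ hm]
      _ = a ^ 2 * (volume D * ∫⁻ z in D, ∫⁻ x, ‖f (x - z) - f x‖ₑ ^ 2) := by
          rw [lintegral_lintegral_swap]
          fun_prop
      _ ≤ a ^ 2 * (volume D * ∫⁻ _z in D, τ ^ 2) := by
          gcongr a ^ 2 * (volume D * ?_)
          refine setLIntegral_mono' mD fun z hz => ?_
          rw [← eLpNorm_two_sq]
          gcongr
          exact hτ z hz
      _ = (a * volume D * τ) ^ 2 := by
          rw [setLIntegral_const]
          ring
  exact (ENNReal.pow_right_strictMono two_ne_zero).le_iff_le.1 main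

/-- The convolution of `f` with a kernel `ρ`. -/
def mollify (ρ f : E → ℝ) (x : E) : ℝ := ∫ y, f y * ρ (x - y)

theorem mollify_eq (ρ f : E → ℝ) :
    mollify ρ f = convolution f ρ (ContinuousLinearMap.mul ℝ ℝ) volume := rfl

theorem contDiff_mollify {ρ f : E → ℝ} (hρ : ContDiff ℝ ∞ ρ) (hs : HasCompactSupport ρ)
    (hf : LocallyIntegrable f volume) : ContDiff ℝ ∞ (mollify ρ f) :=
  hs.contDiff_convolution_right (n := ⊤) (ContinuousLinearMap.mul ℝ ℝ) hf hρ

theorem integrable_mul_comp_sub {ρ f : E → ℝ} (hρ : Continuous ρ) (hs : HasCompactSupport ρ)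
    (hf : LocallyIntegrable f volume) (x : E) : Integrable fun y => f y * ρ (x - y) :=
  (hs.convolutionExists_right (ContinuousLinearMap.mul ℝ ℝ) hf hρ x)

theorem fderiv_mollify {ρ f : E → ℝ} (hρ : ContDiff ℝ ∞ ρ) (hs : HasCompactSupport ρ)
    (hf : LocallyIntegrable f volume) (x v : E) :
    fderiv ℝ (mollify ρ f) x v = mollify (fun z => fderiv ℝ ρ z v) f x := by
  have h := (hs.hasFDerivAt_convolution_right (ContinuousLinearMap.mul ℝ ℝ) hf
    (hρ.of_le (by simp)) x).fderiv
  rw [mollify_eq, h, convolution_precompR_apply _ hf (hs.fderiv ℝ)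
    (hρ.continuous_fderiv (by simp))]
  rfl

variable (E) in
/-- A fixed smooth probability density on the unit ball. -/
def unitBump : ContDiffBump (0 : E) := ⟨1 / 2, 1, by norm_num, by norm_num⟩

/-- The mollifiers: a smooth probability density rescaled to the ball of radius `δ`. -/
def mollifier (δ : ℝ) (x : E) : ℝ :=
  (δ ^ Module.finrank ℝ E)⁻¹ * (unitBump E).normed volume (δ⁻¹ • x)

theorem contDiff_mollifier (δ : ℝ) : ContDiff ℝ ∞ (mollifier (E := E) δ) :=
  contDiff_const.mul ((unitBump E).contDiff_normed.comp (contDiff_const_smul _))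

theorem mollifier_nonneg {δ : ℝ} (hδ : 0 < δ) (x : E) : 0 ≤ mollifier δ x :=
  mul_nonneg (by positivity) ((unitBump E).nonneg_normed _)

theorem mollifier_eq_zero {δ : ℝ} (hδ : 0 < δ) {x : E} (hx : x ∉ Metric.closedBall (0 : E) δ) :
    mollifier δ x = 0 := by
  have : δ⁻¹ • x ∉ Function.support ((unitBump E).normed volume) := by
    rw [ContDiffBump.support_normed_eq]
    simp only [Metric.mem_closedBall, dist_zero_right, not_le] at hx
    simp only [Metric.mem_ball, dist_zero_right, not_lt, norm_smul, norm_inv,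
      Real.norm_of_nonneg hδ.le, unitBump]
    rw [inv_mul_eq_div, one_le_div hδ]
    exact hx.le
  rw [Function.notMem_support] at this
  simp [mollifier, this]

theorem hasCompactSupport_mollifier {δ : ℝ} (hδ : 0 < δ) :
    HasCompactSupport (mollifier (E := E) δ) :=
  HasCompactSupport.intro (isCompact_closedBall 0 δ) fun _ hx => mollifier_eq_zero hδ hx

theorem integral_mollifier {δ : ℝ} (hδ : 0 < δ) : ∫ x : E, mollifier δ x = 1 := by
  simp only [mollifier]
  rw [integral_const_mul, Measure.integral_comp_smul, ContDiffBump.integral_normed,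
    inv_pow, inv_inv, abs_of_pos (by positivity), smul_eq_mul, mul_one,
    inv_mul_cancel₀ (by positivity)]

theorem fderiv_mollifier_eq_zero {δ : ℝ} (hδ : 0 < δ) {x : E}
    (hx : x ∉ Metric.closedBall (0 : E) δ) : fderiv ℝ (mollifier (E := E) δ) x = 0 := by
  have : mollifier (E := E) δ =ᶠ[𝓝 x] fun _ => 0 := by
    filter_upwards [Metric.isClosed_closedBall.isOpen_compl.mem_nhds hx] with y hy
    exact mollifier_eq_zero hδ hy
  rw [this.fderiv_eq]
  simp

variable (E) in
/-- The size of the mollifiers and of their derivatives. -/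
theorem exists_mollifier_bound : ∃ M, 0 ≤ M ∧ ∀ δ, 0 < δ → ∀ x : E,
    |mollifier δ x| ≤ M * (δ ^ Module.finrank ℝ E)⁻¹ ∧
    ‖fderiv ℝ (mollifier (E := E) δ) x‖ ≤ M * (δ ^ Module.finrank ℝ E)⁻¹ * δ⁻¹ := by
  have c := (unitBump E).contDiff_normed (μ := volume) (n := ⊤)
  have s : HasCompactSupport ((unitBump E).normed volume) := (unitBump E).hasCompactSupport_normed
  obtain ⟨M₁, h1⟩ := c.continuous.bounded_above_of_compact_support s
  obtain ⟨M₂, h2⟩ := (c.continuous_fderiv (by simp)).bounded_above_of_compact_support (s.fderiv ℝ)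
  refine ⟨max M₁ M₂, (norm_nonneg _).trans ((h1 0).trans (le_max_left _ _)), fun δ hδ x => ⟨?_, ?_⟩⟩
  · rw [mollifier, abs_mul, abs_of_nonneg (by positivity), mul_comm]
    gcongr
    exact (h1 _).trans (le_max_left _ _)
  · have hd : HasFDerivAt (mollifier (E := E) δ) ((δ ^ Module.finrank ℝ E)⁻¹ •
        ((fderiv ℝ ((unitBump E).normed volume) (δ⁻¹ • x)).comp
          (δ⁻¹ • ContinuousLinearMap.id ℝ E))) x :=
      (((c.differentiable (by simp) (δ⁻¹ • x)).hasFDerivAt).comp x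
        ((hasFDerivAt_id x).const_smul δ⁻¹)).const_mul _
    rw [hd.fderiv, norm_smul, ContinuousLinearMap.comp_smul, norm_smul,
      ContinuousLinearMap.comp_id, Real.norm_of_nonneg (by positivity),
      Real.norm_of_nonneg (by positivity)]
    have := (h2 (δ⁻¹ • x)).trans (le_max_right M₁ M₂)
    calc _ ≤ (δ ^ Module.finrank ℝ E)⁻¹ * (δ⁻¹ * max M₁ M₂) := by gcongr
      _ = _ := by ring

theorem mollify_mollifier_sub {f : E → ℝ} (hf : LocallyIntegrable f volume) {δ : ℝ} (hδ : 0 < δ)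
    (x : E) : mollify (mollifier δ) f x - f x = ∫ y, (f y - f x) * mollifier δ (x - y) := by
  have h1 := integrable_mul_comp_sub (contDiff_mollifier δ).continuous
    (hasCompactSupport_mollifier hδ) hf x
  have h2 : Integrable fun y : E => mollifier δ (x - y) :=
    ((contDiff_mollifier δ).continuous.integrable_of_hasCompactSupport
      (hasCompactSupport_mollifier hδ)).comp_sub_left x
  simp only [sub_mul]
  rw [integral_sub h1 (h2.const_mul _), integral_const_mul,
    integral_sub_left_eq_self (fun y => mollifier δ y) volume x, integral_mollifier hδ, mul_one]
  rfl

theorem integral_comp_sub_fderiv {ρ : E → ℝ} (hρ : ContDiff ℝ ∞ ρ) (hs : HasCompactSupport ρ)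
    (x v : E) : ∫ y, fderiv ℝ ρ (x - y) v = 0 := by
  have h := fderiv_mollify hρ hs (locallyIntegrable_const (1 : ℝ)) x v
  have hc : mollify ρ (fun _ => 1) = fun _ => ∫ y, ρ y := by
    funext x
    simp only [mollify, one_mul]
    exact integral_sub_left_eq_self ρ volume x
  rw [hc, fderiv_fun_const] at h
  simpa [mollify] using h.symm

theorem integrable_mul_of_hasCompactSupport {f h : E → ℝ} (hf : LocallyIntegrable f volume)
    (hc : Continuous h) (hs : HasCompactSupport h) : Integrable fun y => f y * h y := by
  simpa only [smul_eq_mul] using hf.integrable_smul_right_of_hasCompactSupport hc hs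

/-- Increments of an `L²` function averaged against kernels of the size of a mollifier tend to zero
as the kernels concentrate on the diagonal. -/
theorem tendsto_eLpNorm_integral_sub_mul {f : E → ℝ} (hf : Measurable f)
    (h2 : MemLp f 2 (volume : Measure E)) {k : ℝ → E → E → ℝ} {B : Set E} (hB : MeasurableSet B)
    {M : ℝ} (hM : ∀ δ, 0 < δ → δ ≤ 1 → ∀ x ∈ B, ∀ y,
      |k δ x y| ≤ M * (δ ^ Module.finrank ℝ E)⁻¹)
    (h0 : ∀ δ, 0 < δ → δ ≤ 1 → ∀ x ∈ B, ∀ y, y ∉ Metric.closedBall x δ → k δ x y = 0) :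
    Tendsto (fun δ => eLpNorm (fun x => ∫ y, (f y - f x) * k δ x y) 2 (volume.restrict B))
      (𝓝[>] 0) (𝓝 0) := by
  set A : ℝ≥0∞ := ENNReal.ofReal M * volume (Metric.closedBall (0 : E) 1) with hA
  have hA_top : A ≠ ⊤ :=
    ENNReal.mul_ne_top ENNReal.ofReal_ne_top (isCompact_closedBall _ _).measure_lt_top.ne
  rw [ENNReal.tendsto_nhds_zero]
  intro η hη
  obtain ⟨τ, hτ0, hτ⟩ : ∃ τ : ℝ≥0∞, 0 < τ ∧ A * τ ≤ η := by
    have h : Tendsto (fun τ : ℝ≥0∞ => A * τ) (𝓝[>] 0) (𝓝 (A * 0)) :=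
      (ENNReal.Tendsto.const_mul tendsto_id (Or.inr hA_top)).mono_left nhdsWithin_le_nhds
    rw [mul_zero, ENNReal.tendsto_nhds_zero] at h
    obtain ⟨τ, h1, h2⟩ := ((h η hη).and self_mem_nhdsWithin).exists
    exact ⟨τ, h2, h1⟩
  obtain ⟨δ₀, hδ₀, hball⟩ := Metric.eventually_nhds_iff_ball.1
    ((ENNReal.tendsto_nhds_zero.1 (tendsto_eLpNorm_translate_sub h2)) τ hτ0)
  filter_upwards [Ioo_mem_nhdsGT (lt_min hδ₀ one_pos)] with δ hδ
  obtain ⟨hδ0, hδ1⟩ := hδ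
  have hle : δ ≤ 1 := hδ1.le.trans (min_le_right _ _)
  have hpow : 0 < δ ^ Module.finrank ℝ E := by positivity
  refine (eLpNorm_integral_sub_mul_le hf hB
    (a := ENNReal.ofReal (M * (δ ^ Module.finrank ℝ E)⁻¹)) (δ := δ) (τ := τ) ?_ ?_).trans ?_
  · intro x hx y
    by_cases hy : y ∈ Metric.closedBall x δ
    · rw [Set.indicator_of_mem hy, Real.enorm_eq_ofReal_abs]
      exact ENNReal.ofReal_le_ofReal (hM δ hδ0 hle x hx y)
    · rw [Set.indicator_of_notMem hy, h0 δ hδ0 hle x hx y hy, enorm_zero]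
  · intro z hz
    exact hball z (Metric.closedBall_subset_ball (hδ1.trans_le (min_le_left _ _)) hz)
  · refine le_trans (le_of_eq ?_) hτ
    rw [Measure.addHaar_closedBall' volume _ hδ0.le, hA, ← mul_assoc, ← ENNReal.ofReal_mul' hpow.le,
      mul_assoc M, inv_mul_cancel₀ hpow.ne', mul_one]

end Mollification

end

/-! ### Mollification of weak solutions -/

noncomputable section

open Filter Topology

namespace OscillatorChain

open ChainCoord

variable {N : ℕ} (S : OscillatorChain N)

/-- `f` is a weak solution of `K† f = g`, where `K†` is the formal adjoint of `K`. -/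
def IsWeakSolution (f g : ChainSpace N → ℝ) : Prop :=
  ∀ φ : ChainSpace N → ℝ, ContDiff ℝ ∞ φ → HasCompactSupport φ →
    ∫ x, f x * S.realK 1 φ x = ∫ x, g x * φ x

/-- The zeroth-order coefficient `∑_b a_b² s_b²` of `K`. -/
def gapWeight (x : ChainSpace N) : ℝ := ∑ b : Fin 2, S.aSq b * S.bathGap b x ^ 2

/-- The kernel of the commutator between mollification and the formal adjoint of `K`: the
constant-coefficient second-order part has dropped out. -/
def commKernel (ρ : ChainSpace N → ℝ) (x y : ChainSpace N) : ℝ :=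
  (-2 * S.alphaK + (S.gapWeight x - S.gapWeight y)) * ρ (x - y)
    + fderiv ℝ ρ (x - y) (S.drift x - S.drift y)

variable {S}

theorem contDiff_gapWeight : ContDiff ℝ ∞ S.gapWeight := by
  unfold gapWeight; fun_prop

theorem fderiv_comp_const_sub {ρ : ChainSpace N → ℝ} (hρ : ContDiff ℝ ∞ ρ)
    (x y v : ChainSpace N) : fderiv ℝ (fun y => ρ (x - y)) y v = -fderiv ℝ ρ (x - y) v := by
  have h1 := (hρ.differentiable (by simp) (x - y)).hasFDerivAt
  have h2 : HasFDerivAt (fun y : ChainSpace N => x - y) (-ContinuousLinearMap.id ℝ _) y := by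
    simpa using (hasFDerivAt_id y).const_sub x
  have h3 := (h1.comp y h2).fderiv
  simp only [Function.comp_def] at h3
  rw [h3]
  simp

theorem pd_comp_const_sub {ρ : ChainSpace N → ℝ} (hρ : ContDiff ℝ ∞ ρ) (k : ChainCoord N)
    (x : ChainSpace N) : pd k (fun y => ρ (x - y)) = fun y => -pd k ρ (x - y) :=
  funext fun _ => fderiv_comp_const_sub hρ x _ _

theorem pd_pd_comp_const_sub {ρ : ChainSpace N → ℝ} (hρ : ContDiff ℝ ∞ ρ) (k : ChainCoord N)
    (x : ChainSpace N) : pd k (pd k fun y => ρ (x - y)) = fun y => pd k (pd k ρ) (x - y) := by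
  rw [pd_comp_const_sub hρ]
  have h : (fun y => -pd k ρ (x - y)) = fun y => (fun z => -pd k ρ z) (x - y) := rfl
  rw [h, pd_comp_const_sub (contDiff_pd hρ).neg]
  funext y
  simp only [pd, fderiv_fun_neg, neg_apply, neg_neg]
  rfl

theorem along_comp_const_sub {ρ : ChainSpace N → ℝ} (hρ : ContDiff ℝ ∞ ρ) (x y : ChainSpace N) :
    S.along (fun y => ρ (x - y)) y = -fderiv ℝ ρ (x - y) (S.drift y) :=
  fderiv_comp_const_sub hρ x _ _

theorem hasCompactSupport_pd {k : ChainCoord N} {ρ : ChainSpace N → ℝ}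
    (hs : HasCompactSupport ρ) : HasCompactSupport (pd k ρ) :=
  HasCompactSupport.intro hs fun _ hx => pd_eq_zero_of_notMem hx

theorem hasCompactSupport_comp_const_sub {ρ : ChainSpace N → ℝ} (hs : HasCompactSupport ρ)
    (x : ChainSpace N) : HasCompactSupport fun y => ρ (x - y) :=
  hs.comp_homeomorph (Homeomorph.subLeft x)

theorem pd_mollify {ρ f : ChainSpace N → ℝ} (hρ : ContDiff ℝ ∞ ρ) (hs : HasCompactSupport ρ)
    (hf : LocallyIntegrable f volume) (k : ChainCoord N) :
    pd k (mollify ρ f) = mollify (pd k ρ) f :=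
  funext fun x => fderiv_mollify hρ hs hf x _

/-- The formal adjoint applied to a mollification is the convolution of `f` with `K` applied to the
translated kernel, up to the commutator kernel. -/
theorem realK_mollify {ρ f : ChainSpace N → ℝ} (hρ : ContDiff ℝ ∞ ρ) (hs : HasCompactSupport ρ)
    (hf : LocallyIntegrable f volume) (x : ChainSpace N) :
    S.realK (-1) (mollify ρ f) x = ∫ y, f y * (S.realK 1 (fun y => ρ (x - y)) y
      + S.commKernel ρ x y) := by
  have I {τ : ChainSpace N → ℝ} (hc : ContDiff ℝ ∞ τ) (h : HasCompactSupport τ) :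
      Integrable fun y => f y * τ (x - y) := integrable_mul_comp_sub hc.continuous h hf x
  have i0 := (I hρ hs).const_mul (-S.alphaK + S.gapWeight x)
  have i1 (b : Fin 2) := (I (contDiff_pd (k := r b) (contDiff_pd (k := r b) hρ))
    (hasCompactSupport_pd (hasCompactSupport_pd hs))).const_mul (-S.cSq b)
  have i2 := I ((hρ.fderiv_right (m := ∞) (by simp)).clm_apply
    (contDiff_const (c := S.drift x))) (hs.fderiv_apply ℝ (S.drift x))
  have e (y : ChainSpace N) : f y * (S.realK 1 (fun y => ρ (x - y)) y + S.commKernel ρ x y) =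
      ((-S.alphaK + S.gapWeight x) * (f y * ρ (x - y))
        + -S.cSq 0 * (f y * pd (r 0) (pd (r 0) ρ) (x - y)))
        + -S.cSq 1 * (f y * pd (r 1) (pd (r 1) ρ) (x - y))
        + f y * fderiv ℝ ρ (x - y) (S.drift x) := by
    simp only [realK, commKernel, pd_pd_comp_const_sub hρ, along_comp_const_sub hρ, gapWeight,
      Fin.sum_univ_two, map_sub]
    ring
  simp only [e]
  rw [integral_add ((i0.fun_add (i1 0)).fun_add (i1 1)) i2,
    integral_add (i0.fun_add (i1 0)) (i1 1), integral_add i0 (i1 0)]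
  simp only [integral_const_mul]
  simp only [realK, along, fderiv_mollify hρ hs hf, pd_mollify hρ hs hf,
    pd_mollify (contDiff_pd hρ) (hasCompactSupport_pd hs) hf, Fin.sum_univ_two, gapWeight]
  simp only [mollify]
  ring

theorem continuous_commKernel {ρ : ChainSpace N → ℝ} (hρ : ContDiff ℝ ∞ ρ) (x : ChainSpace N) :
    Continuous (S.commKernel ρ x) := by
  have h1 := (contDiff_gapWeight (S := S)).continuous
  have h2 := (contDiff_drift (S := S)).continuous
  have h3 : Continuous (fderiv ℝ ρ) := hρ.continuous_fderiv (by simp)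
  have h4 := hρ.continuous
  unfold commKernel
  fun_prop

theorem hasCompactSupport_commKernel {ρ : ChainSpace N → ℝ} (hs : HasCompactSupport ρ)
    (x : ChainSpace N) : HasCompactSupport (S.commKernel ρ x) := by
  refine HasCompactSupport.intro ((Homeomorph.subLeft x).isCompact_preimage.2 hs) fun y hy => ?_
  have h1 : x - y ∉ tsupport ρ := hy
  have h2 : fderiv ℝ ρ (x - y) = 0 :=
    image_eq_zero_of_notMem_tsupport fun h => h1 (tsupport_fderiv_subset ℝ h)
  simp [commKernel, image_eq_zero_of_notMem_tsupport h1, h2]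

/-- The commutator of mollification with the formal adjoint of `K`, on a weak solution. -/
theorem IsWeakSolution.realK_mollify_sub {f g : ChainSpace N → ℝ} (h : S.IsWeakSolution f g)
    (hf : LocallyIntegrable f volume) {ρ : ChainSpace N → ℝ} (hρ : ContDiff ℝ ∞ ρ)
    (hs : HasCompactSupport ρ) (x : ChainSpace N) :
    S.realK (-1) (mollify ρ f) x - mollify ρ g x = ∫ y, f y * S.commKernel ρ x y := by
  have c1 : ContDiff ℝ ∞ fun y => ρ (x - y) := hρ.comp (contDiff_const.sub contDiff_id)
  have c2 := hasCompactSupport_comp_const_sub hs x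
  have i1 := integrable_mul_of_hasCompactSupport hf (continuous_realK (S := S) c1 1)
    (HasCompactSupport.intro c2 fun _ hx => realK_eq_zero_of_notMem hx)
  have i2 := integrable_mul_of_hasCompactSupport hf (continuous_commKernel (S := S) hρ x)
    (hasCompactSupport_commKernel hs x)
  rw [realK_mollify hρ hs hf]
  simp only [mul_add]
  rw [integral_add i1 i2, h _ c1 c2, mollify]
  ring

/-- The commutator kernel has total mass `W - ρ * W`, with `W` the zeroth-order coefficient of `K`:
the constant `-2 α_K` cancels against the divergence of the vector field. -/
theorem integral_commKernel {ρ : ChainSpace N → ℝ} (hρ : ContDiff ℝ ∞ ρ)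
    (hs : HasCompactSupport ρ) (hone : ∫ x, ρ x = 1) (x : ChainSpace N) :
    ∫ y, S.commKernel ρ x y = S.gapWeight x - mollify ρ S.gapWeight x := by
  have c1 : ContDiff ℝ ∞ fun y => ρ (x - y) := hρ.comp (contDiff_const.sub contDiff_id)
  have c2 := hasCompactSupport_comp_const_sub hs x
  have i1 := (c1.continuous.integrable_of_hasCompactSupport (μ := volume) c2).const_mul
    (-2 * S.alphaK + S.gapWeight x)
  have i2 := integrable_mul_comp_sub hρ.continuous hs
    ((contDiff_gapWeight (S := S)).continuous.locallyIntegrable (μ := volume)) x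
  have i3 : Integrable fun y => fderiv ℝ ρ (x - y) (S.drift x) :=
    ((((hρ.fderiv_right (m := ∞) (by simp)).clm_apply
      (contDiff_const (c := S.drift x))).continuous).integrable_of_hasCompactSupport
      (hs.fderiv_apply ℝ (S.drift x))).comp_sub_left x
  have i4 : Integrable fun y => S.along (fun y => ρ (x - y)) y :=
    (contDiff_along c1).continuous.integrable_of_hasCompactSupport
      (HasCompactSupport.intro c2 fun _ hx => along_eq_zero_of_notMem hx)
  have e (y : ChainSpace N) : S.commKernel ρ x y =
      (-2 * S.alphaK + S.gapWeight x) * ρ (x - y) - S.gapWeight y * ρ (x - y)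
        + fderiv ℝ ρ (x - y) (S.drift x) + S.along (fun y => ρ (x - y)) y := by
    rw [along_comp_const_sub hρ, commKernel, map_sub]
    ring
  simp only [e]
  have i12 : Integrable fun y => (-2 * S.alphaK + S.gapWeight x) * ρ (x - y)
      - S.gapWeight y * ρ (x - y) := i1.sub i2
  rw [integral_add (i12.fun_add i3) i4, integral_add i12 i3, integral_sub i1 i2,
    integral_const_mul, integral_along c1 c2, integral_comp_sub_fderiv hρ hs,
    integral_sub_left_eq_self ρ volume x, hone, mollify]
  ring

theorem exists_lipschitz_of_contDiff {F : Type*} [NormedAddCommGroup F] [NormedSpace ℝ F]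
    {h : ChainSpace N → F} (hh : ContDiff ℝ ∞ h) (R : ℝ) :
    ∃ L, 0 ≤ L ∧ ∀ x ∈ Metric.closedBall 0 R, ∀ y ∈ Metric.closedBall 0 R,
      ‖h x - h y‖ ≤ L * ‖x - y‖ := by
  obtain ⟨L, hL⟩ := (hh.of_le (m := 1) (by simp)).locallyLipschitz.locallyLipschitzOn
    |>.exists_lipschitzOnWith_of_compact (isCompact_closedBall (0 : ChainSpace N) R)
  exact ⟨L, L.2, fun x hx y hy => by simpa [dist_eq_norm] using hL.dist_le_mul x hx y hy⟩

/-- The commutator kernel has the size of the mollifier itself: the factor `δ⁻¹` from the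
derivative of the mollifier is compensated by the Lipschitz bound of the vector field. -/
theorem exists_commKernel_bound (R : ℝ) : ∃ M, 0 ≤ M ∧ ∀ δ, 0 < δ → δ ≤ 1 →
    ∀ x ∈ Metric.closedBall (0 : ChainSpace N) R, ∀ y,
      |S.commKernel (mollifier δ) x y| ≤ M * (δ ^ Module.finrank ℝ (ChainSpace N))⁻¹ ∧
      (y ∉ Metric.closedBall x δ → S.commKernel (mollifier δ) x y = 0) := by
  obtain ⟨M, hM0, hM⟩ := exists_mollifier_bound (ChainSpace N)
  obtain ⟨L₁, hL₁, h1⟩ := exists_lipschitz_of_contDiff (contDiff_gapWeight (S := S)) (R + 1)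
  obtain ⟨L₂, hL₂, h2⟩ := exists_lipschitz_of_contDiff (contDiff_drift (S := S)) (R + 1)
  refine ⟨(2 * |S.alphaK| + L₁ + L₂) * M, by positivity, fun δ hδ hδ1 x hx y => ?_⟩
  have hzero : y ∉ Metric.closedBall x δ → S.commKernel (mollifier δ) x y = 0 := fun hy => by
    have : x - y ∉ Metric.closedBall (0 : ChainSpace N) δ := by
      simpa [dist_eq_norm, norm_sub_rev] using hy
    simp [commKernel, mollifier_eq_zero hδ this, fderiv_mollifier_eq_zero hδ this]
  refine ⟨?_, hzero⟩
  by_cases hy : y ∈ Metric.closedBall x δ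
  · have hxy : ‖x - y‖ ≤ δ := by simpa [dist_eq_norm, norm_sub_rev] using hy
    have hx0 : ‖x‖ ≤ R := by simpa using hx
    have hx' : x ∈ Metric.closedBall (0 : ChainSpace N) (R + 1) := by
      simp only [Metric.mem_closedBall, dist_zero_right]; linarith
    have hy' : y ∈ Metric.closedBall (0 : ChainSpace N) (R + 1) := by
      have h3 := norm_sub_norm_le y x
      rw [norm_sub_rev] at h3
      simp only [Metric.mem_closedBall, dist_zero_right]; linarith
    obtain ⟨b1, b2⟩ := hM δ hδ (x - y)
    set D := (δ ^ Module.finrank ℝ (ChainSpace N))⁻¹ with hD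
    have hD0 : 0 ≤ D := by positivity
    have e1 : |S.gapWeight x - S.gapWeight y| ≤ L₁ :=
      (h1 x hx' y hy').trans (by nlinarith)
    have e2 : ‖S.drift x - S.drift y‖ ≤ L₂ * δ :=
      (h2 x hx' y hy').trans (by gcongr)
    have e3 : |-2 * S.alphaK + (S.gapWeight x - S.gapWeight y)| ≤ 2 * |S.alphaK| + L₁ := by
      refine (abs_add_le _ _).trans (add_le_add ?_ e1)
      rw [abs_mul]; norm_num
    have e4 : |fderiv ℝ (mollifier δ) (x - y) (S.drift x - S.drift y)| ≤ M * D * L₂ := by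
      calc _ ≤ ‖fderiv ℝ (mollifier δ) (x - y)‖ * ‖S.drift x - S.drift y‖ :=
            ContinuousLinearMap.le_opNorm _ _
        _ ≤ (M * D * δ⁻¹) * (L₂ * δ) := by gcongr
        _ = M * D * L₂ := by field_simp
    calc |S.commKernel (mollifier δ) x y|
        ≤ |(-2 * S.alphaK + (S.gapWeight x - S.gapWeight y)) * mollifier δ (x - y)|
          + |fderiv ℝ (mollifier δ) (x - y) (S.drift x - S.drift y)| := abs_add_le _ _
      _ ≤ (2 * |S.alphaK| + L₁) * (M * D) + M * D * L₂ := by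
          rw [abs_mul]
          gcongr
      _ = _ := by ring
  · rw [hzero hy, abs_zero]
    positivity

theorem exists_abs_gapWeight_sub_mollify_le (R : ℝ) : ∃ L, 0 ≤ L ∧ ∀ δ, 0 < δ → δ ≤ 1 →
    ∀ x ∈ Metric.closedBall (0 : ChainSpace N) R,
      |S.gapWeight x - mollify (mollifier δ) S.gapWeight x| ≤ L * δ := by
  obtain ⟨L, hL, h⟩ := exists_lipschitz_of_contDiff (contDiff_gapWeight (S := S)) (R + 1)
  refine ⟨L, hL, fun δ hδ hδ1 x hx => ?_⟩
  have hint : Integrable fun y : ChainSpace N => L * δ * mollifier δ (x - y) :=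
    (((contDiff_mollifier δ).continuous.integrable_of_hasCompactSupport
      (hasCompactSupport_mollifier hδ)).comp_sub_left x).const_mul _
  rw [abs_sub_comm, mollify_mollifier_sub
    ((contDiff_gapWeight (S := S)).continuous.locallyIntegrable (μ := volume)) hδ,
    ← Real.norm_eq_abs]
  calc _ ≤ ∫ y, L * δ * mollifier δ (x - y) := by
        refine norm_integral_le_of_norm_le hint (ae_of_all _ fun y => ?_)
        rw [norm_mul, Real.norm_of_nonneg (mollifier_nonneg hδ _)]
        by_cases hxy : x - y ∈ Metric.closedBall (0 : ChainSpace N) δ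
        · have hxy' : ‖x - y‖ ≤ δ := by simpa using hxy
          have hx0 : ‖x‖ ≤ R := by simpa using hx
          have hx' : x ∈ Metric.closedBall (0 : ChainSpace N) (R + 1) := by
            simp only [Metric.mem_closedBall, dist_zero_right]; linarith
          have hy' : y ∈ Metric.closedBall (0 : ChainSpace N) (R + 1) := by
            have h3 := norm_sub_norm_le y x
            rw [norm_sub_rev] at h3
            simp only [Metric.mem_closedBall, dist_zero_right]; linarith
          have h4 := h y hy' x hx'
          rw [norm_sub_rev y] at h4
          have := mollifier_nonneg hδ (x - y)
          gcongr
          exact h4.trans (by gcongr)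
        · simp [mollifier_eq_zero hδ hxy]
    _ = L * δ := by
        rw [integral_const_mul, integral_sub_left_eq_self (fun y => mollifier δ y) volume x,
          integral_mollifier hδ, mul_one]

theorem tendsto_eLpNorm_mollify_sub {f : ChainSpace N → ℝ} (hf : Measurable f)
    (hf2 : MemLp f 2 volume) (R : ℝ) :
    Tendsto (fun δ => eLpNorm (fun x => mollify (mollifier δ) f x - f x) 2
      (volume.restrict (Metric.closedBall 0 R))) (𝓝[>] 0) (𝓝 0) := by
  obtain ⟨M, hM0, hM⟩ := exists_mollifier_bound (ChainSpace N)
  have h := tendsto_eLpNorm_integral_sub_mul hf hf2 (k := fun δ x y => mollifier δ (x - y))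
    (B := Metric.closedBall 0 R) Metric.isClosed_closedBall.measurableSet (M := M)
    (fun δ hδ _ x _ y => (hM δ hδ (x - y)).1)
    (fun δ hδ _ x _ y hy => mollifier_eq_zero hδ (by
      simpa [dist_eq_norm, norm_sub_rev] using hy))
  refine h.congr' ?_
  filter_upwards [self_mem_nhdsWithin] with δ hδ
  simp only [mollify_mollifier_sub (hf2.locallyIntegrable (by norm_num)) hδ]

/-- A weak `L²` solution is locally the limit of smooth functions in the graph norm. -/
theorem IsWeakSolution.tendsto_eLpNorm_realK_mollify_sub {f g : ChainSpace N → ℝ}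
    (h : S.IsWeakSolution f g) (hf : Measurable f) (hf2 : MemLp f 2 volume) (hg : Measurable g)
    (hg2 : MemLp g 2 volume) (R : ℝ) :
    Tendsto (fun δ => eLpNorm (fun x => S.realK (-1) (mollify (mollifier δ) f) x - g x) 2
      (volume.restrict (Metric.closedBall 0 R))) (𝓝[>] 0) (𝓝 0) := by
  set B : Set (ChainSpace N) := Metric.closedBall 0 R with hB
  have mB : MeasurableSet B := Metric.isClosed_closedBall.measurableSet
  have lf : LocallyIntegrable f volume := hf2.locallyIntegrable (by norm_num)
  have lg : LocallyIntegrable g volume := hg2.locallyIntegrable (by norm_num)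
  obtain ⟨M, hM0, hM⟩ := exists_commKernel_bound (S := S) R
  obtain ⟨L, hL0, hL⟩ := exists_abs_gapWeight_sub_mollify_le (S := S) R
  have t1 := tendsto_eLpNorm_integral_sub_mul hf hf2
    (k := fun δ x y => S.commKernel (mollifier δ) x y) mB (M := M)
    (fun δ hδ hδ1 x hx y => (hM δ hδ hδ1 x hx y).1)
    (fun δ hδ hδ1 x hx y => (hM δ hδ hδ1 x hx y).2)
  have t2 : Tendsto (fun δ : ℝ => ENNReal.ofReal (L * δ) * eLpNorm f 2 (volume.restrict B))
      (𝓝[>] 0) (𝓝 0) := by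
    have c : Tendsto (fun δ : ℝ => ENNReal.ofReal (L * δ)) (𝓝[>] 0) (𝓝 0) := by
      have : Tendsto (fun δ : ℝ => ENNReal.ofReal (L * δ)) (𝓝 0) (𝓝 (ENNReal.ofReal (L * 0))) :=
        (ENNReal.continuous_ofReal.comp (continuous_const_mul L)).tendsto 0
      rw [mul_zero, ENNReal.ofReal_zero] at this
      exact this.mono_left nhdsWithin_le_nhds
    simpa using ENNReal.Tendsto.mul_const c (Or.inr (hf2.restrict B).eLpNorm_ne_top)
  have t3 := tendsto_eLpNorm_mollify_sub hg hg2 R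
  have t := (t1.add t2).add t3
  simp only [add_zero] at t
  refine tendsto_of_tendsto_of_tendsto_of_le_of_le' tendsto_const_nhds t
    (Eventually.of_forall fun _ => zero_le) ?_
  filter_upwards [Ioo_mem_nhdsGT one_pos] with δ hδ
  obtain ⟨hδ0, hδ1⟩ := hδ
  have cρ := contDiff_mollifier (E := ChainSpace N) δ
  have sρ := hasCompactSupport_mollifier (E := ChainSpace N) hδ0
  have cW := (contDiff_gapWeight (S := S)).continuous
  have mW : Measurable fun x => S.gapWeight x - mollify (mollifier δ) S.gapWeight x :=
    (cW.sub (contDiff_mollify cρ sρ cW.locallyIntegrable).continuous).measurable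
  have mK : Measurable (S.realK (-1) (mollify (mollifier δ) f)) :=
    (continuous_realK (contDiff_mollify cρ sρ lf) _).measurable
  have mg : Measurable (mollify (mollifier δ) g) :=
    (contDiff_mollify cρ sρ lg).continuous.measurable
  -- split the weight `f y` of the commutator kernel into `f y - f x` and `f x`
  have split (x : ChainSpace N) : ∫ y, (f y - f x) * S.commKernel (mollifier δ) x y =
      (S.realK (-1) (mollify (mollifier δ) f) x - mollify (mollifier δ) g x)
        - f x * (S.gapWeight x - mollify (mollifier δ) S.gapWeight x) := by
    have i1 := integrable_mul_of_hasCompactSupport lf (continuous_commKernel (S := S) cρ x)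
      (hasCompactSupport_commKernel sρ x)
    have i2 := ((continuous_commKernel (S := S) cρ x).integrable_of_hasCompactSupport
      (μ := volume) (hasCompactSupport_commKernel sρ x)).const_mul (f x)
    simp only [sub_mul]
    rw [integral_sub i1 i2, integral_const_mul, h.realK_mollify_sub lf cρ sρ,
      integral_commKernel cρ sρ (integral_mollifier hδ0)]
  have bound : eLpNorm (fun x => f x * (S.gapWeight x - mollify (mollifier δ) S.gapWeight x)) 2
      (volume.restrict B) ≤ ENNReal.ofReal (L * δ) * eLpNorm f 2 (volume.restrict B) := by
    refine eLpNorm_le_mul_eLpNorm_of_ae_le_mul ?_ 2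
    filter_upwards [ae_restrict_mem mB] with x hx
    rw [norm_mul, mul_comm, Real.norm_eq_abs (_ - _)]
    exact mul_le_mul_of_nonneg_right (hL δ hδ0 hδ1.le x hx) (norm_nonneg _)
  simp only [split]
  refine le_trans ?_ (add_le_add_left (add_le_add_right bound _) _)
  refine le_trans (le_of_eq ?_) ((eLpNorm_add_le (f := fun x =>
    (S.realK (-1) (mollify (mollifier δ) f) x - mollify (mollifier δ) g x))
    (g := fun x => mollify (mollifier δ) g x - g x)
    (mK.sub mg).aestronglyMeasurable (mg.sub hg).aestronglyMeasurable one_le_two).trans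
    (add_le_add_left ?_ _))
  · congr 1
    funext x
    simp
  · refine le_trans (le_of_eq ?_) (eLpNorm_add_le
      ((mK.sub mg).sub (hf.mul mW)).aestronglyMeasurable (hf.mul mW).aestronglyMeasurable
      one_le_two)
    congr 1
    funext x
    simp

end OscillatorChain

end

/-! ### The estimate for real test functions and real weak solutions -/

noncomputable section

open Filter Topology

namespace OscillatorChain

open ChainCoord

variable {N : ℕ} {S : OscillatorChain N} {Γ n m C : ℝ}

theorem le_ofReal_sqrt_mul_add {a b c : ℝ≥0∞} {D : ℝ}
    (h : a ^ 2 ≤ ENNReal.ofReal D * (b ^ 2 + c ^ 2)) : a ≤ ENNReal.ofReal (√D) * (b + c) := by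
  refine (ENNReal.pow_le_pow_left_iff two_ne_zero).1 (h.trans ?_)
  rw [mul_pow, ← ENNReal.ofReal_pow (Real.sqrt_nonneg _)]
  gcongr
  · rcases le_total 0 D with hD | hD
    · rw [Real.sq_sqrt hD]
    · exact hD.trans (sq_nonneg _)
  · calc b ^ 2 + c ^ 2 ≤ b ^ 2 + c ^ 2 + 2 * b * c := le_self_add
      _ = (b + c) ^ 2 := by ring

theorem sq_energy_rpow_mul (hG : ∀ x, 1 ≤ S.energy Γ x) (δ : ℝ) (f : ChainSpace N → ℝ)
    (x : ChainSpace N) :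
    (S.energy Γ x ^ (δ / 2) * f x) ^ 2 = S.energy Γ x ^ δ * f x ^ 2 := by
  rw [mul_pow, ← Real.rpow_natCast, ← Real.rpow_mul (by linarith [hG x])]
  norm_num

/-- Control of `G^δ` gives the weighted estimate for test functions. -/
theorem Controlled.exists_eLpNorm_le (hG : ∀ x, 1 ≤ S.energy Γ x) {δ : ℝ}
    (h : S.Controlled fun x => S.energy Γ x ^ δ) :
    ∃ D : ℝ, ∀ σ : ℝ, |σ| = 1 → ∀ f : ChainSpace N → ℝ, ContDiff ℝ ∞ f → HasCompactSupport f →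
      eLpNorm (fun x => S.energy Γ x ^ (δ / 2) * f x) 2 volume
        ≤ ENNReal.ofReal D * (eLpNorm (S.realK σ f) 2 volume + eLpNorm f 2 volume) := by
  obtain ⟨hc, A, hA, h⟩ := h
  refine ⟨√A, fun σ hσ f hf hs => le_ofReal_sqrt_mul_add ?_⟩
  rw [eLpNorm_two_sq_eq_ofReal (integrable_realK_sq hf hs),
    eLpNorm_two_sq_eq_ofReal (integrable_sq hf hs), eLpNorm_two_sq_eq_ofReal,
    ← ENNReal.ofReal_add (integral_nonneg fun _ => sq_nonneg _)
      (integral_nonneg fun _ => sq_nonneg _), ← ENNReal.ofReal_mul hA]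
  · refine ENNReal.ofReal_le_ofReal ?_
    simp only [sq_energy_rpow_mul hG]
    exact h σ hσ f hf hs
  · simp only [sq_energy_rpow_mul hG]
    exact integrable_mul_sq hc hf hs

/-- Control of `G^δ` localizes: on a sublevel set of the energy, the weighted norm is bounded by the
graph norm on a larger sublevel set, with a constant that does not depend on the level. -/
theorem EnergyBounds.exists_eLpNorm_restrict_le (hE : EnergyBounds S Γ n m C) (hC : 0 ≤ C)
    (hn : 1 < n) {δ : ℝ} (h : S.Controlled fun x => S.energy Γ x ^ δ) :
    ∃ D : ℝ, ∀ R, 1 ≤ R → ∀ f : ChainSpace N → ℝ, ContDiff ℝ ∞ f →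
      eLpNorm (fun x => S.energy Γ x ^ (δ / 2) * f x) 2
          (volume.restrict {x | S.energy Γ x ≤ R})
        ≤ ENNReal.ofReal D *
          (eLpNorm (S.realK (-1) f) 2 (volume.restrict {x | S.energy Γ x ≤ 4 * R})
            + eLpNorm f 2 (volume.restrict {x | S.energy Γ x ≤ 4 * R})) := by
  have hG := hE.one_le
  obtain ⟨hc, A, hA, h⟩ := h
  obtain ⟨B, hB, hcut⟩ := hE.exists_graphSq_energyCut_le hC hn
  refine ⟨√(A * B), fun R hR f hf => le_ofReal_sqrt_mul_add ?_⟩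
  have hR0 : 0 < R := by linarith
  set χ := S.energyCut Γ R with hχ
  have cχ : ContDiff ℝ ∞ fun x => χ x * f x := (contDiff_energyCut R).mul hf
  have sχ : HasCompactSupport fun x => χ x * f x :=
    (hE.hasCompactSupport_energyCut hC hn hR0).mul_right
  have Kc := hE.isCompact_le hC hn (4 * R)
  have i1 : IntegrableOn (fun x => S.realK (-1) f x ^ 2) {x | S.energy Γ x ≤ 4 * R} :=
    ((continuous_realK hf _).pow 2).continuousOn.integrableOn_compact Kc
  have i2 : IntegrableOn (fun x => f x ^ 2) {x | S.energy Γ x ≤ 4 * R} :=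
    (hf.continuous.pow 2).continuousOn.integrableOn_compact Kc
  have i3 := integrable_mul_sq hc cχ sχ
  rw [eLpNorm_two_sq_eq_ofReal i1, eLpNorm_two_sq_eq_ofReal i2,
    ← ENNReal.ofReal_add (integral_nonneg fun _ => sq_nonneg _)
      (integral_nonneg fun _ => sq_nonneg _), ← integral_add i1 i2,
    ← ENNReal.ofReal_mul (by positivity)]
  have mS : MeasurableSet {x | S.energy Γ x ≤ R} :=
    (hE.isCompact_le hC hn R).isClosed.measurableSet
  calc eLpNorm (fun x => S.energy Γ x ^ (δ / 2) * f x) 2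
        (volume.restrict {x | S.energy Γ x ≤ R}) ^ 2
      = eLpNorm (fun x => S.energy Γ x ^ (δ / 2) * (χ x * f x)) 2
        (volume.restrict {x | S.energy Γ x ≤ R}) ^ 2 := by
        congr 1
        refine eLpNorm_congr_ae ?_
        filter_upwards [ae_restrict_mem mS] with x hx
        rw [hχ, energyCut_eq_one hR0 hx, one_mul]
    _ ≤ eLpNorm (fun x => S.energy Γ x ^ (δ / 2) * (χ x * f x)) 2 volume ^ 2 := by
        gcongr
        exact Measure.restrict_le_self
    _ = ENNReal.ofReal (∫ x, S.energy Γ x ^ δ * (χ x * f x) ^ 2) := by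
        rw [eLpNorm_two_sq_eq_ofReal]
        · simp only [sq_energy_rpow_mul hG δ fun x => χ x * f x]
        · simpa only [sq_energy_rpow_mul hG δ fun x => χ x * f x] using i3
    _ ≤ _ := by
        refine ENNReal.ofReal_le_ofReal ((h (-1) (by simp) _ cχ sχ).trans ?_)
        rw [mul_assoc]
        exact mul_le_mul_of_nonneg_left (hcut R hR (-1) (by simp) f hf) hA

/-- Control of `G^δ` gives the weighted estimate for weak solutions. -/
theorem EnergyBounds.exists_eLpNorm_weak_le (hE : EnergyBounds S Γ n m C) (hC : 0 ≤ C)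
    (hn : 1 < n) {δ : ℝ} (hδ : 0 ≤ δ) (h : S.Controlled fun x => S.energy Γ x ^ δ) :
    ∃ D : ℝ, ∀ f g : ChainSpace N → ℝ, S.IsWeakSolution f g → Measurable f → MemLp f 2 volume →
      Measurable g → MemLp g 2 volume →
      eLpNorm (fun x => S.energy Γ x ^ (δ / 2) * f x) 2 volume
        ≤ ENNReal.ofReal D * (eLpNorm g 2 volume + eLpNorm f 2 volume) := by
  have hG := hE.one_le
  obtain ⟨D, hD⟩ := hE.exists_eLpNorm_restrict_le hC hn h
  refine ⟨D, fun f g hw mf hf mg hg => ?_⟩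
  have cw := continuous_energy_rpow (S := S) hG (δ / 2)
  have mw : Measurable fun x => S.energy Γ x ^ (δ / 2) * f x := cw.measurable.mul mf
  have lf : LocallyIntegrable f volume := hf.locallyIntegrable (by norm_num)
  have mS (R : ℝ) : MeasurableSet {x | S.energy Γ x ≤ R} :=
    (hE.isCompact_le hC hn R).isClosed.measurableSet
  -- the bound on a sublevel set, by passing to the limit in the bound for mollifications
  have loc (R : ℝ) (hR : 1 ≤ R) : eLpNorm (fun x => S.energy Γ x ^ (δ / 2) * f x) 2
      (volume.restrict {x | S.energy Γ x ≤ R})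
        ≤ ENNReal.ofReal D * (eLpNorm g 2 volume + eLpNorm f 2 volume) := by
    have hR0 : 0 ≤ R := by linarith
    obtain ⟨ϱ, hϱ⟩ := (hE.isCompact_le hC hn (4 * R)).isBounded.subset_closedBall 0
    have hsub : {x | S.energy Γ x ≤ R} ⊆ Metric.closedBall 0 ϱ := fun x hx =>
      hϱ (show S.energy Γ x ≤ 4 * R by have : S.energy Γ x ≤ R := hx; linarith)
    set B : Set (ChainSpace N) := Metric.closedBall 0 ϱ with hB
    have t1 := tendsto_eLpNorm_mollify_sub mf hf ϱ
    have t2 := hw.tendsto_eLpNorm_realK_mollify_sub mf hf mg hg ϱ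
    have t3 : Tendsto (fun η => ENNReal.ofReal (R ^ (δ / 2)) *
          eLpNorm (fun x => mollify (mollifier η) f x - f x) 2 (volume.restrict B)
        + ENNReal.ofReal D * ((eLpNorm (fun x => S.realK (-1) (mollify (mollifier η) f) x - g x) 2
            (volume.restrict B) + eLpNorm g 2 volume)
          + (eLpNorm (fun x => mollify (mollifier η) f x - f x) 2 (volume.restrict B)
            + eLpNorm f 2 volume))) (𝓝[>] 0)
        (𝓝 (ENNReal.ofReal (R ^ (δ / 2)) * 0 + ENNReal.ofReal D *
          ((0 + eLpNorm g 2 volume) + (0 + eLpNorm f 2 volume)))) :=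
      (ENNReal.Tendsto.const_mul t1 (Or.inr ENNReal.ofReal_ne_top)).add
        (ENNReal.Tendsto.const_mul ((t2.add_const _).add (t1.add_const _))
          (Or.inr ENNReal.ofReal_ne_top))
    rw [mul_zero, zero_add, zero_add, zero_add] at t3
    refine ge_of_tendsto t3 ?_
    filter_upwards [self_mem_nhdsWithin] with η hη
    have cu : ContDiff ℝ ∞ (mollify (mollifier η) f) :=
      contDiff_mollify (contDiff_mollifier η) (hasCompactSupport_mollifier hη) lf
    set u := mollify (mollifier η) f with hu
    have mu : Measurable u := cu.continuous.measurable
    have mK : Measurable (S.realK (-1) u) := (continuous_realK cu _).measurable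
    have b1 : eLpNorm (fun x => S.energy Γ x ^ (δ / 2) * f x) 2
        (volume.restrict {x | S.energy Γ x ≤ R})
        ≤ eLpNorm (fun x => S.energy Γ x ^ (δ / 2) * (f x - u x)) 2
            (volume.restrict {x | S.energy Γ x ≤ R})
          + eLpNorm (fun x => S.energy Γ x ^ (δ / 2) * u x) 2
            (volume.restrict {x | S.energy Γ x ≤ R}) := by
      refine le_trans (le_of_eq ?_) (eLpNorm_add_le
        (cw.measurable.mul (mf.sub mu)).aestronglyMeasurable
        (cw.measurable.mul mu).aestronglyMeasurable one_le_two)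
      congr 1
      funext x
      simp only [Pi.add_apply]
      exact (by ring : S.energy Γ x ^ (δ / 2) * f x
        = S.energy Γ x ^ (δ / 2) * (f x - u x) + S.energy Γ x ^ (δ / 2) * u x)
    have b2 : eLpNorm (fun x => S.energy Γ x ^ (δ / 2) * (f x - u x)) 2
        (volume.restrict {x | S.energy Γ x ≤ R})
        ≤ ENNReal.ofReal (R ^ (δ / 2)) * eLpNorm (fun x => u x - f x) 2 (volume.restrict B) := by
      refine (eLpNorm_le_mul_eLpNorm_of_ae_le_mul (c := R ^ (δ / 2))
        (g := fun x => u x - f x) ?_ 2).trans ?_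
      · filter_upwards [ae_restrict_mem (mS R)] with x hx
        have h0 : 0 ≤ S.energy Γ x := by linarith [hG x]
        rw [norm_mul, norm_sub_rev, Real.norm_of_nonneg (by positivity)]
        gcongr
      · gcongr
    have b3 : eLpNorm (S.realK (-1) u) 2 (volume.restrict {x | S.energy Γ x ≤ 4 * R})
        ≤ eLpNorm (fun x => S.realK (-1) u x - g x) 2 (volume.restrict B)
          + eLpNorm g 2 volume := by
      calc eLpNorm (S.realK (-1) u) 2 (volume.restrict {x | S.energy Γ x ≤ 4 * R})
          ≤ eLpNorm (S.realK (-1) u) 2 (volume.restrict B) := by gcongr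
        _ ≤ eLpNorm (fun x => S.realK (-1) u x - g x) 2 (volume.restrict B)
            + eLpNorm g 2 (volume.restrict B) := by
          refine le_trans (le_of_eq ?_) (eLpNorm_add_le (mK.sub mg).aestronglyMeasurable
            mg.aestronglyMeasurable one_le_two)
          congr 1
          funext x
          simp
        _ ≤ _ := by
          gcongr
          exact Measure.restrict_le_self
    have b4 : eLpNorm u 2 (volume.restrict {x | S.energy Γ x ≤ 4 * R})
        ≤ eLpNorm (fun x => u x - f x) 2 (volume.restrict B) + eLpNorm f 2 volume := by
      calc eLpNorm u 2 (volume.restrict {x | S.energy Γ x ≤ 4 * R})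
          ≤ eLpNorm u 2 (volume.restrict B) := by gcongr
        _ ≤ eLpNorm (fun x => u x - f x) 2 (volume.restrict B)
            + eLpNorm f 2 (volume.restrict B) := by
          refine le_trans (le_of_eq ?_) (eLpNorm_add_le (mu.sub mf).aestronglyMeasurable
            mf.aestronglyMeasurable one_le_two)
          congr 1
          funext x
          simp
        _ ≤ _ := by
          gcongr
          exact Measure.restrict_le_self
    exact b1.trans (add_le_add b2 ((hD R hR u cu).trans (by gcongr)))
  refine Lp.eLpNorm_le_of_ae_tendsto (u := atTop) (f := fun R : ℝ =>
    {x | S.energy Γ x ≤ R}.indicator fun x => S.energy Γ x ^ (δ / 2) * f x) ?_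
    (fun R => (mw.indicator (mS R)).aestronglyMeasurable) (ae_of_all _ fun x => ?_)
  · filter_upwards [eventually_ge_atTop 1] with R hR
    rw [eLpNorm_indicator_eq_eLpNorm_restrict (mS R)]
    exact loc R hR
  · refine tendsto_const_nhds.congr' ?_
    filter_upwards [eventually_ge_atTop (S.energy Γ x)] with R hR
    exact (Set.indicator_of_mem (s := {x | S.energy Γ x ≤ R}) hR
      fun x => S.energy Γ x ^ (δ / 2) * f x).symm

end OscillatorChain

end

/-! ### The estimate for `K` and its adjoint -/

noncomputable section

open Filter Topology

namespace OscillatorChain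

open ChainCoord

variable {N : ℕ} {S : OscillatorChain N} {Γ : ℝ}

theorem map_ofReal_mul (L : ℂ →L[ℝ] ℝ) (c : ℝ) (z : ℂ) : L (c * z) = c * L z := by
  rw [← Complex.real_smul, map_smul, smul_eq_mul]

theorem map_chainDeriv (L : ℂ →L[ℝ] ℝ) {k : ChainCoord N} {F : ChainSpace N → ℂ}
    (hF : ContDiff ℝ ∞ F) (x : ChainSpace N) :
    L (chainDeriv k F x) = pd k (fun x => L (F x)) x := by
  have h := (L.hasFDerivAt.comp x (hF.differentiable (by simp) x).hasFDerivAt).fderiv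
  simp only [Function.comp_def] at h
  rw [pd, h]
  rfl

/-- The coefficients of `K` are real, so that `K` commutes with taking real and imaginary parts. -/
theorem map_formalK (L : ℂ →L[ℝ] ℝ) {F : ChainSpace N → ℂ} (hF : ContDiff ℝ ∞ F)
    (x : ChainSpace N) : L (S.formalK F x) = S.realK 1 (fun x => L (F x)) x := by
  have h2 (k : ChainCoord N) : L (chainDeriv k (chainDeriv k F) x)
      = pd k (pd k fun x => L (F x)) x := by
    rw [map_chainDeriv L (contDiff_chainDeriv hF)]
    simp only [map_chainDeriv L hF]
  simp only [formalK, realK, along_eq, map_add, map_sub, map_sum, neg_mul, map_neg,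
    map_ofReal_mul, h2, map_chainDeriv L hF, bond]
  simp only [Finset.sum_add_distrib, Finset.sum_sub_distrib, mul_sub, Finset.sum_neg_distrib]
  ring

/-- A weighted estimate for the real and imaginary parts gives one for the function. -/
theorem eLpNorm_ofReal_mul_le {w : ChainSpace N → ℝ} {F A : ChainSpace N → ℂ} {D : ℝ≥0∞}
    (hw : Measurable w) (hF : AEStronglyMeasurable F volume)
    (h : ∀ L : ℂ →L[ℝ] ℝ, L = Complex.reCLM ∨ L = Complex.imCLM →
      eLpNorm (fun x => w x * L (F x)) 2 volume
        ≤ D * (eLpNorm (fun x => L (A x)) 2 volume + eLpNorm (fun x => L (F x)) 2 volume)) :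
    eLpNorm (fun x => (w x : ℂ) * F x) 2 volume
      ≤ 2 * D * (eLpNorm A 2 volume + eLpNorm F 2 volume) := by
  have m (L : ℂ →L[ℝ] ℝ) : AEStronglyMeasurable (fun x => w x * L (F x)) volume :=
    hw.aestronglyMeasurable.mul (L.continuous.comp_aestronglyMeasurable hF)
  have part (L : ℂ →L[ℝ] ℝ) (hL : L = Complex.reCLM ∨ L = Complex.imCLM) :
      eLpNorm (fun x => w x * L (F x)) 2 volume
        ≤ D * (eLpNorm A 2 volume + eLpNorm F 2 volume) := by
    have le (H : ChainSpace N → ℂ) :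
        eLpNorm (fun x => L (H x)) 2 volume ≤ eLpNorm H 2 volume := by
      refine eLpNorm_mono fun x => ?_
      rcases hL with rfl | rfl
      · exact Complex.abs_re_le_norm _
      · exact Complex.abs_im_le_norm _
    refine (h L hL).trans ?_
    gcongr
    · exact le A
    · exact le F
  calc eLpNorm (fun x => (w x : ℂ) * F x) 2 volume
      ≤ eLpNorm (fun x => |w x * Complex.reCLM (F x)| + |w x * Complex.imCLM (F x)|) 2
          volume := by
        refine eLpNorm_mono fun x => ?_
        rw [norm_mul, Complex.norm_real, abs_mul, abs_mul, ← mul_add, Real.norm_eq_abs (_ * _),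
          abs_of_nonneg (by positivity)]
        exact mul_le_mul_of_nonneg_left (Complex.norm_le_abs_re_add_abs_im _) (abs_nonneg _)
    _ ≤ eLpNorm (fun x => |w x * Complex.reCLM (F x)|) 2 volume
          + eLpNorm (fun x => |w x * Complex.imCLM (F x)|) 2 volume :=
        eLpNorm_add_le (m _).norm (m _).norm one_le_two
    _ = eLpNorm (fun x => w x * Complex.reCLM (F x)) 2 volume
          + eLpNorm (fun x => w x * Complex.imCLM (F x)) 2 volume := by
        congr 1
        · exact eLpNorm_norm fun x => w x * Complex.reCLM (F x)
        · exact eLpNorm_norm fun x => w x * Complex.imCLM (F x)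
    _ ≤ _ := (add_le_add (part _ (Or.inl rfl)) (part _ (Or.inr rfl))).trans_eq (by ring)

theorem minimalK_apply (φ : 𝓓((⊤ : TopologicalSpace.Opens (ChainSpace N)), ℂ)) :
    S.minimalK ⟨testToL2 N φ, φ, rfl⟩ = S.testK φ :=
  congrArg S.testK
    ((LinearEquiv.ofInjective (testToL2 N) testToL2_injective).symm_apply_apply φ)

theorem exists_opK_apply (φ : 𝓓((⊤ : TopologicalSpace.Opens (ChainSpace N)), ℂ)) :
    ∃ y : S.opK.domain, (y : ChainL2 N) = testToL2 N φ ∧ S.opK y = S.testK φ := by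
  obtain ⟨h1, h2⟩ := S.minimalK.le_closure
  have hmem : testToL2 N φ ∈ S.minimalK.domain := ⟨φ, rfl⟩
  refine ⟨⟨testToL2 N φ, h1 hmem⟩, rfl, ?_⟩
  rw [← minimalK_apply]
  exact (h2 (x := ⟨testToL2 N φ, hmem⟩) (y := ⟨testToL2 N φ, h1 hmem⟩) rfl).symm

/-- Every element of the graph of the closed operator is a limit of graph elements over test
functions. Closability is not needed: the closure of a non-closable operator is by convention
the operator itself. -/
theorem exists_seq_tendsto_opK (f : S.opK.domain) :
    ∃ φ : ℕ → 𝓓((⊤ : TopologicalSpace.Opens (ChainSpace N)), ℂ),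
      Tendsto (fun j => testToL2 N (φ j)) atTop (𝓝 (f : ChainL2 N)) ∧
      Tendsto (fun j => S.testK (φ j)) atTop (𝓝 (S.opK f)) := by
  have hmem : ((f : ChainL2 N), S.opK f) ∈ closure (S.minimalK.graph : Set (_ × _)) := by
    have h := S.opK.mem_graph f
    by_cases hc : S.minimalK.IsClosable
    · rw [← Submodule.topologicalClosure_coe, hc.graph_closure_eq_closure_graph]
      exact h
    · refine subset_closure ?_
      have : S.opK = S.minimalK := LinearPMap.closure_def' hc
      rw [← this]
      exact h
  obtain ⟨a, ha, ht⟩ := mem_closure_iff_seq_limit.1 hmem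
  have hφ (j : ℕ) : ∃ φ, testToL2 N φ = (a j).1 ∧ S.testK φ = (a j).2 := by
    obtain ⟨⟨_, φ, rfl⟩, h1, h2⟩ := S.minimalK.mem_graph_iff.1 (ha j)
    exact ⟨φ, h1, (minimalK_apply φ).symm.trans h2⟩
  choose φ h1 h2 using hφ
  refine ⟨φ, ?_, ?_⟩
  · simp only [h1]
    exact (continuous_fst.tendsto _).comp ht
  · simp only [h2]
    exact (continuous_snd.tendsto _).comp ht

theorem dense_opK_domain : Dense (S.opK.domain : Set (ChainL2 N)) := by
  refine (Lp.dense_hasCompactSupport_contDiff (F := ℂ) (p := 2) (μ := volume)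
    (E := ChainSpace N) (by simp)).mono ?_
  rintro f ⟨g, hfg, hs, hg⟩
  obtain ⟨y, hy, -⟩ := exists_opK_apply (S := S) ⟨g, hg, hs, Set.subset_univ _⟩
  have : (y : ChainL2 N) = f := by
    rw [hy]
    refine Lp.ext (Filter.EventuallyEq.trans ?_ hfg.symm)
    exact MemLp.coeFn_toLp (memLp_testFunction _)
  exact this ▸ y.2

/-- The real and imaginary parts of an element of the domain of the adjoint are weak solutions. -/
theorem isWeakSolution_adjoint (L : ℂ →L[ℝ] ℝ) (f : S.opK.adjoint.domain) :
    S.IsWeakSolution (fun x => L ((f : ChainL2 N) x)) (fun x => L (S.opK.adjoint f x)) := by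
  intro ψ hψ hs
  have cφ : ContDiff ℝ ∞ fun x => (ψ x : ℂ) := Complex.ofRealCLM.contDiff.comp hψ
  let φ : 𝓓((⊤ : TopologicalSpace.Opens (ChainSpace N)), ℂ) :=
    ⟨fun x => (ψ x : ℂ), cφ, hs.comp_left Complex.ofReal_zero, Set.subset_univ _⟩
  obtain ⟨y, hy, hKy⟩ := exists_opK_apply (S := S) φ
  have hadj := (LinearPMap.adjoint_isFormalAdjoint dense_opK_domain).symm y f
  rw [hy, hKy] at hadj
  have hK (x : ChainSpace N) : S.formalK φ x = (S.realK 1 ψ x : ℂ) := by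
    have e0 : S.realK 1 (fun _ => (0 : ℝ)) x = 0 :=
      realK_eq_zero_of_notMem (by simp [tsupport, Function.support])
    change S.formalK (fun x => (ψ x : ℂ)) x = _
    apply Complex.ext
    · have := map_formalK (S := S) Complex.reCLM cφ x
      simpa using this
    · have := map_formalK (S := S) Complex.imCLM cφ x
      simpa [e0] using this
  have key (u : ChainL2 N) (v : ChainL2 N) (ρ : ChainSpace N → ℝ)
      (hv : v =ᵐ[volume] fun x => (ρ x : ℂ)) :
      L (inner ℂ v u) = ∫ x, L (u x) * ρ x := by
    rw [L2.inner_def, ← L.integral_comp_comm (L2.integrable_inner v u)]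
    refine integral_congr_ae ?_
    filter_upwards [hv] with x hx
    rw [hx, RCLike.inner_apply, Complex.conj_ofReal, mul_comm, map_ofReal_mul, mul_comm]
  have e1 : (S.testK φ : ChainSpace N → ℂ) =ᵐ[volume] fun x => (S.realK 1 ψ x : ℂ) := by
    filter_upwards [MemLp.coeFn_toLp (S.memLp_formalK φ)] with x hx
    exact hx.trans (hK x)
  have e2 : (testToL2 N φ : ChainSpace N → ℂ) =ᵐ[volume] fun x => (ψ x : ℂ) :=
    MemLp.coeFn_toLp (memLp_testFunction φ)
  rw [← key _ _ _ e1, ← key _ _ _ e2, hadj]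

theorem ofReal_mul_norm_add (D : ℝ) (u v : ChainL2 N) :
    ENNReal.ofReal (2 * D * (‖u‖ + ‖v‖))
      = 2 * ENNReal.ofReal D * (eLpNorm u 2 volume + eLpNorm v 2 volume) := by
  rw [ENNReal.ofReal_mul' (by positivity), ENNReal.ofReal_mul (by norm_num),
    ENNReal.ofReal_add (norm_nonneg _) (norm_nonneg _), ofReal_norm, ofReal_norm, Lp.enorm_def,
    Lp.enorm_def, ENNReal.ofReal_ofNat]

end OscillatorChain

open OscillatorChain Filter Topology in
theorem mainTheorem4 (N : ℕ) (S : OscillatorChain N) (n m : ℝ)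
    (hn : 1 < n) (hA1 : PotentialGrowth S.V₁ n)
    (hm : n < m) (hA2 : PotentialGrowth S.V₂ m)
    (Γ : ℝ) (hΓ : ∀ x : ChainSpace N, 1 ≤ S.energy Γ x) :
    ∃ C ε : ℝ, 0 < ε ∧
      (∀ f : S.opK.domain,
        eLpNorm (fun x : ChainSpace N => ((S.energy Γ x ^ ε : ℝ) : ℂ) * (f : ChainL2 N) x)
            2 volume
          ≤ ENNReal.ofReal (C * (‖S.opK f‖ + ‖(f : ChainL2 N)‖))) ∧
      (∀ f : S.opK.adjoint.domain,
        eLpNorm (fun x : ChainSpace N => ((S.energy Γ x ^ ε : ℝ) : ℂ) * (f : ChainL2 N) x)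
            2 volume
          ≤ ENNReal.ofReal (C * (‖S.opK.adjoint f‖ + ‖(f : ChainL2 N)‖))) := by
  obtain ⟨C, hC, hE⟩ := exists_energyBounds hn hA1 hA2 hΓ
  obtain ⟨δ, hδ, hctrl⟩ := hE.exists_controlled_rpow hC.le hn hm hA1 hA2
  obtain ⟨D₁, hD₁⟩ := hctrl.exists_eLpNorm_le hΓ
  obtain ⟨D₂, hD₂⟩ := hE.exists_eLpNorm_weak_le hC.le hn hδ.le hctrl
  have cw := (continuous_energy_rpow (S := S) hΓ (δ / 2)).measurable
  have cwC : Measurable fun x : ChainSpace N => ((S.energy Γ x ^ (δ / 2) : ℝ) : ℂ) :=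
    Complex.measurable_ofReal.comp cw
  refine ⟨2 * max D₁ D₂, δ / 2, by positivity, fun f => ?_, fun f => ?_⟩
  · obtain ⟨φ, ht1, ht2⟩ := exists_seq_tendsto_opK f
    have test (j : ℕ) : eLpNorm (fun x : ChainSpace N =>
        ((S.energy Γ x ^ (δ / 2) : ℝ) : ℂ) * testToL2 N (φ j) x) 2 volume
        ≤ ENNReal.ofReal (2 * max D₁ D₂ * (‖S.testK (φ j)‖ + ‖testToL2 N (φ j)‖)) := by
      have e1 := MemLp.coeFn_toLp (memLp_testFunction (φ j))
      have e2 := MemLp.coeFn_toLp (S.memLp_formalK (φ j))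
      have h := eLpNorm_ofReal_mul_le (F := φ j) (A := S.formalK (φ j))
        (D := ENNReal.ofReal (max D₁ D₂)) cw (φ j).continuous.aestronglyMeasurable fun L _ => by
          have hs : HasCompactSupport fun x => L (φ j x) :=
            (φ j).hasCompactSupport.comp_left (map_zero L)
          simp only [map_formalK L (φ j).contDiff]
          refine (hD₁ 1 (by simp) (fun x => L (φ j x)) (L.contDiff.comp (φ j).contDiff) hs).trans ?_
          gcongr
          exact le_max_left _ _
      rw [ofReal_mul_norm_add]
      refine le_trans (le_of_eq ?_) (h.trans (le_of_eq ?_))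
      · refine eLpNorm_congr_ae ?_
        filter_upwards [e1] with x hx
        exact congrArg _ hx
      · rw [← eLpNorm_congr_ae e1, ← eLpNorm_congr_ae e2]
        rfl
    -- pass to the limit along an almost everywhere convergent subsequence, by Fatou's lemma
    obtain ⟨s, hs, hae⟩ := (tendstoInMeasure_of_tendsto_Lp ht1).exists_seq_tendsto_ae
    have lim := Lp.eLpNorm_lim_le_liminf_eLpNorm (p := 2) (μ := volume)
      (f := fun j x => ((S.energy Γ x ^ (δ / 2) : ℝ) : ℂ) * testToL2 N (φ (s j)) x)
      (fun j => cwC.aestronglyMeasurable.mul (Lp.aestronglyMeasurable _))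
      (fun x => ((S.energy Γ x ^ (δ / 2) : ℝ) : ℂ) * (f : ChainL2 N) x)
      (hae.mono fun x hx => hx.const_mul _)
    have hb : Tendsto (fun j => ENNReal.ofReal
        (2 * max D₁ D₂ * (‖S.testK (φ (s j))‖ + ‖testToL2 N (φ (s j))‖))) atTop
        (𝓝 (ENNReal.ofReal (2 * max D₁ D₂ * (‖S.opK f‖ + ‖(f : ChainL2 N)‖)))) :=
      ENNReal.tendsto_ofReal ((((ht2.comp hs.tendsto_atTop).norm).add
        ((ht1.comp hs.tendsto_atTop).norm)).const_mul _)
    rw [← hb.liminf_eq]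
    exact lim.trans (liminf_le_liminf (Eventually.of_forall fun j => test (s j)))
  · have m (u : ChainL2 N) (L : ℂ →L[ℝ] ℝ) : Measurable fun x => L (u x) :=
      L.measurable.comp (Lp.stronglyMeasurable u).measurable
    have m2 (u : ChainL2 N) (L : ℂ →L[ℝ] ℝ) : MemLp (fun x => L (u x)) 2 volume :=
      L.comp_memLp u
    rw [ofReal_mul_norm_add]
    refine eLpNorm_ofReal_mul_le cw (Lp.aestronglyMeasurable _) fun L _ => ?_
    refine (hD₂ _ _ (isWeakSolution_adjoint L f) (m _ L) (m2 _ L) (m _ L) (m2 _ L)).trans ?_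
    gcongr
    exact le_max_right _ _

end
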